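/- **Setting.** All vector spaces are over $\mathbb Z/2$. Let $L$ be a front diagram of a Legendrian knot or link with a Maslov potential $\mu$. Assume that $L$ is *nearly plat*: it is a small perturbation of a front in which all left cusps have the same $x$-coordinate, all right cusps have the same $x$-coordinate, and the crossings have distinct $x$-coordinates; after the perturbation all cusps and crossings have distinct $x$-coordinates. Strands over a vertical line are numbered from top to bottom. $Q(L)$ is the set of crossings and right cusps. Put $|q|=1$ for a right cusp, and $|q|=\mu(T)-\mu(B)$ for a crossing of the strands $T$, $B$, where $T$ has the smaller slope. **Morse complex sequences.** A *handleslide mark* is a vertical segment between two strands of equal Maslov potential. A *Morse complex sequence* (MCS) $\mathcal C$ on $L$ consists of finitely many handleslide marks, vertical lines $x=x_1<\dots<x_M$ which cut $L$ into tangles that contain exactly one crossing, cusp or handleslide mark each, and for each $m$ a complex $(C_m,d_m)$ with basis the strands $e_1,e_2,\dots$ over $x_m$, $|e_i|=\mu(e_i)$, $\deg d_m=-1$ and $d_me_i\in\operatorname{span}\{e_j: j>i\}$, such that: * at a crossing of the strands $k,k+1$ between $x_m$ and $x_{m+1}$, $\langle d_me_k,e_{k+1}\rangle=0$ and the transposition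 $e_k\leftrightarrow e_{k+1}$ is an isomorphism of complexes $C_m\to C_{m+1}$; * at a mark between strands $k<l$, the map $h_{k,l}$ with $e_k\mapsto e_k+e_l$ and $e_i\mapsto e_i$ for $i\ne k$ is an isomorphism of complexes $C_m\to C_{m+1}$; * at a left cusp that creates the strands $k,k+1$, $\langle d_{m+1}e_k,e_{k+1}\rangle=1$, and $e_i\mapsto[e_i]$ $(i<k)$, $e_i\mapsto[e_{i+2}]$ $(i\ge k)$ is an isomorphism of complexes from $C_m$ to $C_{m+1}/\operatorname{span}\{e_k,d_{m+1}e_k\}$; at a right cusp the same holds with $C_m$ and $C_{m+1}$ exchanged. Outside of the front the complex is zero. At a cusp of the strands $k,k+1$ let $d$ be the differential on the side of the cusp where these strands exist. The cusp is said to carry an *implicit mark* $(i,k)$ if $i<k$ and $\langle de_i,e_{k+1}\rangle=1$, and $(k+1,j)$ if $j>k+1$ and $\langle de_k,e_j\rangle=1$. **Moves.** An MCS move replaces an MCS by another one with the same marks and complexes outside of a small interval of $x$-values, and acts in this interval in one of the following ways, or in a way obtained by reflection about a horizontal or vertical axis (for moves 1–14). (1) Two equal consecutive marks appear. (2–5)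 Two consecutive marks $(i,j)$, $(k,l)$ with $j\neq k$, $l\ne i$ are interchanged. (6) Consecutive marks $(i,j),(j,k)$ become $(j,k),(i,k),(i,j)$ (from left to right). (7, 10) A mark with no end on the two crossing strands passes a crossing. (8) A mark $(l,m)$, $l<m$, to the left of a crossing of the strands $m,m+1$ becomes a mark $(l,m+1)$ to the right of it. (9, 11, 12) A mark with no end on the two cusp strands passes a cusp, changing implicit marks if it does not commute with them. (13, 14) A mark next to a cusp, with one end on a cusp strand, is absorbed: it becomes implicit if it is of the form $(i,k)$ or $(k+1,j)$, and disappears if it is of the form $(i,k+1)$ or $(k,j)$, provided that the result is an MCS. (15) If $l<m$ and $|e_l|=|e_m|-1$ in $C_p$, marks are inserted directly to the right of $x_p$: marks $(u,m)$ for all $u$ with $\langle d_pe_u,e_l\rangle=1$ and then marks $(l,v)$ for all $v$ with $\langle d_pe_m,e_v\rangle=1$ (at least one mark in total). Two MCSs are *equivalent* if they are related by a finite sequence of moves, in either direction. **Chord paths.** A *chord* $(x_m,[i,j])$ consists of a line $x_m$ and two strands $i<j$ over it. A *descending sequence* from $a\in Q(L)$ is a finite sequence of chords over consecutive lines $x_m$,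 from right to left, such that the first chord is $(x_l,[k,k+1])$, where $a$ lies between $x_l$ and $x_{l+1}$ and involves the strands $k,k+1$, and such that a chord $[i,j]$ over $x_{m+1}$ is followed by a chord over $x_m$ as follows. At a crossing of $k,k+1$, where $[i,j]\neq[k,k+1]$ is required, and at a right cusp, the chord keeps its two strands (which are renumbered). At a mark $(k,l)$ the chord stays $[i,j]$, or it jumps along the mark: $[k,j]$ to $[l,j]$ if $l<j$, or $[i,l]$ to $[i,k]$ if $i<k$. Left cusps are not passed. A *chord path* from $a$ to a crossing $b$ of the strands $k,k+1$ between $x_p$ and $x_{p+1}$ is a descending sequence from $a$ whose last chord is $(x_{p+1},[i,k])$ with $\langle d_pe_i,e_k\rangle=1$, or $(x_{p+1},[k+1,j])$ with $\langle d_pe_{k+1},e_j\rangle=1$. Let $\mathcal M^{\mathcal C}(a;b)$ be the finite set of these (empty if $b$ is a right cusp). The *linearized complex* $(A_{\mathcal C},d_1)$ is the graded vector space $A_{\mathcal C}$ with basis $Q(L)$ and $d_1a=\sum_{|b|=|a|-1}\#\mathcal M^{\mathcal C}(a;b)\,b$. **Theorem.** If $\mathcal C^+$ and $\mathcal C^-$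 are equivalent MCSs on $L$, then $(A_{\mathcal C^+},d_1^+)$ and $(A_{\mathcal C^-},d_1^-)$ are isomorphic: there is a degree-preserving linear bijection $\Phi:A_{\mathcal C^+}\to A_{\mathcal C^-}$ with $\Phi d_1^+=d_1^-\Phi$. More precisely, if $\mathcal C^-$ is obtained from $\mathcal C^+$ by a single move: * For moves 1–7 and 9–14 and their reflections, and for move 8 reflected about a vertical axis (or about both axes), the identity is such an isomorphism. * For move 8, let $q$ be the crossing that the mark $(l,m)$ passes. Then $\Phi(a)=a+\#\mathcal M^0(a)\,q$ is such an isomorphism, and $\Phi\circ\Phi=\mathrm{id}$, where $\mathcal M^0(a)$ is the set of descending sequences from $a$ in $\mathcal C^+$ that end with the chord $[l,m]$ over the line immediately to the right of $q$. The same holds for the reflection of move 8 about a horizontal axis, in which a mark $(m+1,l)$ to the left of $q$ becomes a mark $(m,l)$ to the right of it, with the chord $[m+1,l]$ instead. * For move 15, with strands $l<m$ over $x_p$, $\Phi(a)=a+\sum_{b}\#\mathcal M^0(a;b)\,b$ is such an isomorphism, and $\Phi\circ\Phi=\mathrm{id}$, where $\mathcal M^0(a;b)$ is the set of those chord paths from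 $a$ to $b$, in $\mathcal C^+$ with an additional vertical mark between $l$ and $m$ directly to the right of $x_p$ (with the complex $(C_p,d_p)$ on both sides), that jump along this mark. -/

import Mathlib

namespace LegendrianMCS

/-! ### Fronts

A front diagram whose crossings and cusps have distinct `x`-coordinates is recorded by the list of
its singularities, read from left to right.  Along every vertical line the strands are numbered
`0, 1, 2, …` from top to bottom, and `μ : List ℤ` is the list of the values of the Maslov potential
on them. -/

/-- A singularity of a front.  The number `k` says that the strands `k` and `k + 1` meet in it.  At a
left cusp, `p` is the Maslov potential of the lower strand (the upper one has potential `p + 1`);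
these values determine the Maslov potential of the front. -/
inductive Singularity where
  | leftCusp (k : ℕ) (p : ℤ)
  | crossing (k : ℕ)
  | rightCusp (k : ℕ)

namespace Singularity

/-- The strands (with their potentials) to the right of a singularity, from those to its left. -/
def act (μ : List ℤ) : Singularity → List ℤ
  | leftCusp k p => μ.take k ++ [p + 1, p] ++ μ.drop k
  | crossing k => μ.take k ++ ((μ.drop k).take 2).reverse ++ μ.drop (k + 2)
  | rightCusp k => μ.take k ++ μ.drop (k + 2)

/-- The singularity can follow the strands `μ`: the strands that meet in it exist, and at a right
cusp the upper strand has Maslov potential one more than the lower one. -/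
def Allowed (μ : List ℤ) : Singularity → Prop
  | leftCusp k _ => k ≤ μ.length
  | crossing k => k + 1 < μ.length
  | rightCusp k => k + 1 < μ.length ∧ μ.getD k 0 = μ.getD (k + 1) 0 + 1

/-- Crossings and right cusps, the singularities that give generators of the algebra. -/
def IsGenerator : Singularity → Prop
  | leftCusp _ _ => False
  | crossing _ => True
  | rightCusp _ => True

instance : DecidablePred IsGenerator
  | leftCusp _ _ => isFalse id
  | crossing _ => isTrue trivial
  | rightCusp _ => isTrue trivial

end Singularity

/-- Reading the word `w` from the strands `μ` on, every singularity is allowed and no strand is left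
at the end. -/
def WordCloses : List ℤ → List Singularity → Prop
  | μ, [] => μ = []
  | μ, s :: w => s.Allowed μ ∧ WordCloses (s.act μ) w

/-- A front diagram together with a Maslov potential. -/
structure Front where
  word : List Singularity
  closes : WordCloses [] word

namespace Front

/-- Nearly plat: a small perturbation of a front in which all left cusps have the same
`x`-coordinate and all right cusps have the same `x`-coordinate.  So first come the left cusps, then
the crossings, then the right cusps, and no strand passes between the two strands of another cusp
(an even number of strands lies above each cusp, and strands `2 i` and `2 i + 1` belong together). -/
def NearlyPlat (F : Front) : Prop :=
  ∃ L X R : List Singularity, F.word = L ++ X ++ R ∧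
    (∀ s ∈ L, ∃ k p, Even k ∧ s = .leftCusp k p) ∧
    (∀ s ∈ X, ∃ k, s = .crossing k) ∧
    (∀ s ∈ R, ∃ k, Even k ∧ s = .rightCusp k)

/-- `Q(L)`: the crossings and right cusps of the front. -/
abbrev Q (F : Front) : Type :=
  {t : Fin F.word.length // (F.word.get t).IsGenerator}

/-- The potentials of the strands immediately to the left of the singularity number `t`. -/
def strandsBefore (F : Front) (t : ℕ) : List ℤ :=
  (F.word.take t).foldl Singularity.act []

/-- The degree of a generator: `1` for a right cusp and `μ(T) - μ(B)` for a crossing, where `T` is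
the strand of smaller slope, that is, the upper strand to the left of the crossing. -/
def degree (F : Front) (q : F.Q) : ℤ :=
  match F.word.get q.1 with
  | .leftCusp _ _ => 0
  | .crossing k => (F.strandsBefore q.1).getD k 0 - (F.strandsBefore q.1).getD (k + 1) 0
  | .rightCusp _ => 1

end Front

/-! ### Ordered complexes -/

/-- An ambient space with basis `e 0, e 1, …`.  The complex over a vertical line with `n` strands is
the span of `e 0, …, e (n - 1)`; all maps below are extended to the ambient space in the obvious way
(differentials by zero, chain maps by a bijection of the remaining basis vectors). -/
abbrev StrandSpace : Type := ℕ →₀ ZMod 2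

noncomputable def e (i : ℕ) : StrandSpace := Finsupp.single i 1

/-- A graded complex over `ℤ/2` with basis `e 0, …, e (n - 1)`, where `n = deg.length` and `e i` has
degree `deg[i]`, whose differential has degree `-1` and is triangular. The coefficient
`⟨d e_i, e_j⟩` is `d (e i) j`. -/
structure OrderedComplex where
  deg : List ℤ
  d : StrandSpace →ₗ[ZMod 2] StrandSpace
  supported : ∀ i, deg.length ≤ i → d (e i) = 0
  triangular : ∀ i j, d (e i) j ≠ 0 → i < j ∧ j < deg.length
  degree : ∀ i j, d (e i) j ≠ 0 → deg.getD j 0 = deg.getD i 0 - 1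
  d_sq : d ∘ₗ d = 0

/-- The complex of a vertical line that misses the front. -/
noncomputable def OrderedComplex.zero : OrderedComplex where
  deg := []
  d := 0
  supported := by simp
  triangular := by simp
  degree := by simp
  d_sq := by simp

/-- The linear map with `e i ↦ f i`. -/
noncomputable def basisMap (f : ℕ → StrandSpace) : StrandSpace →ₗ[ZMod 2] StrandSpace :=
  Finsupp.linearCombination (ZMod 2) f

/-- `e k ↦ e k + e l`, and the other basis vectors are fixed. -/
noncomputable def handleslideMap (k l : ℕ) : StrandSpace →ₗ[ZMod 2] StrandSpace :=
  basisMap fun i => if i = k then e k + e l else e i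

/-- The transposition of the strands `k` and `k + 1`. -/
def crossingPerm (k : ℕ) : Equiv.Perm ℕ := Equiv.swap k (k + 1)

noncomputable def crossingMap (k : ℕ) : StrandSpace →ₗ[ZMod 2] StrandSpace :=
  basisMap fun i => e (crossingPerm k i)

/-- The renumbering of strands when two new strands `k` and `k + 1` are inserted. -/
def cuspShift (k i : ℕ) : ℕ := if i < k then i else i + 2

noncomputable def cuspMap (k : ℕ) : StrandSpace →ₗ[ZMod 2] StrandSpace :=
  basisMap fun i => e (cuspShift k i)

/-- `Y` has two strands more than `X`, namely `k` and `k + 1`, which meet in a cusp: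
`⟨d e_k, e_{k+1}⟩ = 1` in `Y`, and `e_i ↦ [e_i]` (`i < k`), `e_i ↦ [e_{i+2}]` (`i ≥ k`) is an
isomorphism of complexes from `X` to the quotient of `Y` by the span of `e_k` and `d e_k`. -/
def CuspRelated (k : ℕ) (X Y : OrderedComplex) : Prop :=
  let W : Submodule (ZMod 2) StrandSpace := Submodule.span (ZMod 2) {e k, Y.d (e k)}
  Y.d (e k) (k + 1) = 1 ∧
    Function.Bijective (W.mkQ ∘ₗ cuspMap k) ∧
    ∀ v, W.mkQ (cuspMap k (X.d v)) = W.mkQ (Y.d (cuspMap k v))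

/-! ### Morse complex sequences -/

/-- An elementary marked tangle: a crossing, a cusp, or an (explicit) handleslide mark between the
strands `k < l`. -/
inductive Tangle where
  | sing (s : Singularity)
  | slide (k l : ℕ)

def Tangle.sing? : Tangle → Option Singularity
  | sing s => some s
  | slide _ _ => none

/-- The complexes `X` and `Y` can stand at the left and right border of the given tangle. -/
def Fits (X : OrderedComplex) : Tangle → OrderedComplex → Prop
  | .sing (.leftCusp k p), Y =>
      (Singularity.leftCusp k p).Allowed X.deg ∧
        Y.deg = (Singularity.leftCusp k p).act X.deg ∧ CuspRelated k X Y
  | .sing (.crossing k), Y =>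
      (Singularity.crossing k).Allowed X.deg ∧
        Y.deg = (Singularity.crossing k).act X.deg ∧
        X.d (e k) (k + 1) = 0 ∧ crossingMap k ∘ₗ X.d = Y.d ∘ₗ crossingMap k
  | .sing (.rightCusp k), Y =>
      (Singularity.rightCusp k).Allowed X.deg ∧
        Y.deg = (Singularity.rightCusp k).act X.deg ∧ CuspRelated k Y X
  | .slide k l, Y =>
      k < l ∧ l < X.deg.length ∧ X.deg.getD k 0 = X.deg.getD l 0 ∧
        Y.deg = X.deg ∧ handleslideMap k l ∘ₗ X.d = Y.d ∘ₗ handleslideMap k l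

/-- An elementary marked tangle with the complex at its right border. -/
abbrev Step : Type := Tangle × OrderedComplex

/-- The tangles and complexes fit together, from the complex `X` at the left on. -/
def StepsFit : OrderedComplex → List Step → Prop
  | _, [] => True
  | X, s :: S => Fits X s.1 s.2 ∧ StepsFit s.2 S

/-- A Morse complex sequence on `F`: the sequence of elementary marked tangles into which vertical
lines `x_1 < x_2 < …` cut the front with its handleslide marks, together with the complexes over
these lines.  To the left of the first cusp there is the zero complex; for the complex over `x_1`
the condition at the first left cusp says that `⟨d_1 e_0, e_1⟩ = 1`. -/
structure MCS (F : Front) where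
  steps : List Step
  front_eq : steps.filterMap (fun s => s.1.sing?) = F.word
  fits : StepsFit OrderedComplex.zero steps

/-- The complex over the vertical line `x_m`, which has `m` tangles to its left. -/
noncomputable def complexAt (S : List Step) (m : ℕ) : OrderedComplex :=
  (OrderedComplex.zero :: S.map Prod.snd).getD m OrderedComplex.zero

/-- The tangle between `x_m` and `x_{m+1}`. -/
def tangleAt (S : List Step) (m : ℕ) : Option Tangle :=
  S[m]?.map Prod.fst

/-- The singularity number `t` of the front is `s`, and it lies between `x_m` and `x_{m+1}`. -/
def IsAt (S : List Step) (t m : ℕ) (s : Singularity) : Prop :=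
  tangleAt S m = some (.sing s) ∧ ((S.take m).filterMap (fun s => s.1.sing?)).length = t

/-! ### Chord paths and the linearized complex -/

/-- The chord `(x_pos, [top, bot])`. -/
structure Chord where
  pos : ℕ
  top : ℕ
  bot : ℕ

/-- The chord connects two existing strands over one of the lines `x_m`, the upper one first. -/
def Chord.IsIn (S : List Step) (c : Chord) : Prop :=
  c.pos ≤ S.length ∧ c.top < c.bot ∧ c.bot < (complexAt S c.pos).deg.length

/-- The possible successions of two chords of a chord path at a tangle: first the ends of the chord
at the right border, then those of the chord at the left border. A left cusp is never passed: in a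
nearly plat front it has no crossing to its left. -/
inductive ChordStep : Tangle → ℕ × ℕ → ℕ × ℕ → Prop
  | crossing (k i j : ℕ) (h : (i, j) ≠ (k, k + 1)) :
      ChordStep (.sing (.crossing k)) (i, j) (crossingPerm k i, crossingPerm k j)
  | rightCusp (k i j : ℕ) :
      ChordStep (.sing (.rightCusp k)) (i, j) (cuspShift k i, cuspShift k j)
  | stay (k l i j : ℕ) : ChordStep (.slide k l) (i, j) (i, j)
  | jumpTop (k l j : ℕ) (h : l < j) : ChordStep (.slide k l) (k, j) (l, j)
  | jumpBot (k l i : ℕ) (h : i < k) : ChordStep (.slide k l) (i, l) (i, k)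

/-- The chord `c'` may follow `c` (immediately to its left). -/
def Follows (S : List Step) (c c' : Chord) : Prop :=
  c.pos = c'.pos + 1 ∧
    ∃ T, tangleAt S c'.pos = some T ∧ ChordStep T (c.top, c.bot) (c'.top, c'.bot)

/-- The first chord is the one immediately to the left of the crossing or right cusp `t`, between
the two strands that meet there. -/
def Originates (S : List Step) (t : ℕ) (P : List Chord) : Prop :=
  ∃ m k, (IsAt S t m (.crossing k) ∨ IsAt S t m (.rightCusp k)) ∧ P.head? = some ⟨m, k, k + 1⟩

/-- All conditions on a chord path that originates at `t`, except for the one on its last chord. -/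
def IsDescending (S : List Step) (t : ℕ) (P : List Chord) : Prop :=
  (∀ c ∈ P, c.IsIn S) ∧ Originates S t P ∧ P.IsChain (Follows S)

/-- The condition on the last chord of a chord path to the crossing `t` between `x_p` and `x_{p+1}`:
it is `(x_{p+1}, [i, k])` with `⟨d_p e_i, e_k⟩ = 1`, or `(x_{p+1}, [k + 1, j])` with
`⟨d_p e_{k+1}, e_j⟩ = 1`. -/
def Terminates (S : List Step) (t : ℕ) (P : List Chord) : Prop :=
  ∃ p k c, IsAt S t p (.crossing k) ∧ P.getLast? = some c ∧ c.pos = p + 1 ∧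
    ((c.bot = k ∧ (complexAt S p).d (e c.top) k = 1) ∨
      (c.top = k + 1 ∧ (complexAt S p).d (e (k + 1)) c.bot = 1))

/-- The set of chord paths from the crossing or right cusp `a` to the crossing `b`. -/
def chordPaths (S : List Step) (a b : ℕ) : Set (List Chord) :=
  {P | IsDescending S a P ∧ Terminates S b P}

theorem finite_isIn (S : List Step) : {c : Chord | c.IsIn S}.Finite := by
  have h : (⋃ m ∈ Set.Iic S.length, ⋃ j ∈ Set.Iio (complexAt S m).deg.length,
      ⋃ i ∈ Set.Iio j, {(⟨m, i, j⟩ : Chord)}).Finite := by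
    refine (Set.finite_Iic _).biUnion fun m _ => ?_
    refine (Set.finite_Iio _).biUnion fun j _ => ?_
    exact (Set.finite_Iio _).biUnion fun i _ => Set.finite_singleton _
  refine h.subset ?_
  rintro ⟨m, i, j⟩ ⟨h1, h2, h3⟩
  simp only [Set.mem_iUnion, Set.mem_singleton_iff]
  exact ⟨m, h1, j, h3, i, h2, rfl⟩

theorem length_le_of_isChain (S : List Step) (P : List Chord) (hP : P.IsChain (Follows S)) :
    ∀ c ∈ P.head?, P.length ≤ c.pos + 1 := by
  induction P with
  | nil => simp
  | cons c P ih =>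
    cases P with
    | nil => simp
    | cons c' P =>
      rw [List.isChain_cons_cons] at hP
      have h1 := ih hP.2 c' (by simp)
      have h2 := hP.1.1
      simp only [List.length_cons, List.head?_cons, Option.mem_def, Option.some.injEq] at h1 ⊢
      rintro _ rfl
      omega

/-- There are only finitely many chord paths, so that counting them with `Set.ncard` is right. -/
theorem finite_isDescending (S : List Step) (a : ℕ) : {P | IsDescending S a P}.Finite := by
  have h : {P : List Chord | P.length ≤ S.length + 1 ∧ ∀ c ∈ P, c ∈ {c : Chord | c.IsIn S}}.Finite := by
    have := (finite_isIn S).to_subtype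
    refine ((List.finite_length_le {c : Chord | c.IsIn S} (S.length + 1)).image
      (List.map Subtype.val)).subset ?_
    rintro P ⟨h1, h2⟩
    exact ⟨P.attach.map fun c => ⟨c.1, h2 c.1 c.2⟩, by
      change List.length _ ≤ _
      simpa using h1, by simp⟩
  refine h.subset ?_
  rintro P ⟨h1, -, h3⟩
  refine ⟨?_, h1⟩
  cases P with
  | nil => simp
  | cons c P =>
    have h4 := length_le_of_isChain S _ h3 c (by simp)
    have h5 := (h1 c (by simp)).1
    omega

/-- The vector space over `ℤ/2` with basis `Q(L)`. -/
abbrev LinSpace (F : Front) : Type := F.Q →₀ ZMod 2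

/-- The linear map `a ↦ ∑ b, n a b • b`. -/
noncomputable def ofCounts {F : Front} (n : F.Q → F.Q → ZMod 2) : LinSpace F →ₗ[ZMod 2] LinSpace F :=
  Finsupp.linearCombination (ZMod 2) fun a => ∑ b : F.Q, n a b • Finsupp.single b 1

open Classical in
/-- The linear part `d_1` of the differential: `d_1 a = ∑ #M(a; b) b`, the sum over all `b` with
`|b| = |a| - 1`. -/
noncomputable def d₁ {F : Front} (C : MCS F) : LinSpace F →ₗ[ZMod 2] LinSpace F :=
  ofCounts fun a b =>
    if F.degree b = F.degree a - 1 then ((chordPaths C.steps a.1 b.1).ncard : ZMod 2) else 0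

/-- `Φ` is an isomorphism from the linearized complex of `C` to that of `D`: it is bijective,
preserves degrees and commutes with the differentials. -/
def IsLinearizedIso {F : Front} (C D : MCS F) (Φ : LinSpace F →ₗ[ZMod 2] LinSpace F) : Prop :=
  Function.Bijective Φ ∧
    (∀ a b : F.Q, Φ (Finsupp.single a 1) b ≠ 0 → F.degree b = F.degree a) ∧
    Φ ∘ₗ d₁ C = d₁ D ∘ₗ Φ

/-! ### Moves and equivalence

A move changes an MCS in a short interval of `x`-values.  Outside of it, the handleslide marks and
the complexes stay the same.  Recall that the complex right after a left cusp `k` is recorded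
graphically by implicit handleslide marks, from `i` to `k` if `⟨d e_i, e_{k+1}⟩ = 1` and from `k + 1`
to `j` if `⟨d e_k, e_j⟩ = 1`, and similarly at right cusps. So changing implicit marks means
changing that complex. -/

/-- The types of moves, including their reflections. -/
inductive MoveType where
  /-- Two equal handleslide marks in succession appear or disappear. -/
  | cancel
  /-- Two handleslide marks are interchanged (disjoint, interleaved, nested, or with a common upper
  or a common lower strand). -/
  | commute
  /-- Marks `(i, j)` and `(j, k)` are interchanged, with a new mark `(i, k)`. -/
  | commutator
  /-- A mark passes a crossing, and none of its ends lies on the crossing strands. -/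
  | pastCrossing
  /-- A mark between `l` and `m` to the left of a crossing of `m` and `m + 1`, where `l < m`, moves to
  the right of it. -/
  | crossingEnd (l m : ℕ)
  /-- The reflection of the preceding move about a horizontal axis: a mark between `m + 1` and
  `l > m + 1` to the left of a crossing of `m` and `m + 1` moves to the right of it. -/
  | crossingEndHor (l m : ℕ)
  /-- The reflections of the two preceding moves about a vertical axis. -/
  | crossingEndVert
  /-- An explicit mark with no end on the two strands of a cusp passes the cusp, and possibly
  changes implicit marks when it commutes past them. -/
  | pastCusp
  /-- An explicit mark with one end on the strands of a cusp becomes an implicit mark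
  (from `i` to `k`, or from `k + 1` to `j`), or disappears (from `i` to `k + 1`, or from `k` to `j`),
  whenever the result is again a Morse complex sequence. Other implicit marks may be present. -/
  | cuspEnd
  /-- Marks appear at a line `x_p`: from all `u` with `⟨d_p e_u, e_l⟩ = 1` to `m`, and from `l` to
  all `v` with `⟨d_p e_m, e_v⟩ = 1`. Here `l < m` and `|e_l| = |e_m| - 1`. -/
  | explosion (l m : ℕ)

/-- `LocalMove κ W old new`: the tangles `old` to the right of the complex `W` are replaced by
`new`. The intermediate complexes of `old` and `new` are not constrained here, because they will be
parts of Morse complex sequences. -/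
inductive LocalMove : MoveType → OrderedComplex → List Step → List Step → Prop
  | cancel (W X Y : OrderedComplex) (i j : ℕ) :
      LocalMove .cancel W [] [(.slide i j, X), (.slide i j, Y)]
  | commute (W X X' Y : OrderedComplex) (i j k l : ℕ) (h₁ : j ≠ k) (h₂ : l ≠ i) :
      LocalMove .commute W [(.slide i j, X), (.slide k l, Y)] [(.slide k l, X'), (.slide i j, Y)]
  | commutator (W X X₁ X₂ Y : OrderedComplex) (i j k : ℕ) :
      LocalMove .commutator W [(.slide i j, X), (.slide j k, Y)]
        [(.slide j k, X₁), (.slide i k, X₂), (.slide i j, Y)]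
  | commutatorRefl (W X X₁ X₂ Y : OrderedComplex) (i j k : ℕ) :
      LocalMove .commutator W [(.slide j k, X), (.slide i j, Y)]
        [(.slide i j, X₁), (.slide i k, X₂), (.slide j k, Y)]
  | pastCrossing (W X X' Y : OrderedComplex) (i j k : ℕ)
      (hi : i ≠ k ∧ i ≠ k + 1) (hj : j ≠ k ∧ j ≠ k + 1) :
      LocalMove .pastCrossing W [(.slide i j, X), (.sing (.crossing k), Y)]
        [(.sing (.crossing k), X'), (.slide i j, Y)]
  | crossingEnd (W X X' Y : OrderedComplex) (l m : ℕ) (h : l < m) :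
      LocalMove (.crossingEnd l m) W [(.slide l m, X), (.sing (.crossing m), Y)]
        [(.sing (.crossing m), X'), (.slide l (m + 1), Y)]
  | crossingEndHor (W X X' Y : OrderedComplex) (l m : ℕ) (h : m + 1 < l) :
      LocalMove (.crossingEndHor l m) W [(.slide (m + 1) l, X), (.sing (.crossing m), Y)]
        [(.sing (.crossing m), X'), (.slide m l, Y)]
  | crossingEndVert (W X X' Y : OrderedComplex) (l m : ℕ) (h : l < m) :
      LocalMove .crossingEndVert W [(.slide l (m + 1), X), (.sing (.crossing m), Y)]
        [(.sing (.crossing m), X'), (.slide l m, Y)]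
  | crossingEndHorVert (W X X' Y : OrderedComplex) (l m : ℕ) (h : m + 1 < l) :
      LocalMove .crossingEndVert W [(.slide m l, X), (.sing (.crossing m), Y)]
        [(.sing (.crossing m), X'), (.slide (m + 1) l, Y)]
  | pastLeftCusp (W X X' Y : OrderedComplex) (i j k : ℕ) (p : ℤ) :
      LocalMove .pastCusp W
        [(.sing (.leftCusp k p), X), (.slide (cuspShift k i) (cuspShift k j), Y)]
        [(.slide i j, X'), (.sing (.leftCusp k p), Y)]
  | pastRightCusp (W X X' Y : OrderedComplex) (i j k : ℕ) :
      LocalMove .pastCusp W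
        [(.slide (cuspShift k i) (cuspShift k j), X), (.sing (.rightCusp k), Y)]
        [(.sing (.rightCusp k), X'), (.slide i j, Y)]
  | leftCuspEnd (W X Y : OrderedComplex) (i j k : ℕ) (p : ℤ)
      (h : i = k ∨ i = k + 1 ∨ j = k ∨ j = k + 1) :
      LocalMove .cuspEnd W [(.sing (.leftCusp k p), X), (.slide i j, Y)]
        [(.sing (.leftCusp k p), Y)]
  | rightCuspEnd (W X Y : OrderedComplex) (i j k : ℕ)
      (h : i = k ∨ i = k + 1 ∨ j = k ∨ j = k + 1) :
      LocalMove .cuspEnd W [(.slide i j, X), (.sing (.rightCusp k), Y)]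
        [(.sing (.rightCusp k), Y)]
  | explosion (W : OrderedComplex) (l m : ℕ) (us vs : List ℕ) (new : List Step)
      (hlm : l < m) (hm : m < W.deg.length) (hdeg : W.deg.getD l 0 = W.deg.getD m 0 - 1)
      (hus : us.Nodup) (hu : ∀ u, u ∈ us ↔ W.d (e u) l = 1)
      (hvs : vs.Nodup) (hv : ∀ v, v ∈ vs ↔ W.d (e m) v = 1)
      (hne : us ++ vs ≠ [])
      (hnew : new.map Prod.fst = us.map (fun u => .slide u m) ++ vs.map (fun v => .slide l v)) :
      LocalMove (.explosion l m) W [] new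

/-- `D` is obtained from `C` by a move of type `κ` immediately to the right of `x_p`. -/
def Move {F : Front} (κ : MoveType) (p : ℕ) (C D : MCS F) : Prop :=
  ∃ pre old new post : List Step, pre.length = p ∧
    C.steps = pre ++ old ++ post ∧ D.steps = pre ++ new ++ post ∧
    LocalMove κ (complexAt C.steps p) old new

/-- Equivalence of Morse complex sequences: they are connected by a finite sequence of moves, each
of which may be performed in either direction. -/
def Equivalent {F : Front} : MCS F → MCS F → Prop :=
  Relation.EqvGen fun C D => ∃ κ p, Move κ p C D

/-- The moves for which the identity map is an isomorphism of the linearized complexes. -/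
def MoveType.IsPlain : MoveType → Prop
  | crossingEnd _ _ => False
  | crossingEndHor _ _ => False
  | explosion _ _ => False
  | _ => True

/-! ### The isomorphisms for the other moves -/

open Classical in
/-- If `k` is the crossing of the strands `m` and `m + 1` between `x_{p+1}` and `x_{p+2}`, the number
mod `2` of sequences of chords that originate at `a`, satisfy all conditions on the succession of
chords of a chord path, and end with the chord `(x_{p+2}, [i, j])` just to the right of `k`. For all
other `k` the number is `0`. -/
noncomputable def crossingCount {F : Front} (C : MCS F) (p m i j : ℕ) (a k : F.Q) : ZMod 2 :=
  if IsAt C.steps k.1 (p + 1) (.crossing m) then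
    ({P | IsDescending C.steps a.1 P ∧ P.getLast? = some ⟨p + 2, i, j⟩}.ncard : ZMod 2)
  else 0

/-- The tangles of `C` with an additional vertical mark between `l` and `m` to the right of `x_p`;
on both sides of it there is the complex `(C_p, d_p)`. -/
noncomputable def withMark {F : Front} (C : MCS F) (p l m : ℕ) : List Step :=
  C.steps.take p ++ [(.slide l m, complexAt C.steps p)] ++ C.steps.drop p

/-- The number mod `2` of those chord paths from `a` to `b`, in `C` with an additional mark between
`l` and `m` to the right of `x_p`, that jump along this mark. -/
noncomputable def markCount {F : Front} (C : MCS F) (p l m : ℕ) (a b : F.Q) : ZMod 2 :=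
  ({P | P ∈ chordPaths (withMark C p l m) a.1 b.1 ∧
    ∃ i j i' j', (⟨p + 1, i, j⟩ : Chord) ∈ P ∧ (⟨p, i', j'⟩ : Chord) ∈ P ∧
      (i, j) ≠ (i', j')}.ncard : ZMod 2)

end LegendrianMCS

/-!
The proof is dual to the picture of chord paths.  Functionals on the chords `[i, j]` over a vertical
line are the same as strictly triangular endomorphisms `φ` of the complex over this line: the value
on `[i, j]` is the coefficient `⟨φ e_i, e_j⟩`.  The rules for the succession of two chords turn into
a transfer of functionals from left to right (`transfer`, `Represents.transfer`).  At a handleslide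
mark it is conjugation by the handleslide map.  At a crossing of the strands `k`, `k + 1` it is
conjugation by the transposition, followed by the removal of the coefficient from `k + 1` to `k`
that arises from `[k, k + 1]`.  At a right cusp it is compression.

The condition on the last chord of a chord path to a crossing is the functional `∂E`, where
`E : e (k + 1) ↦ e k` and `∂φ = d φ + φ d` is the differential of the endomorphism complex
(`birth`).  Since what is removed at a crossing is a multiple of `E`, transfer past a crossing is a
chain map up to a multiple of `∂E` (`bd_transfer_crossing`).  By induction along the front, the map
`readOff`, which sends a functional to its values on all the sequences of chords that come from the
right, intertwines `∂` with the matrix of chord path counts (`readOff_bd`).  This is where nearly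
plat fronts are needed: among the right cusps only coefficients from `2 i` to `2 i + 1` are seen,
and for products of strictly triangular operators these vanish.

The moves are now computations with operators.  The moves for which the identity is an isomorphism
do not change the values that `readOff` extracts (`LocalMove.agree`).  In the two moves of a mark
past a crossing with a nontrivial isomorphism, conjugation by the mark changes `E` to `E + Z` with an
elementary operator `Z` that represents the chord in the theorem.  In the explosion, all marks
together are conjugation by `1 + ∂G` with `G : e l ↦ e m`, which is chain homotopic to the identity
with homotopy `[G, ·]` (`conj_one_add_bd`), and `[G, ·]` is also what a jump along a mark from `l` to
`m` does (`Represents.jump`).  In each case the new matrix of counts is the conjugate of the old one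
by the identity plus a matrix of square zero (`pathCoeff_correction`).

Degrees take care of themselves: all operators are homogeneous, so that chord paths exist only
between generators of the right degrees (`d₁_eq`).
-/

namespace LegendrianMCS

/-! ### Operators on the space of strands -/

/-- Endomorphisms of the space of strands.  A functional on the chords over a vertical line is
encoded as the operator whose matrix coefficient from `e i` to `e j` is its value on `[i, j]`. -/
abbrev Op : Type := Module.End (ZMod 2) StrandSpace

theorem Op.ext_basis {φ ψ : Op} (h : ∀ i, φ (e i) = ψ (e i)) : φ = ψ := by
  refine Finsupp.lhom_ext' fun i => LinearMap.ext_ring ?_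
  exact h i

theorem Op.add_self (φ : Op) : φ + φ = 0 := by
  rw [← two_smul (ZMod 2) φ]
  have : (2 : ZMod 2) = 0 := rfl
  rw [this, zero_smul]

/-- The matrix coefficient `⟨φ e_i, e_j⟩`. -/
noncomputable def entry (i j : ℕ) : Op →ₗ[ZMod 2] ZMod 2 :=
  Finsupp.lapply j ∘ₗ LinearMap.applyₗ (e i)

@[simp] theorem entry_apply (i j : ℕ) (φ : Op) : entry i j φ = φ (e i) j := rfl

/-- The operator with `e i ↦ e j` that kills the other basis vectors. -/
noncomputable def elem (i j : ℕ) : Op := basisMap fun a => if a = i then e j else 0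

theorem basisMap_e (f : ℕ → StrandSpace) (i : ℕ) : basisMap f (e i) = f i := by
  simp [basisMap, e]

@[simp] theorem elem_e (i j a : ℕ) : elem i j (e a) = if a = i then e j else 0 := basisMap_e _ _

theorem e_apply (i j : ℕ) : e i j = if i = j then 1 else 0 := by
  simp [e, Finsupp.single_apply]

theorem elem_mul_elem (i j k l : ℕ) : elem i j * elem k l = if l = i then elem k j else 0 := by
  apply Op.ext_basis
  intro a
  by_cases h : l = i <;> by_cases h' : a = k <;> simp [h, h']

theorem handleslideMap_eq (k l : ℕ) : handleslideMap k l = 1 + elem k l := by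
  apply Op.ext_basis
  intro a
  rw [handleslideMap, basisMap_e]
  by_cases h : a = k <;> simp [h]

theorem handleslideMap_mul_self {k l : ℕ} (h : k ≠ l) :
    (handleslideMap k l * handleslideMap k l : Op) = 1 := by
  have h1 : elem k l * elem k l = 0 := by rw [elem_mul_elem, if_neg h.symm]
  rw [handleslideMap_eq, mul_add, mul_one, add_mul, one_mul, h1, add_zero, add_assoc, Op.add_self,
    add_zero]

theorem apply_eq_sum (φ : Op) (v : StrandSpace) (j : ℕ) :
    φ v j = v.sum fun r x => x * φ (e r) j := by
  induction v using Finsupp.induction_linear with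
  | zero => simp
  | add v w hv hw =>
    rw [map_add, Finsupp.add_apply, hv, hw, Finsupp.sum_add_index'] <;> simp [add_mul]
  | single r x =>
    rw [Finsupp.sum_single_index (by simp)]
    have : Finsupp.single r x = x • e r := by simp [e]
    rw [this, map_smul]; rfl

theorem elem_apply (i j : ℕ) (v : StrandSpace) : elem i j v = v i • e j := by
  induction v using Finsupp.induction_linear with
  | zero => simp
  | add v w hv hw => rw [map_add, hv, hw, Finsupp.add_apply, add_smul]
  | single r x =>
    have : Finsupp.single r x = x • e r := by simp [e]
    rw [this, map_smul, elem_e]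
    by_cases h : r = i <;> simp [h, e_apply]

theorem crossingMap_e (k i : ℕ) : crossingMap k (e i) = e (crossingPerm k i) := basisMap_e _ _

theorem crossingPerm_crossingPerm (k i : ℕ) : crossingPerm k (crossingPerm k i) = i := by
  simp [crossingPerm]

theorem crossingMap_mul_self (k : ℕ) : (crossingMap k * crossingMap k : Op) = 1 := by
  apply Op.ext_basis
  intro i
  rw [Module.End.mul_apply, crossingMap_e, crossingMap_e, crossingPerm_crossingPerm]; rfl

theorem crossingMap_apply (k : ℕ) (v : StrandSpace) (j : ℕ) :
    crossingMap k v j = v (crossingPerm k j) := by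
  induction v using Finsupp.induction_linear with
  | zero => simp
  | add v w hv hw => rw [map_add, Finsupp.add_apply, Finsupp.add_apply, hv, hw]
  | single r x =>
    have : Finsupp.single r x = x • e r := by simp [e]
    rw [this, map_smul, crossingMap_e, Finsupp.smul_apply, Finsupp.smul_apply, e_apply, e_apply]
    have : crossingPerm k r = j ↔ r = crossingPerm k j :=
    ⟨fun h => by rw [← h, crossingPerm_crossingPerm],
      fun h => by rw [h, crossingPerm_crossingPerm]⟩
    simp only [this]

theorem crossingMap_conj_elem (k i j : ℕ) :
    crossingMap k * elem i j * crossingMap k = elem (crossingPerm k i) (crossingPerm k j) := by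
  apply Op.ext_basis
  intro a
  have : crossingPerm k a = i ↔ a = crossingPerm k i :=
    ⟨fun h => by rw [← h, crossingPerm_crossingPerm],
      fun h => by rw [h, crossingPerm_crossingPerm]⟩
  simp only [Module.End.mul_apply, crossingMap_e, elem_e, this]
  split_ifs <;> simp [crossingMap_e]

theorem crossingMap_conj_handleslideMap (k i j : ℕ) :
    crossingMap k * handleslideMap i j * crossingMap k =
      handleslideMap (crossingPerm k i) (crossingPerm k j) := by
  rw [handleslideMap_eq, handleslideMap_eq, mul_add, add_mul, mul_one, crossingMap_mul_self,
    crossingMap_conj_elem]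

theorem handleslideMap_apply (k l : ℕ) (v : StrandSpace) (j : ℕ) :
    handleslideMap k l v j = v j + if j = l then v k else 0 := by
  rw [handleslideMap_eq, LinearMap.add_apply, elem_apply]
  simp [e_apply, eq_comm]

theorem cuspShift_strictMono (k : ℕ) : StrictMono (cuspShift k) := by
  intro i j h
  simp only [cuspShift]
  split_ifs <;> omega

/-- The coordinate projection onto the strands other than `k` and `k + 1`, renumbered. -/
noncomputable def cuspProj (k : ℕ) : StrandSpace →ₗ[ZMod 2] StrandSpace :=
  Finsupp.lcomapDomain (cuspShift k) (cuspShift_strictMono k).injective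

theorem cuspProj_apply (k : ℕ) (v : StrandSpace) (j : ℕ) : cuspProj k v j = v (cuspShift k j) := rfl

theorem cuspMap_e (k i : ℕ) : cuspMap k (e i) = e (cuspShift k i) := basisMap_e _ _

/-! ### Strictly triangular operators -/

/-- Strictly triangular: `φ e_i` lies in the span of the `e_j` with `j > i`.  These operators
encode the functionals on the chords `[i, j]`, `i < j`. -/
def StrictTri (φ : Op) : Prop := ∀ i j, φ (e i) j ≠ 0 → i < j

theorem StrictTri.eq_zero {φ : Op} (h : StrictTri φ) {i j : ℕ} (hij : j ≤ i) : φ (e i) j = 0 := by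
  by_contra h'
  exact absurd (h i j h') (by omega)

theorem StrictTri.add {φ ψ : Op} (hφ : StrictTri φ) (hψ : StrictTri ψ) : StrictTri (φ + ψ) := by
  intro i j h
  by_contra h'
  apply h
  rw [LinearMap.add_apply, Finsupp.add_apply, hφ.eq_zero (by omega),
    hψ.eq_zero (by omega), add_zero]

theorem StrictTri.zero : StrictTri 0 := by
  intro i j h
  simp at h

theorem StrictTri.elem {i j : ℕ} (h : i < j) : StrictTri (elem i j) := by
  intro a b hab
  rw [elem_e] at hab
  split_ifs at hab with h1
  · rw [e_apply] at hab
    split_ifs at hab with h2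
    · omega
    · simp at hab
  · simp at hab

theorem OrderedComplex.strictTri (X : OrderedComplex) : StrictTri X.d :=
  fun i j h => (X.triangular i j h).1

theorem OrderedComplex.d_mul_d (X : OrderedComplex) : (X.d * X.d : Op) = 0 := X.d_sq

/-- A product of two strictly triangular operators raises the index by at least two. -/
theorem StrictTri.lt_of_mul {φ ψ : Op} (hφ : StrictTri φ) (hψ : StrictTri ψ) {i j : ℕ}
    (h : (φ * ψ) (e i) j ≠ 0) : i + 1 < j := by
  rw [Module.End.mul_apply, apply_eq_sum] at h
  obtain ⟨r, -, h2⟩ := Finset.exists_ne_zero_of_sum_ne_zero h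
  have h3 := hψ i r (left_ne_zero_of_mul h2)
  have h4 := hφ r j (right_ne_zero_of_mul h2)
  omega

theorem StrictTri.mul {φ ψ : Op} (hφ : StrictTri φ) (hψ : StrictTri ψ) : StrictTri (φ * ψ) :=
  fun _ _ h => (by have := hφ.lt_of_mul hψ h; omega)

theorem StrictTri.mul_adjacent {φ ψ : Op} (hφ : StrictTri φ) (hψ : StrictTri ψ) (i : ℕ) :
    (φ * ψ) (e i) (i + 1) = 0 := by
  by_contra h
  exact absurd (hφ.lt_of_mul hψ h) (by omega)

/-- A strictly triangular operator has no coefficient from `e j` back to `e i` when `i < j`. -/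
theorem elem_mul_mul_elem {φ : Op} (hφ : StrictTri φ) {i j : ℕ} (h : i < j) :
    elem i j * φ * elem i j = 0 := by
  apply Op.ext_basis
  intro a
  simp only [Module.End.mul_apply, elem_e]
  split_ifs with h1
  · rw [elem_apply, hφ.eq_zero h.le, zero_smul]; rfl
  · simp

/-- The commutator with `d`.  Over `ℤ/2` it is also the anticommutator, so it is the differential
of the endomorphism complex. -/
noncomputable def bd (d : Op) : Op →ₗ[ZMod 2] Op :=
  LinearMap.mulLeft (ZMod 2) d + LinearMap.mulRight (ZMod 2) d

@[simp] theorem bd_apply (d φ : Op) : bd d φ = d * φ + φ * d := rfl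

theorem StrictTri.bd {d φ : Op} (hd : StrictTri d) (hφ : StrictTri φ) : StrictTri (bd d φ) :=
  (hd.mul hφ).add (hφ.mul hd)

/-- Boundaries have no coefficients between adjacent strands; so they vanish on the chords at which
chord paths start. -/
theorem StrictTri.bd_adjacent {d φ : Op} (hd : StrictTri d) (hφ : StrictTri φ) (i : ℕ) :
    LegendrianMCS.bd d φ (e i) (i + 1) = 0 := by
  rw [bd_apply, LinearMap.add_apply, Finsupp.add_apply, hd.mul_adjacent hφ, hφ.mul_adjacent hd,
    add_zero]

theorem bd_bd {d : Op} (hd : d * d = 0) (φ : Op) : bd d (bd d φ) = 0 := by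
  have h : bd d (bd d φ) = d * d * φ + φ * (d * d) + (d * φ * d + d * φ * d) := by
    simp only [bd_apply]
    noncomm_ring
  rw [h, hd, Op.add_self, zero_mul, mul_zero, add_zero, add_zero]

theorem handleslide_conj_entry (k l : ℕ) (φ : Op) (i j : ℕ) :
    (handleslideMap k l * φ * handleslideMap k l) (e i) j =
      φ (e i) j + (if i = k then φ (e l) j else 0) +
        if j = l then φ (e i) k + (if i = k then φ (e l) k else 0) else 0 := by
  rw [Module.End.mul_apply, Module.End.mul_apply, handleslideMap_apply, handleslideMap_eq,
    LinearMap.add_apply, elem_e]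
  by_cases h : i = k <;> simp [h]

theorem crossing_conj_entry (k : ℕ) (φ : Op) (i j : ℕ) :
    (crossingMap k * φ * crossingMap k) (e i) j = φ (e (crossingPerm k i)) (crossingPerm k j) := by
  rw [Module.End.mul_apply, Module.End.mul_apply, crossingMap_apply, crossingMap_e]

theorem cusp_conj_entry (k : ℕ) (φ : Op) (i j : ℕ) :
    (cuspProj k * φ * cuspMap k) (e i) j = φ (e (cuspShift k i)) (cuspShift k j) := by
  rw [Module.End.mul_apply, Module.End.mul_apply, cuspProj_apply, cuspMap_e]

/-! ### Transfer of functionals -/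

/-- The number of singularities in a sequence of tangles. -/
def numSing (S : List Step) : ℕ := (S.filterMap fun s => s.1.sing?).length

/-- The transfer of functionals on chords from the left to the right of a tangle: the value of the
new functional on a chord is the sum of the values of the old one over all possible next chords.  It
is `0` at a left cusp, which no sequence of chords passes. -/
noncomputable def transfer : Tangle → Op →ₗ[ZMod 2] Op
  | .sing (.leftCusp _ _) => 0
  | .sing (.crossing k) =>
      LinearMap.mulLeft (ZMod 2) (crossingMap k : Op) ∘ₗ
        LinearMap.mulRight (ZMod 2) (crossingMap k) +
        (entry k (k + 1)).smulRight (elem (k + 1) k)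
  | .sing (.rightCusp k) =>
      LinearMap.mulLeft (ZMod 2) (cuspProj k : Op) ∘ₗ LinearMap.mulRight (ZMod 2) (cuspMap k)
  | .slide k l =>
      LinearMap.mulLeft (ZMod 2) (handleslideMap k l : Op) ∘ₗ
        LinearMap.mulRight (ZMod 2) (handleslideMap k l)

theorem transfer_crossing (k : ℕ) (φ : Op) : transfer (.sing (.crossing k)) φ =
    crossingMap k * φ * crossingMap k + φ (e k) (k + 1) • elem (k + 1) k := by
  simp [transfer, mul_assoc]

theorem transfer_rightCusp (k : ℕ) (φ : Op) : transfer (.sing (.rightCusp k)) φ =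
    cuspProj k * φ * cuspMap k := by
  simp [transfer, mul_assoc]

theorem transfer_slide (k l : ℕ) (φ : Op) : transfer (.slide k l) φ =
    handleslideMap k l * φ * handleslideMap k l := by
  simp [transfer, mul_assoc]

theorem transfer_leftCusp (k : ℕ) (p : ℤ) (φ : Op) :
    transfer (.sing (.leftCusp k p)) φ = 0 := rfl

theorem transfer_slide_entry (k l : ℕ) (φ : Op) (i j : ℕ) : transfer (.slide k l) φ (e i) j =
    φ (e i) j + (if i = k then φ (e l) j else 0) +
        if j = l then φ (e i) k + (if i = k then φ (e l) k else 0) else 0 := by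
  rw [transfer_slide, handleslide_conj_entry]

theorem transfer_crossing_entry (k : ℕ) (φ : Op) (i j : ℕ) :
    transfer (.sing (.crossing k)) φ (e i) j = φ (e (crossingPerm k i)) (crossingPerm k j) +
      if i = k + 1 ∧ j = k then φ (e k) (k + 1) else 0 := by
  rw [transfer_crossing, LinearMap.add_apply, Finsupp.add_apply, crossing_conj_entry,
    LinearMap.smul_apply, Finsupp.smul_apply, elem_e]
  congr 1
  by_cases h : i = k + 1 <;> by_cases h' : j = k <;> simp [h, h', e_apply]
  exact fun h2 => absurd h2.symm h'

theorem transfer_rightCusp_entry (k : ℕ) (φ : Op) (i j : ℕ) :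
    transfer (.sing (.rightCusp k)) φ (e i) j = φ (e (cuspShift k i)) (cuspShift k j) := by
  rw [transfer_rightCusp, cusp_conj_entry]

/-- Marks point downwards. -/
def Tangle.Descends : Tangle → Prop
  | slide k l => k < l
  | sing _ => True

theorem StrictTri.transfer {φ : Op} (hφ : StrictTri φ) {T : Tangle} (hT : T.Descends) :
    StrictTri (transfer T φ) := by
  intro i j h
  by_contra hij
  apply h
  have hz : ∀ {a b : ℕ}, b ≤ a → φ (e a) b = 0 := fun h => hφ.eq_zero h
  match T, hT with
  | .sing (.leftCusp _ _), _ => rfl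
  | .sing (.rightCusp k), _ =>
    rw [transfer_rightCusp_entry]
    exact hz ((cuspShift_strictMono k).monotone (by omega))
  | .slide k l, hT =>
    have hT : k < l := hT
    rw [transfer_slide_entry]
    split_ifs with h1 h2 h3 <;> simp (disch := omega) only [hz, add_zero]
  | .sing (.crossing k), _ =>
    rw [transfer_crossing_entry]
    split_ifs with h1
    · rw [h1.1, h1.2]
      simp only [crossingPerm, Equiv.swap_apply_left, Equiv.swap_apply_right]
      exact CharTwo.add_self_eq_zero _
    · rw [add_zero]
      apply hz
      simp only [crossingPerm, Equiv.swap_apply_def]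
      split_ifs <;> omega

/-- Conjugation by a handleslide map does not change the coefficients between adjacent strands. -/
theorem slide_adjacent {φ : Op} (hφ : StrictTri φ) {k l : ℕ} (h : k < l) (i : ℕ) :
    transfer (.slide k l) φ (e i) (i + 1) = φ (e i) (i + 1) := by
  have hz : ∀ {a b : ℕ}, b ≤ a → φ (e a) b = 0 := fun h => hφ.eq_zero h
  rw [transfer_slide_entry]
  split_ifs <;> simp (disch := omega) only [hz, add_zero]

/-- The value of the functional on the first chord of a chord path that originates at the given
singularity. -/
noncomputable def headEntry : Singularity → Op →ₗ[ZMod 2] ZMod 2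
  | .leftCusp _ _ => 0
  | .crossing k => entry k (k + 1)
  | .rightCusp k => entry k (k + 1)

/-- `readOff S a φ` is the sum of the values of `φ` over the last chords of all sequences of chords
that originate at the singularity number `a` of `S` and go back to the left border of `S`. -/
noncomputable def readOff : List Step → ℕ → Op →ₗ[ZMod 2] ZMod 2
  | [], _ => 0
  | (.slide k l, _) :: S, a => readOff S a ∘ₗ transfer (.slide k l)
  | (.sing s, _) :: _, 0 => headEntry s
  | (.sing s, _) :: S, a + 1 => readOff S a ∘ₗ transfer (.sing s)

/-- The transfer of functionals from the left to the right of a sequence of tangles. -/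
noncomputable def transferAll : List Step → Op →ₗ[ZMod 2] Op
  | [] => LinearMap.id
  | s :: S => transferAll S ∘ₗ transfer s.1

/-- The functional on chords immediately to the right of a crossing that records the condition on
the last chord of a chord path to this crossing.  It is the boundary, in the endomorphism complex,
of the operator `e (k + 1) ↦ e k`. -/
noncomputable def birth : Singularity → OrderedComplex → Op
  | .crossing k, Y => bd Y.d (elem (k + 1) k)
  | _, _ => 0

/-- The number mod `2` of chord paths from the singularity `a` of `S` to the singularity `b`. -/
noncomputable def pathCoeff : List Step → ℕ → ℕ → ZMod 2
  | [], _, _ => 0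
  | (.slide _ _, _) :: S, b, a => pathCoeff S b a
  | (.sing _, _) :: _, 0, 0 => 0
  | (.sing s, Y) :: S, 0, a + 1 => readOff S a (birth s Y)
  | (.sing _, _) :: _, _ + 1, 0 => 0
  | (.sing _, _) :: S, b + 1, a + 1 => pathCoeff S b a

/-- The functional belonging to the singularity `b` of `S`, transferred to the right border. -/
noncomputable def pushedBirth : List Step → ℕ → Op
  | [], _ => 0
  | (.slide _ _, _) :: S, b => pushedBirth S b
  | (.sing s, Y) :: S, 0 => transferAll S (birth s Y)
  | (.sing _, _) :: S, b + 1 => pushedBirth S b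

/-- All marks in the sequence point downwards. -/
def AllDescend (S : List Step) : Prop := ∀ s ∈ S, s.1.Descends

@[simp] theorem numSing_nil : numSing [] = 0 := rfl
@[simp] theorem numSing_slide (k l : ℕ) (Y : OrderedComplex) (S : List Step) :
    numSing ((.slide k l, Y) :: S) = numSing S := rfl
@[simp] theorem numSing_sing (s : Singularity) (Y : OrderedComplex) (S : List Step) :
    numSing ((.sing s, Y) :: S) = numSing S + 1 := rfl
theorem numSing_append (A B : List Step) : numSing (A ++ B) = numSing A + numSing B := by
  simp [numSing]

theorem readOff_slide (k l : ℕ) (Y : OrderedComplex) (S : List Step) (a : ℕ) (φ : Op) :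
    readOff ((.slide k l, Y) :: S) a φ = readOff S a (transfer (.slide k l) φ) := by
  simp [readOff]
theorem readOff_zero (s : Singularity) (Y : OrderedComplex) (S : List Step) (φ : Op) :
    readOff ((.sing s, Y) :: S) 0 φ = headEntry s φ := by simp [readOff]
theorem readOff_succ (s : Singularity) (Y : OrderedComplex) (S : List Step) (a : ℕ) (φ : Op) :
    readOff ((.sing s, Y) :: S) (a + 1) φ = readOff S a (transfer (.sing s) φ) := by simp [readOff]

theorem readOff_append_lt (A B : List Step) (a : ℕ) (ha : a < numSing A) (φ : Op) :
    readOff (A ++ B) a φ = readOff A a φ := by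
  induction A generalizing a φ with
  | nil => simp at ha
  | cons s A ih =>
    obtain ⟨s | ⟨k, l⟩, Y⟩ := s
    · cases a with
      | zero => rfl
      | succ a =>
        rw [List.cons_append, readOff_succ, readOff_succ, ih _ (by simpa using ha)]
    · rw [List.cons_append, readOff_slide, readOff_slide, ih _ (by simpa using ha)]

theorem readOff_append_ge (A B : List Step) (a : ℕ) (φ : Op) :
    readOff (A ++ B) (numSing A + a) φ = readOff B a (transferAll A φ) := by
  induction A generalizing φ with
  | nil => simp [transferAll]
  | cons s A ih =>
    obtain ⟨s | ⟨k, l⟩, Y⟩ := s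
    · rw [List.cons_append, numSing_sing, show numSing A + 1 + a = (numSing A + a) + 1 by omega,
        readOff_succ, ih]; rfl
    · rw [List.cons_append, numSing_slide, readOff_slide, ih]; rfl

theorem pathCoeff_append_lt_lt (A B : List Step) (b a : ℕ) (ha : a < numSing A) :
    pathCoeff (A ++ B) b a = pathCoeff A b a := by
  induction A generalizing a b with
  | nil => simp at ha
  | cons s A ih =>
    obtain ⟨s | ⟨k, l⟩, Y⟩ := s
    · cases a with
      | zero => cases b <;> rfl
      | succ a =>
        have ha : a < numSing A := by simpa using ha
        cases b with
        | zero => exact readOff_append_lt _ _ _ ha _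
        | succ b => exact ih _ _ ha
    · exact ih _ _ ha

theorem pathCoeff_append_lt_ge (A B : List Step) (b a : ℕ) (hb : b < numSing A) :
    pathCoeff (A ++ B) b (numSing A + a) = readOff B a (pushedBirth A b) := by
  induction A generalizing b with
  | nil => simp at hb
  | cons s A ih =>
    obtain ⟨s | ⟨k, l⟩, Y⟩ := s
    · rw [List.cons_append, numSing_sing, show numSing A + 1 + a = (numSing A + a) + 1 by omega]
      cases b with
      | zero => exact readOff_append_ge _ _ _ _
      | succ b => exact ih _ (by simpa using hb)
    · exact ih _ hb

theorem pathCoeff_append_ge_ge (A B : List Step) (b a : ℕ) :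
    pathCoeff (A ++ B) (numSing A + b) (numSing A + a) = pathCoeff B b a := by
  induction A with
  | nil => simp
  | cons s A ih =>
    obtain ⟨s | ⟨k, l⟩, Y⟩ := s
    · rw [List.cons_append, numSing_sing, show numSing A + 1 + a = (numSing A + a) + 1 by omega,
        show numSing A + 1 + b = (numSing A + b) + 1 by omega]
      exact ih
    · exact ih

theorem pathCoeff_eq_zero_of_le (A : List Step) (b a : ℕ) (h : a ≤ b) : pathCoeff A b a = 0 := by
  induction A generalizing a b with
  | nil => rfl
  | cons s A ih =>
    obtain ⟨s | ⟨k, l⟩, Y⟩ := s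
    · cases a with
      | zero => cases b <;> rfl
      | succ a =>
        obtain _ | b := b
        · omega
        · exact ih _ _ (by omega)
    · exact ih _ _ h

theorem StrictTri.transferAll {S : List Step} (hS : AllDescend S) {φ : Op} (hφ : StrictTri φ) :
    StrictTri (transferAll S φ) := by
  induction S generalizing φ with
  | nil => exact hφ
  | cons s S ih =>
    exact ih (fun t ht => hS t (by simp [ht])) (hφ.transfer (hS s (by simp)))

/-! ### The complexes along a sequence -/

/-- The complex at the right border of a sequence of tangles. -/
def lastComplex : OrderedComplex → List Step → OrderedComplex
  | X, [] => X
  | _, s :: S => lastComplex s.2 S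

theorem StepsFit.append_left {X : OrderedComplex} {A B : List Step} (h : StepsFit X (A ++ B)) :
    StepsFit X A := by
  induction A generalizing X with
  | nil => trivial
  | cons s A ih => exact ⟨h.1, ih h.2⟩

theorem StepsFit.append_right {X : OrderedComplex} {A B : List Step} (h : StepsFit X (A ++ B)) :
    StepsFit (lastComplex X A) B := by
  induction A generalizing X with
  | nil => exact h
  | cons s A ih => exact ih h.2

theorem StepsFit.allDescend {X : OrderedComplex} {A : List Step} (h : StepsFit X A) :
    AllDescend A := by
  induction A generalizing X with
  | nil => intro s hs; simp at hs
  | cons s A ih =>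
    intro t ht
    rcases List.mem_cons.1 ht with rfl | ht
    · obtain ⟨s | ⟨k, l⟩, Y⟩ := t
      · trivial
      · exact h.1.1
    · exact ih h.2 t ht

theorem slide_fits {X Y : OrderedComplex} {k l : ℕ} (h : Fits X (.slide k l) Y) :
    handleslideMap k l * X.d = Y.d * handleslideMap k l := h.2.2.2.2

theorem crossing_fits {X Y : OrderedComplex} {k : ℕ} (h : Fits X (.sing (.crossing k)) Y) :
    crossingMap k * X.d = Y.d * crossingMap k := h.2.2.2

theorem crossing_fits_entry {X Y : OrderedComplex} {k : ℕ} (h : Fits X (.sing (.crossing k)) Y)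
    (i j : ℕ) : Y.d (e i) j = X.d (e (crossingPerm k i)) (crossingPerm k j) := by
  have h1 : Y.d = crossingMap k * X.d * crossingMap k := by
    rw [crossing_fits h, mul_assoc, crossingMap_mul_self, mul_one]
  rw [h1, crossing_conj_entry]

theorem crossing_fits_entry_zero {X Y : OrderedComplex} {k : ℕ}
    (h : Fits X (.sing (.crossing k)) Y) : Y.d (e k) (k + 1) = 0 := by
  rw [crossing_fits_entry h]
  simp only [crossingPerm, Equiv.swap_apply_left, Equiv.swap_apply_right]
  exact X.strictTri.eq_zero (by omega)

theorem bd_elem_entry (d : Op) (i j a b : ℕ) : bd d (elem i j) (e a) b =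
    (if a = i then d (e j) b else 0) + if b = j then d (e a) i else 0 := by
  rw [bd_apply, LinearMap.add_apply, Finsupp.add_apply, Module.End.mul_apply, Module.End.mul_apply,
    elem_e, elem_apply, Finsupp.smul_apply, e_apply]
  by_cases h : a = i <;> by_cases h' : b = j <;> simp [h, h']
  all_goals exact fun h2 => absurd h2.symm h'

/-- Triangularity of the functional of a crossing uses the condition `⟨d e_k, e_{k+1}⟩ = 0`. -/
theorem birth_strictTri {X Y : OrderedComplex} {s : Singularity} (h : Fits X (.sing s) Y) :
    StrictTri (birth s Y) := by
  match s, h with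
  | .leftCusp _ _, _ => exact StrictTri.zero
  | .rightCusp _, _ => exact StrictTri.zero
  | .crossing k, h =>
    intro a b hab
    simp only [birth] at hab
    rw [bd_elem_entry] at hab
    have h0 := crossing_fits_entry_zero h
    by_contra hlt
    apply hab
    have hz : ∀ {a b : ℕ}, b ≤ a → Y.d (e a) b = 0 := fun h => Y.strictTri.eq_zero h
    have hz' : ∀ {a b : ℕ}, b ≤ a + 1 → (b ≤ a ∨ a = k) → Y.d (e a) b = 0 := by
      intro a b h1 h2
      rcases h2 with h2 | rfl
      · exact hz h2
      · rcases Nat.lt_or_ge a b with h3 | h3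
        · obtain rfl : b = a + 1 := by omega
          exact h0
        · exact hz h3
    split_ifs <;> simp (disch := omega) only [hz', add_zero]

theorem pushedBirth_strictTri {X : OrderedComplex} {S : List Step} (h : StepsFit X S) (b : ℕ) :
    StrictTri (pushedBirth S b) := by
  induction S generalizing X b with
  | nil => exact StrictTri.zero
  | cons s S ih =>
    obtain ⟨s | ⟨k, l⟩, Y⟩ := s
    · cases b with
      | zero => exact (birth_strictTri h.1).transferAll h.2.allDescend
      | succ b => exact ih h.2 b
    · exact ih h.2 b

/-- Transfer past a mark is a chain map. -/
theorem bd_transfer_slide {X Y : OrderedComplex} {k l : ℕ} (h : Fits X (.slide k l) Y) (φ : Op) :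
    bd Y.d (transfer (.slide k l) φ) = transfer (.slide k l) (bd X.d φ) := by
  have h1 := slide_fits h
  have h2 : X.d * handleslideMap k l = handleslideMap k l * Y.d := by
    have h3 := handleslideMap_mul_self (k := k) (l := l) (by have := h.1; omega)
    calc X.d * handleslideMap k l
        = (handleslideMap k l * handleslideMap k l) * X.d * handleslideMap k l := by
          rw [h3, one_mul]
      _ = handleslideMap k l * (handleslideMap k l * X.d) * handleslideMap k l := by
          rw [mul_assoc (handleslideMap k l)]
      _ = handleslideMap k l * Y.d * (handleslideMap k l * handleslideMap k l) := by
          rw [h1]; simp only [mul_assoc]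
      _ = _ := by rw [h3, mul_one]
  rw [transfer_slide, transfer_slide, bd_apply, bd_apply, mul_add, add_mul]
  congr 1
  · rw [← mul_assoc, ← mul_assoc, ← h1]; simp only [mul_assoc]
  · rw [mul_assoc, ← h2]; simp only [mul_assoc]

/-- Transfer past a crossing is a chain map up to the functional of the crossing. -/
theorem bd_transfer_crossing {X Y : OrderedComplex} {k : ℕ} (h : Fits X (.sing (.crossing k)) Y)
    {φ : Op} (hφ : StrictTri φ) :
    bd Y.d (transfer (.sing (.crossing k)) φ) =
      transfer (.sing (.crossing k)) (bd X.d φ) + φ (e k) (k + 1) • birth (.crossing k) Y := by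
  have h1 := crossing_fits h
  have h2 : X.d * crossingMap k = crossingMap k * Y.d := by
    have h3 := crossingMap_mul_self k
    calc X.d * crossingMap k
        = (crossingMap k * crossingMap k) * X.d * crossingMap k := by
          rw [h3, one_mul]
      _ = crossingMap k * (crossingMap k * X.d) * crossingMap k := by
          rw [mul_assoc (crossingMap k)]
      _ = crossingMap k * Y.d * (crossingMap k * crossingMap k) := by
          rw [h1]; simp only [mul_assoc]
      _ = _ := by rw [h3, mul_one]
  rw [transfer_crossing, transfer_crossing, X.strictTri.bd_adjacent hφ, zero_smul, add_zero,
    map_add, map_smul]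
  refine congrArg (· + _) ?_
  rw [bd_apply, bd_apply, mul_add, add_mul]
  congr 1
  · rw [← mul_assoc, ← mul_assoc, ← h1]; simp only [mul_assoc]
  · rw [mul_assoc, ← h2]; simp only [mul_assoc]

/-! ### The region of right cusps -/

/-- There are only marks and right cusps of the strands `k`, `k + 1` with even `k`. -/
def CuspsOnly (S : List Step) : Prop :=
  ∀ s ∈ S, ∀ q, s.1 = .sing q → ∃ k, Even k ∧ q = .rightCusp k

/-- Only right cusps can follow a right cusp. -/
def CuspsLast (S : List Step) : Prop :=
  ∀ A B k Y, S = A ++ (.sing (.rightCusp k), Y) :: B → CuspsOnly ((.sing (.rightCusp k), Y) :: B)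

theorem CuspsLast.append_right {A B : List Step} (h : CuspsLast (A ++ B)) : CuspsLast B :=
  fun A' B' k Y hB => h (A ++ A') B' k Y (by rw [hB, List.append_assoc])

theorem CuspsLast.tail {s : Step} {B : List Step} (h : CuspsLast (s :: B)) : CuspsLast B :=
  CuspsLast.append_right (A := [s]) h

theorem CuspsOnly.tail {s : Step} {B : List Step} (h : CuspsOnly (s :: B)) : CuspsOnly B :=
  fun t ht => h t (by simp [ht])

/-- Among the right cusps, sequences of chords see only the coefficients from `e (2 i)` to
`e (2 i + 1)`. -/
theorem CuspsOnly.readOff_eq_zero {S : List Step} (hS : CuspsOnly S) (hd : AllDescend S) {φ : Op}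
    (hφ : StrictTri φ) (h : ∀ i, Even i → φ (e i) (i + 1) = 0) (a : ℕ) : readOff S a φ = 0 := by
  induction S generalizing a φ with
  | nil => rfl
  | cons s S ih =>
    have hd' : AllDescend S := fun t ht => hd t (by simp [ht])
    have hs : s.1.Descends := hd s (by simp)
    obtain ⟨s | ⟨k, l⟩, Y⟩ := s
    · obtain ⟨k, hk, rfl⟩ := hS _ List.mem_cons_self s rfl
      cases a with
      | zero => exact h k hk
      | succ a =>
        rw [readOff_succ]
        refine ih hS.tail hd' (hφ.transfer hs) (fun i hi => ?_) a
        rw [transfer_rightCusp_entry]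
        have : cuspShift k (i + 1) = cuspShift k i + 1 ∧ Even (cuspShift k i) := by
          simp only [cuspShift]
          rw [Nat.even_iff] at hi hk
          simp only [Nat.even_iff]
          split_ifs <;> omega
        rw [this.1]
        exact h _ this.2
    · rw [readOff_slide]
      refine ih hS.tail hd' (hφ.transfer hs) (fun i hi => ?_) a
      rw [slide_adjacent hφ hs]
      exact h i hi

theorem CuspsOnly.readOff_congr {S : List Step} (hS : CuspsOnly S) (hd : AllDescend S) {φ ψ : Op}
    (hφ : StrictTri φ) (hψ : StrictTri ψ) (h : ∀ i, Even i → φ (e i) (i + 1) = ψ (e i) (i + 1))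
    (a : ℕ) : readOff S a φ = readOff S a ψ := by
  have := hS.readOff_eq_zero hd (hφ.add hψ) (fun i hi => by
    rw [LinearMap.add_apply, Finsupp.add_apply, h i hi]; exact CharTwo.add_self_eq_zero _) a
  rw [map_add] at this
  exact CharTwo.add_eq_zero.1 this

/-- No chord path ends at a right cusp. -/
theorem CuspsOnly.pathCoeff_eq_zero {S : List Step} (hS : CuspsOnly S) (b a : ℕ) :
    pathCoeff S b a = 0 := by
  induction S generalizing a b with
  | nil => rfl
  | cons s S ih =>
    obtain ⟨s | ⟨k, l⟩, Y⟩ := s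
    · obtain ⟨k, hk, rfl⟩ := hS _ List.mem_cons_self s rfl
      match b, a with
      | 0, 0 => rfl
      | 0, a + 1 => exact map_zero _
      | b + 1, 0 => rfl
      | b + 1, a + 1 => exact ih hS.tail b a
    · exact ih hS.tail b a

/-! ### The chain property -/

theorem sum_range_numSing_sing (s : Singularity) (Y : OrderedComplex) (S : List Step)
    {M : Type*} [AddCommMonoid M] (f : ℕ → M) :
    ∑ b ∈ Finset.range (numSing ((.sing s, Y) :: S)), f b =
      f 0 + ∑ b ∈ Finset.range (numSing S), f (b + 1) := by
  rw [numSing_sing, Finset.sum_range_succ', add_comm]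

/-- `readOff` intertwines the differential of the endomorphism complex with the matrix of
chord path counts. -/
theorem readOff_bd {X : OrderedComplex} {S : List Step} (hS : StepsFit X S) (hc : CuspsLast S)
    {φ : Op} (hφ : StrictTri φ) (a : ℕ) :
    readOff S a (bd X.d φ) = ∑ b ∈ Finset.range (numSing S), readOff S b φ * pathCoeff S b a := by
  induction S generalizing X φ a with
  | nil => simp [readOff]
  | cons s S ih =>
    have hd := hS.allDescend s (by simp)
    obtain ⟨s | ⟨k, l⟩, Y⟩ := s
    · rw [sum_range_numSing_sing]
      match s with
      | .rightCusp k =>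
        have hC := hc [] S k Y rfl
        have hz := hC.pathCoeff_eq_zero
        rw [hC.readOff_eq_zero hS.allDescend (X.strictTri.bd hφ)
          (fun i _ => X.strictTri.bd_adjacent hφ i)]
        simp [hz]
      | .leftCusp k p =>
        have h0 : ∀ (c : ℕ) (ψ : Op), readOff ((.sing (.leftCusp k p), Y) :: S) c ψ = 0 := by
          intro c ψ
          cases c with
          | zero => rfl
          | succ c => rw [readOff_succ, transfer_leftCusp, map_zero]
        simp [h0]
      | .crossing k =>
        cases a with
        | zero =>
          rw [readOff_zero]
          simp only [headEntry, entry_apply, X.strictTri.bd_adjacent hφ]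
          symm
          apply add_eq_zero_iff_eq_neg.2
          simp [pathCoeff]
        | succ a =>
          have h1 := bd_transfer_crossing hS.1 hφ
          have h2 := congrArg (readOff S a) h1
          rw [ih hS.2 hc.tail (hφ.transfer hd), map_add, map_smul] at h2
          rw [readOff_succ, readOff_zero]
          simp only [headEntry, entry_apply, pathCoeff, readOff_succ]
          rw [h2, smul_eq_mul, add_comm, add_assoc, CharTwo.add_self_eq_zero, add_zero]
    · rw [readOff_slide, ← bd_transfer_slide hS.1, ih hS.2 hc.tail (hφ.transfer hd)]
      rfl

/-- No right cusps. -/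
def NoRightCusp (S : List Step) : Prop := ∀ s ∈ S, ∀ k, s.1 ≠ .sing (.rightCusp k)

/-- Transfer past several tangles is a chain map up to the functionals of the crossings that are
passed. -/
theorem bd_transferAll {X : OrderedComplex} {S : List Step} (hS : StepsFit X S)
    (hc : NoRightCusp S) {φ : Op} (hφ : StrictTri φ) :
    bd (lastComplex X S).d (transferAll S φ) = transferAll S (bd X.d φ) +
      ∑ b ∈ Finset.range (numSing S), readOff S b φ • pushedBirth S b := by
  induction S generalizing X φ with
  | nil => simp [transferAll, lastComplex]
  | cons s S ih =>
    have hd := hS.allDescend s (by simp)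
    have hc' : NoRightCusp S := fun t ht => hc t (by simp [ht])
    obtain ⟨s | ⟨k, l⟩, Y⟩ := s
    · rw [sum_range_numSing_sing]
      match s with
      | .rightCusp k => exact absurd rfl (hc _ List.mem_cons_self k)
      | .leftCusp k p =>
        have h0 : ∀ (c : ℕ), readOff ((.sing (.leftCusp k p), Y) :: S) c φ = 0 := by
          intro c
          cases c with
          | zero => rfl
          | succ c => rw [readOff_succ, transfer_leftCusp, map_zero]
        simp [h0, transferAll, transfer_leftCusp]
      | .crossing k =>
        have h1 := bd_transfer_crossing hS.1 hφ
        have h2 := ih hS.2 hc' (hφ.transfer hd)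
        rw [h1, map_add, map_smul, add_assoc] at h2
        exact h2
    · have h2 := ih hS.2 hc' (hφ.transfer hd)
      rw [bd_transfer_slide hS.1] at h2
      exact h2

theorem bd_birth (s : Singularity) (Y : OrderedComplex) : bd Y.d (birth s Y) = 0 := by
  match s with
  | .leftCusp _ _ => exact map_zero _
  | .rightCusp _ => exact map_zero _
  | .crossing k => exact bd_bd Y.d_mul_d _

/-- The functional of a crossing is a cycle; after the transfer its boundary is the combination of
the other transferred functionals with the chord path counts as coefficients. -/
theorem bd_pushedBirth {X : OrderedComplex} {S : List Step} (hS : StepsFit X S)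
    (hc : NoRightCusp S) (b : ℕ) :
    bd (lastComplex X S).d (pushedBirth S b) =
      ∑ a ∈ Finset.range (numSing S), pathCoeff S b a • pushedBirth S a := by
  induction S generalizing X b with
  | nil => simp [pushedBirth]
  | cons s S ih =>
    have hc' : NoRightCusp S := fun t ht => hc t (by simp [ht])
    obtain ⟨s | ⟨k, l⟩, Y⟩ := s
    · rw [sum_range_numSing_sing]
      cases b with
      | zero =>
        have h := bd_transferAll hS.2 hc' (birth_strictTri hS.1)
        rw [bd_birth, map_zero, zero_add] at h
        simp only [pathCoeff, zero_smul, zero_add]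
        exact h
      | succ b =>
        have h := ih hS.2 hc' b
        simp only [pathCoeff, zero_smul, zero_add]
        exact h
    · exact ih hS.2 hc' b

theorem transferAll_append (A B : List Step) (φ : Op) :
    transferAll (A ++ B) φ = transferAll B (transferAll A φ) := by
  induction A generalizing φ with
  | nil => rfl
  | cons s A ih => exact ih _

theorem pushedBirth_append_lt (A B : List Step) (b : ℕ) (hb : b < numSing A) :
    pushedBirth (A ++ B) b = transferAll B (pushedBirth A b) := by
  induction A generalizing b with
  | nil => simp at hb
  | cons s A ih =>
    obtain ⟨s | ⟨k, l⟩, Y⟩ := s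
    · cases b with
      | zero => exact transferAll_append _ _ _
      | succ b => exact ih _ (by simpa using hb)
    · exact ih _ hb

theorem pushedBirth_append_ge (A B : List Step) (b : ℕ) :
    pushedBirth (A ++ B) (numSing A + b) = pushedBirth B b := by
  induction A with
  | nil => simp
  | cons s A ih =>
    obtain ⟨s | ⟨k, l⟩, Y⟩ := s
    · rw [List.cons_append, numSing_sing, show numSing A + 1 + b = (numSing A + b) + 1 by omega]
      exact ih
    · exact ih

/-! ### Moves that do not change the chord path counts -/

/-- The two sequences have the same effect on functionals and the same chord path counts. -/
def Agree (S S' : List Step) : Prop :=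
  (∀ φ, StrictTri φ → ∀ a, readOff S a φ = readOff S' a φ) ∧
    ∀ b a, pathCoeff S b a = pathCoeff S' b a

/-- Changes without effect on functionals do not change the counts for crossings further left. -/
theorem Agree.append_left {S S' : List Step} (h : Agree S S') {X : OrderedComplex} {A : List Step}
    (hA : StepsFit X A) (b a : ℕ) : pathCoeff (A ++ S) b a = pathCoeff (A ++ S') b a := by
  rcases Nat.lt_or_ge a (numSing A) with ha | ha
  · rw [pathCoeff_append_lt_lt _ _ _ _ ha, pathCoeff_append_lt_lt _ _ _ _ ha]
  · obtain ⟨a, rfl⟩ := Nat.exists_eq_add_of_le ha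
    rcases Nat.lt_or_ge b (numSing A) with hb | hb
    · rw [pathCoeff_append_lt_ge _ _ _ _ hb, pathCoeff_append_lt_ge _ _ _ _ hb]
      exact h.1 _ (pushedBirth_strictTri hA b) a
    · obtain ⟨b, rfl⟩ := Nat.exists_eq_add_of_le hb
      rw [pathCoeff_append_ge_ge, pathCoeff_append_ge_ge]
      exact h.2 b a

theorem handleslideMap_commute {i j k l : ℕ} (h₁ : j ≠ k) (h₂ : l ≠ i) :
    (handleslideMap i j * handleslideMap k l : Op) = handleslideMap k l * handleslideMap i j := by
  have h3 : elem i j * elem k l = 0 := by rw [elem_mul_elem, if_neg h₂]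
  have h4 : elem k l * elem i j = 0 := by rw [elem_mul_elem, if_neg h₁]
  simp only [handleslideMap_eq, mul_add, add_mul, mul_one, one_mul, h3, h4]
  abel

theorem handleslideMap_commutator {i j k : ℕ} (h₁ : i < j) (h₂ : j < k) :
    (handleslideMap j k * handleslideMap i j : Op) =
      handleslideMap i j * handleslideMap i k * handleslideMap j k := by
  simp only [handleslideMap_eq, mul_add, add_mul, mul_one, one_mul, elem_mul_elem]
  simp (disch := omega) only [if_neg, if_true]
  simp only [zero_mul]
  abel

theorem handleslideMap_commutator' {i j k : ℕ} (h₁ : i < j) (h₂ : j < k) :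
    (handleslideMap i j * handleslideMap j k : Op) =
      handleslideMap j k * handleslideMap i k * handleslideMap i j := by
  have h3 := handleslideMap_commutator h₁ h₂
  have h4 : handleslideMap j k * handleslideMap i k * handleslideMap i j =
      handleslideMap i j * handleslideMap j k + (elem i k + elem i k) := by
    rw [← sub_eq_zero]
    simp only [handleslideMap_eq, mul_add, add_mul, mul_one, one_mul, elem_mul_elem]
    simp (disch := omega) only [if_neg, if_true]
    simp only [zero_mul]
    abel
  rw [h4, Op.add_self, add_zero]

theorem agree_cancel {W X Y : OrderedComplex} {i j : ℕ} {B : List Step}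
    (hD : StepsFit W ((.slide i j, X) :: (.slide i j, Y) :: B)) :
    Agree B ((.slide i j, X) :: (.slide i j, Y) :: B) := by
  refine ⟨fun φ _ a => ?_, fun b a => rfl⟩
  have h := handleslideMap_mul_self (k := i) (l := j) (by have := hD.1.1; omega)
  rw [readOff_slide, readOff_slide, transfer_slide, transfer_slide]
  rw [show handleslideMap i j * (handleslideMap i j * φ * handleslideMap i j) * handleslideMap i j =
    (handleslideMap i j * handleslideMap i j) * φ * (handleslideMap i j * handleslideMap i j) by
      simp only [mul_assoc], h, one_mul, mul_one]

theorem agree_commute {X X' Y : OrderedComplex} {i j k l : ℕ} (B : List Step)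
    (h₁ : j ≠ k) (h₂ : l ≠ i) :
    Agree ((.slide i j, X) :: (.slide k l, Y) :: B) ((.slide k l, X') :: (.slide i j, Y) :: B) := by
  refine ⟨fun φ _ a => ?_, fun b a => rfl⟩
  have h := handleslideMap_commute h₁ h₂
  rw [readOff_slide, readOff_slide, readOff_slide, readOff_slide, transfer_slide, transfer_slide,
    transfer_slide, transfer_slide]
  congr 1
  calc handleslideMap k l * (handleslideMap i j * φ * handleslideMap i j) * handleslideMap k l
      = (handleslideMap k l * handleslideMap i j) * φ *
          (handleslideMap i j * handleslideMap k l) := by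
        simp only [mul_assoc]
    _ = (handleslideMap i j * handleslideMap k l) * φ *
          (handleslideMap k l * handleslideMap i j) := by
        rw [h]
    _ = _ := by simp only [mul_assoc]

theorem agree_commutator {X X₁ X₂ Y : OrderedComplex} {i j k : ℕ} (B : List Step)
    (h₁ : i < j) (h₂ : j < k) :
    Agree ((.slide i j, X) :: (.slide j k, Y) :: B)
      ((.slide j k, X₁) :: (.slide i k, X₂) :: (.slide i j, Y) :: B) := by
  refine ⟨fun φ _ a => ?_, fun b a => rfl⟩
  simp only [readOff_slide, transfer_slide]
  congr 1
  calc handleslideMap j k * (handleslideMap i j * φ * handleslideMap i j) * handleslideMap j k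
      = (handleslideMap j k * handleslideMap i j) * φ *
          (handleslideMap i j * handleslideMap j k) := by
        simp only [mul_assoc]
    _ = _ := by
        rw [handleslideMap_commutator h₁ h₂, handleslideMap_commutator' h₁ h₂]
        simp only [mul_assoc]

theorem agree_commutatorRefl {X X₁ X₂ Y : OrderedComplex} {i j k : ℕ} (B : List Step)
    (h₁ : i < j) (h₂ : j < k) :
    Agree ((.slide j k, X) :: (.slide i j, Y) :: B)
      ((.slide i j, X₁) :: (.slide i k, X₂) :: (.slide j k, Y) :: B) := by
  refine ⟨fun φ _ a => ?_, fun b a => rfl⟩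
  simp only [readOff_slide, transfer_slide]
  congr 1
  calc handleslideMap i j * (handleslideMap j k * φ * handleslideMap j k) * handleslideMap i j
      = (handleslideMap i j * handleslideMap j k) * φ *
          (handleslideMap j k * handleslideMap i j) := by
        simp only [mul_assoc]
    _ = _ := by
        rw [handleslideMap_commutator h₁ h₂, handleslideMap_commutator' h₁ h₂]
        simp only [mul_assoc]

/-- The effect of moving a mark past a crossing, up to an error term `Z`. -/
theorem transfer_past_crossing {i j m : ℕ} (hij : i < j) {Z : Op}
    (hZ : transfer (.slide (crossingPerm m i) (crossingPerm m j)) (elem (m + 1) m) =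
      elem (m + 1) m + Z) {φ : Op} (hφ : StrictTri φ) :
    transfer (.slide (crossingPerm m i) (crossingPerm m j)) (transfer (.sing (.crossing m)) φ) =
      transfer (.sing (.crossing m)) (transfer (.slide i j) φ) + φ (e m) (m + 1) • Z := by
  rw [transfer_crossing, map_add, map_smul, hZ, transfer_crossing, slide_adjacent hφ hij, smul_add,
    ← add_assoc, transfer_slide, transfer_slide, ← crossingMap_conj_handleslideMap]
  congr 2
  have h := crossingMap_mul_self m
  calc crossingMap m * handleslideMap i j * crossingMap m * (crossingMap m * φ * crossingMap m) *
        (crossingMap m * handleslideMap i j * crossingMap m)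
      = crossingMap m * handleslideMap i j * (crossingMap m * crossingMap m) * φ *
        (crossingMap m * crossingMap m) * handleslideMap i j * crossingMap m := by
        simp only [mul_assoc]
    _ = _ := by rw [h]; simp only [mul_one, mul_assoc]

/-- A mark between `i'` and `j'` commutes with the operator `e (m + 1) ↦ e m`. -/
theorem transfer_slide_elem {m i' j' : ℕ} (hi : i' ≠ m) (hj : j' ≠ m + 1) :
    transfer (.slide i' j') (elem (m + 1) m) = elem (m + 1) m := by
  have h1 : elem i' j' * elem (m + 1) m = 0 := by rw [elem_mul_elem, if_neg hi.symm]
  have h2 : elem (m + 1) m * elem i' j' = 0 := by rw [elem_mul_elem, if_neg hj]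
  rw [transfer_slide, handleslideMap_eq, add_mul, mul_add, one_mul, h1, add_zero, mul_one, h2,
    add_zero]

theorem agree_pastCrossing {W X X' Y : OrderedComplex} {i j m : ℕ} {B : List Step}
    (hij : i < j) (hi : crossingPerm m i ≠ m) (hj : crossingPerm m j ≠ m + 1)
    (hD : StepsFit W ((.sing (.crossing m), X') ::
      (.slide (crossingPerm m i) (crossingPerm m j), Y) :: B)) :
    Agree ((.slide i j, X) :: (.sing (.crossing m), Y) :: B)
      ((.sing (.crossing m), X') :: (.slide (crossingPerm m i) (crossingPerm m j), Y) :: B) := by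
  have hZ := transfer_slide_elem hi hj
  constructor
  · intro φ hφ a
    cases a with
    | zero =>
      rw [readOff_slide, readOff_zero, readOff_zero]
      exact slide_adjacent hφ hij m
    | succ a =>
      rw [readOff_slide, readOff_succ, readOff_succ, readOff_slide,
        transfer_past_crossing (Z := 0) hij (by rw [hZ, add_zero]) hφ, smul_zero, add_zero]
  · intro b a
    match b, a with
    | 0, 0 => rfl
    | b + 1, 0 => rfl
    | b + 1, a + 1 => rfl
    | 0, a + 1 =>
      simp only [pathCoeff, birth]
      rw [readOff_slide, ← bd_transfer_slide hD.2.1, hZ]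

theorem readOff_leftCusp (k : ℕ) (p : ℤ) (Y : OrderedComplex) (B : List Step) (a : ℕ) (φ : Op) :
    readOff ((.sing (.leftCusp k p), Y) :: B) a φ = 0 := by
  cases a with
  | zero => rfl
  | succ a => rw [readOff_succ, transfer_leftCusp, map_zero]

theorem agree_pastLeftCusp {X X' Y : OrderedComplex} {i j i' j' k : ℕ} {p : ℤ} (B : List Step) :
    Agree ((.sing (.leftCusp k p), X) :: (.slide i' j', Y) :: B)
      ((.slide i j, X') :: (.sing (.leftCusp k p), Y) :: B) := by
  constructor
  · intro φ _ a
    rw [readOff_leftCusp, readOff_slide, readOff_leftCusp]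
  · intro b a
    match b, a with
    | 0, 0 => rfl
    | b + 1, 0 => rfl
    | b + 1, a + 1 => rfl
    | 0, a + 1 => simp [pathCoeff, birth]

theorem agree_leftCuspEnd {X Y : OrderedComplex} {i j k : ℕ} {p : ℤ} (B : List Step) :
    Agree ((.sing (.leftCusp k p), X) :: (.slide i j, Y) :: B)
      ((.sing (.leftCusp k p), Y) :: B) := by
  constructor
  · intro φ _ a
    rw [readOff_leftCusp, readOff_leftCusp]
  · intro b a
    match b, a with
    | 0, 0 => rfl
    | b + 1, 0 => rfl
    | b + 1, a + 1 => rfl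
    | 0, a + 1 => simp [pathCoeff, birth]

theorem CuspsOnly.readOff_slide {S : List Step} (h : CuspsOnly S) (hd : AllDescend S) {k l : ℕ}
    (hkl : k < l) (Y : OrderedComplex) {φ : Op} (hφ : StrictTri φ) (a : ℕ) :
    readOff ((.slide k l, Y) :: S) a φ = readOff S a φ := by
  rw [LegendrianMCS.readOff_slide]
  exact h.readOff_congr hd (hφ.transfer (T := .slide k l) hkl) hφ
    (fun i _ => slide_adjacent hφ hkl i) a

theorem agree_rightCuspEnd {W X Y : OrderedComplex} {i j k : ℕ} {B : List Step}
    (hC : StepsFit W ((.slide i j, X) :: (.sing (.rightCusp k), Y) :: B))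
    (hc : CuspsLast ((.slide i j, X) :: (.sing (.rightCusp k), Y) :: B)) :
    Agree ((.slide i j, X) :: (.sing (.rightCusp k), Y) :: B)
      ((.sing (.rightCusp k), Y) :: B) := by
  have h := hc.tail [] B k Y rfl
  refine ⟨fun φ hφ a => h.readOff_slide hC.2.allDescend hC.1.1 X hφ a, fun b a => rfl⟩

theorem agree_pastRightCusp {W X X' Y : OrderedComplex} {i j i' j' k : ℕ} {B : List Step}
    (hC : StepsFit W ((.slide i' j', X) :: (.sing (.rightCusp k), Y) :: B))
    (hD : StepsFit W ((.sing (.rightCusp k), X') :: (.slide i j, Y) :: B))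
    (hc : CuspsLast ((.slide i' j', X) :: (.sing (.rightCusp k), Y) :: B)) :
    Agree ((.slide i' j', X) :: (.sing (.rightCusp k), Y) :: B)
      ((.sing (.rightCusp k), X') :: (.slide i j, Y) :: B) := by
  have h := hc.tail [] B k Y rfl
  constructor
  · intro φ hφ a
    rw [h.readOff_slide hC.2.allDescend hC.1.1 X hφ a]
    cases a with
    | zero => rfl
    | succ a =>
      rw [readOff_succ, readOff_succ, h.tail.readOff_slide hD.2.2.allDescend hD.2.1.1]
      exact hφ.transfer trivial
  · intro b a
    match b, a with
    | 0, 0 => rfl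
    | b + 1, 0 => rfl
    | b + 1, a + 1 => rfl
    | 0, a + 1 => simp [pathCoeff, birth]

theorem lastComplex_eq {X : OrderedComplex} {A B : List Step} :
    (X :: (A ++ B).map Prod.snd).getD A.length OrderedComplex.zero = lastComplex X A := by
  induction A generalizing X with
  | nil => simp [lastComplex]
  | cons s A ih =>
    exact ih

theorem complexAt_append (A B : List Step) :
    complexAt (A ++ B) A.length = lastComplex OrderedComplex.zero A := lastComplex_eq

theorem crossingPerm_of_ne {k i : ℕ} (h : i ≠ k ∧ i ≠ k + 1) : crossingPerm k i = i :=
  Equiv.swap_apply_of_ne_of_ne h.1 h.2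

theorem LocalMove.agree {κ : MoveType} (hκ : κ.IsPlain) {W : OrderedComplex}
    {old new B : List Step} (h : LocalMove κ W old new) (hC : StepsFit W (old ++ B))
    (hD : StepsFit W (new ++ B)) (hc : CuspsLast (old ++ B)) : Agree (old ++ B) (new ++ B) := by
  cases h with
  | cancel _ X Y i j => exact agree_cancel hD
  | commute _ X X' Y i j k l h₁ h₂ => exact agree_commute B h₁ h₂
  | commutator _ X X₁ X₂ Y i j k => exact agree_commutator B hC.1.1 hC.2.1.1
  | commutatorRefl _ X X₁ X₂ Y i j k => exact agree_commutatorRefl B hC.2.1.1 hC.1.1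
  | pastCrossing _ X X' Y i j k hi hj =>
    have h := agree_pastCrossing (W := W) (X := X) (X' := X') (Y := Y) (i := i) (j := j) (m := k)
      (B := B) hC.1.1 (by rw [crossingPerm_of_ne hi]; exact hi.1)
      (by rw [crossingPerm_of_ne hj]; exact hj.2)
    rw [crossingPerm_of_ne hi, crossingPerm_of_ne hj] at h
    exact h hD
  | crossingEnd => exact hκ.elim
  | crossingEndHor => exact hκ.elim
  | crossingEndVert _ X X' Y l m hlm =>
    have h1 : crossingPerm m l = l := crossingPerm_of_ne (by omega)
    have h2 : crossingPerm m (m + 1) = m := Equiv.swap_apply_right _ _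
    have h := agree_pastCrossing (W := W) (X := X) (X' := X') (Y := Y) (i := l) (j := m + 1)
      (m := m) (B := B) hC.1.1 (by rw [h1]; omega) (by rw [h2]; omega)
    rw [h1, h2] at h
    exact h hD
  | crossingEndHorVert _ X X' Y l m hlm =>
    have h1 : crossingPerm m l = l := crossingPerm_of_ne (by omega)
    have h2 : crossingPerm m m = m + 1 := Equiv.swap_apply_left _ _
    have h := agree_pastCrossing (W := W) (X := X) (X' := X') (Y := Y) (i := m) (j := l) (m := m)
      (B := B) hC.1.1 (by rw [h2]; omega) (by rw [h1]; omega)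
    rw [h1, h2] at h
    exact h hD
  | pastLeftCusp _ X X' Y i j k p => exact agree_pastLeftCusp B
  | pastRightCusp _ X X' Y i j k => exact agree_pastRightCusp hC hD hc
  | leftCuspEnd _ X Y i j k p h => exact agree_leftCuspEnd B
  | rightCuspEnd _ X Y i j k h => exact agree_rightCuspEnd hC hc
  | explosion => exact hκ.elim

theorem Move.pathCoeff_eq {F : Front} {C D : MCS F} {κ : MoveType} {p : ℕ} (hκ : κ.IsPlain)
    (h : Move κ p C D) (hc : CuspsLast C.steps) (b a : ℕ) :
    pathCoeff C.steps b a = pathCoeff D.steps b a := by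
  obtain ⟨pre, old, new, post, rfl, hC, hD, hm⟩ := h
  have hCf := C.fits
  have hDf := D.fits
  rw [hC, List.append_assoc] at hCf hc hm
  rw [hD, List.append_assoc] at hDf
  rw [complexAt_append] at hm
  rw [hC, hD, List.append_assoc, List.append_assoc]
  exact (hm.agree hκ hCf.append_right hDf.append_right hc.append_right).append_left hCf.append_left
    b a

/-! ### Moves that change the chord path counts -/

/-- The matrix of the correction term, when the correction at the singularity `b` to the left of
`B` is given by the functional `z b` at the left border of `B`; there are `n` singularities to the
left of `B`. -/
noncomputable def correction (n : ℕ) (B : List Step) (z : ℕ → Op) (b a : ℕ) : ZMod 2 :=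
  if b < n ∧ n ≤ a then readOff B (a - n) (z b) else 0

theorem correction_ge (n : ℕ) (B : List Step) (z : ℕ → Op) {b : ℕ} (hb : b < n) (a : ℕ) :
    correction n B z b (n + a) = readOff B a (z b) := by
  simp [correction, hb]

theorem correction_lt (n : ℕ) (B : List Step) (z : ℕ → Op) (b : ℕ) {a : ℕ} (ha : a < n) :
    correction n B z b a = 0 := if_neg (by omega)

theorem correction_left (n : ℕ) (B : List Step) (z : ℕ → Op) {b : ℕ} (hb : n ≤ b) (a : ℕ) :
    correction n B z b a = 0 := if_neg (by omega)

/-- A change of the sequence to the left of `B` that changes the transferred functionals by the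
boundaries of `z`, up to the recursive term, conjugates the matrix of chord path counts by the
identity plus the correction. -/
theorem pathCoeff_correction {V : OrderedComplex} {A A' B : List Step} {n : ℕ} (z : ℕ → Op)
    (hA : numSing A = n) (hA' : numSing A' = n) (hB : StepsFit V B) (hc : CuspsLast B)
    (hz : ∀ b, StrictTri (z b))
    (h₁ : ∀ b a, a < n → pathCoeff A' b a = pathCoeff A b a)
    (h₂ : ∀ b < n, ∀ a, readOff B a (pushedBirth A' b) = readOff B a (pushedBirth A b) +
      ∑ c ∈ Finset.range n, pathCoeff A b c * readOff B a (z c) + readOff B a (bd V.d (z b)))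
    (b a : ℕ) :
    pathCoeff (A' ++ B) b a = pathCoeff (A ++ B) b a +
      ∑ c ∈ Finset.range (n + numSing B), pathCoeff (A ++ B) b c * correction n B z c a +
      ∑ c ∈ Finset.range (n + numSing B), correction n B z b c * pathCoeff (A' ++ B) c a := by
  rcases Nat.lt_or_ge a n with ha | ha
  · rw [pathCoeff_append_lt_lt _ _ _ _ (by omega), pathCoeff_append_lt_lt _ _ _ _ (by omega),
      h₁ b a ha, Finset.sum_eq_zero, Finset.sum_eq_zero, add_zero, add_zero]
    · intro c _
      rcases Nat.lt_or_ge c n with hcn | hcn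
      · rw [correction_lt _ _ _ _ hcn, zero_mul]
      · rw [pathCoeff_eq_zero_of_le _ _ _ (by omega), mul_zero]
    · intro c _
      rw [correction_lt _ _ _ _ ha, mul_zero]
  · obtain ⟨a, rfl⟩ := Nat.exists_eq_add_of_le ha
    rcases Nat.lt_or_ge b n with hb | hb
    · have e1 : ∀ c, pathCoeff (A' ++ B) (n + c) (n + a) = pathCoeff B c a := by
        intro c; rw [← hA']; exact pathCoeff_append_ge_ge _ _ _ _
      have e2 : pathCoeff (A' ++ B) b (n + a) = readOff B a (pushedBirth A' b) := by
        have := pathCoeff_append_lt_ge A' B b a (by omega)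
        rwa [hA'] at this
      have e3 : pathCoeff (A ++ B) b (n + a) = readOff B a (pushedBirth A b) := by
        have := pathCoeff_append_lt_ge A B b a (by omega)
        rwa [hA] at this
      rw [Finset.sum_range_add, Finset.sum_range_add, e2, e3, h₂ b hb, readOff_bd hB hc (hz b)]
      congr 1
      · congr 1
        symm
        rw [add_eq_left.2]
        · refine Finset.sum_congr rfl fun c hcn => ?_
          have hcn := Finset.mem_range.1 hcn
          rw [correction_ge _ _ _ hcn, pathCoeff_append_lt_lt _ _ _ _ (by omega)]
        · refine Finset.sum_eq_zero fun c _ => ?_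
          rw [correction_left _ _ _ (by omega), mul_zero]
      · symm
        rw [add_eq_right.2]
        · refine Finset.sum_congr rfl fun c _ => ?_
          rw [correction_ge _ _ _ hb, e1]
        · refine Finset.sum_eq_zero fun c hcn => ?_
          rw [correction_lt _ _ _ _ (Finset.mem_range.1 hcn), zero_mul]
    · rw [Finset.sum_eq_zero, Finset.sum_eq_zero, add_zero, add_zero]
      · obtain ⟨b, rfl⟩ := Nat.exists_eq_add_of_le hb
        have h3 := pathCoeff_append_ge_ge A B b a
        have h4 := pathCoeff_append_ge_ge A' B b a
        rw [hA] at h3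
        rw [hA'] at h4
        rw [h3, h4]
      · intro c _
        rw [correction_left _ _ _ hb, zero_mul]
      · intro c _
        rcases Nat.lt_or_ge c n with hcn | hcn
        · rw [pathCoeff_eq_zero_of_le _ _ _ (by omega), zero_mul]
        · rw [correction_left _ _ _ hcn, mul_zero]

theorem correction_mul_correction (n : ℕ) (B : List Step) (z : ℕ → Op) (b a c : ℕ) :
    correction n B z b c * correction n B z c a = 0 := by
  rcases Nat.lt_or_ge c n with hcn | hcn
  · rw [correction_lt _ _ _ _ hcn, zero_mul]
  · rw [correction_left _ _ _ hcn, mul_zero]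

/-- A mark with an end on the crossing strands passes the crossing number `numSing A`; the mark then
acts nontrivially on the functional of the crossing. -/
theorem pathCoeff_crossingEnd {U X X' Y : OrderedComplex} {A B : List Step} {i j i' j' m : ℕ}
    {Z : Op} (hi : crossingPerm m i = i') (hj : crossingPerm m j = j')
    (hC : StepsFit U (A ++ ((.slide i j, X) :: (.sing (.crossing m), Y) :: B)))
    (hD : StepsFit U (A ++ ((.sing (.crossing m), X') :: (.slide i' j', Y) :: B)))
    (hc : CuspsLast B) (hZ : StrictTri Z)
    (hE : transfer (.slide i' j') (elem (m + 1) m) = elem (m + 1) m + Z) (b a : ℕ) :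
    let S := A ++ ((.slide i j, X) :: (.sing (.crossing m), Y) :: B)
    let S' := A ++ ((.sing (.crossing m), X') :: (.slide i' j', Y) :: B)
    let K := correction (numSing A + 1) B fun b => if b = numSing A then Z else 0
    pathCoeff S' b a = pathCoeff S b a +
      ∑ c ∈ Finset.range (numSing S), pathCoeff S b c * K c a +
      ∑ c ∈ Finset.range (numSing S), K b c * pathCoeff S' c a := by
  subst hi hj
  intro S S' K
  have hS : S = (A ++ [(.slide i j, X), (.sing (.crossing m), Y)]) ++ B := by simp [S]
  have hS' : S' = (A ++ [(.sing (.crossing m), X'),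
    (.slide (crossingPerm m i) (crossingPerm m j), Y)]) ++ B := by simp [S']
  have hn : numSing S = (numSing A + 1) + numSing B := by
    rw [hS, numSing_append, numSing_append]; rfl
  rw [hn, hS, hS']
  have hC' := hC.append_right
  have hD' := hD.append_right
  have hpb := pushedBirth_strictTri hC.append_left
  refine pathCoeff_correction (V := Y) _ (by rw [numSing_append]; rfl) (by rw [numSing_append]; rfl)
    hC'.2.2 hc ?_ ?_ ?_ b a
  · intro b
    split_ifs
    exacts [hZ, StrictTri.zero]
  · intro b a ha
    rcases Nat.lt_or_ge a (numSing A) with ha' | ha'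
    · rw [pathCoeff_append_lt_lt _ _ _ _ ha', pathCoeff_append_lt_lt _ _ _ _ ha']
    · obtain rfl : a = numSing A + 0 := by omega
      rcases Nat.lt_or_ge b (numSing A) with hb | hb
      · rw [pathCoeff_append_lt_ge _ _ _ _ hb, pathCoeff_append_lt_ge _ _ _ _ hb, readOff_slide,
          readOff_zero, readOff_zero]
        exact (slide_adjacent (hpb b) hC'.1.1 m).symm
      · rw [pathCoeff_eq_zero_of_le _ _ _ (by omega), pathCoeff_eq_zero_of_le _ _ _ (by omega)]
  · intro b hb a
    have hsum : ∑ c ∈ Finset.range (numSing A + 1),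
        pathCoeff (A ++ [(.slide i j, X), (.sing (.crossing m), Y)]) b c *
          readOff B a (if c = numSing A then Z else 0) =
        pathCoeff (A ++ [(.slide i j, X), (.sing (.crossing m), Y)]) b (numSing A) *
          readOff B a Z := by
      rw [Finset.sum_eq_single (numSing A)]
      · rw [if_pos rfl]
      · intro c _ hcA
        rw [if_neg hcA, map_zero, mul_zero]
      · simp
    rw [hsum]
    rcases Nat.lt_or_ge b (numSing A) with hb' | hb'
    · rw [pushedBirth_append_lt _ _ _ hb', pushedBirth_append_lt _ _ _ hb', if_neg (by omega),
        map_zero, map_zero, add_zero]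
      have h3 := pathCoeff_append_lt_ge A [(.slide i j, X), (.sing (.crossing m), Y)] b 0 hb'
      rw [add_zero] at h3
      rw [h3, readOff_slide, readOff_zero]
      have h4 := transfer_past_crossing hC'.1.1 hE (hpb b)
      have h5 : headEntry (.crossing m) (transfer (.slide i j) (pushedBirth A b)) =
        pushedBirth A b (e m) (m + 1) := slide_adjacent (hpb b) hC'.1.1 m
      rw [h5, ← smul_eq_mul, ← map_smul, ← map_add]
      exact congrArg (readOff B a) h4
    · obtain rfl : b = numSing A + 0 := by omega
      rw [pushedBirth_append_ge, pushedBirth_append_ge, pathCoeff_eq_zero_of_le _ _ _ (by omega),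
        zero_mul, add_zero, add_zero, if_pos rfl]
      rw [← map_add]
      congr 1
      simp only [pushedBirth, transferAll, birth, LinearMap.comp_apply, LinearMap.id_apply]
      rw [← bd_transfer_slide hD'.2.1, hE, map_add]

/-- Marks from several strands to one strand `m` act together. -/
theorem transferAll_fan_upper {m : ℕ} {us : List ℕ} (hm : m ∉ us) {new : List Step}
    (h : new.map Prod.fst = us.map fun u => .slide u m) (φ : Op) :
    transferAll new φ =
      (1 + (us.map fun u => elem u m).sum) * φ * (1 + (us.map fun u => elem u m).sum) := by
  induction us generalizing new φ with
  | nil =>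
    obtain rfl : new = [] := by simpa using h
    simp [transferAll]
  | cons u us ih =>
    obtain ⟨s, new, rfl, h1, h2⟩ := List.map_eq_cons_iff.1 h
    have hz : ∀ us : List ℕ, m ∉ us → ∀ u, (us.map fun u => elem u m).sum * elem u m = 0 := by
      intro us hm u
      induction us with
      | nil => simp
      | cons u' us ih =>
        rw [List.map_cons, List.sum_cons, add_mul, elem_mul_elem, ih (by grind),
          if_neg (by grind), add_zero]
    have hz' : ∀ us : List ℕ, ∀ u, m ≠ u → elem u m * (us.map fun u => elem u m).sum = 0 := by
      intro us u hu
      induction us with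
      | nil => simp
      | cons u' us ih =>
        rw [List.map_cons, List.sum_cons, mul_add, elem_mul_elem, ih, if_neg (by grind), add_zero]
    have h3 := hz us (by grind) u
    have h4 := hz' us u (by grind)
    change transferAll new (transfer s.1 φ) = _
    rw [ih (by grind) h2, h1, transfer_slide, handleslideMap_eq, List.map_cons, List.sum_cons]
    generalize (us.map fun u => elem u m).sum = A at *
    calc (1 + A) * ((1 + elem u m) * φ * (1 + elem u m)) * (1 + A)
        = (1 + (elem u m + A) + A * elem u m) * φ * (1 + (elem u m + A) + elem u m * A) := by
          noncomm_ring
      _ = _ := by rw [h3, h4, add_zero]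

/-- Marks from one strand `l` to several strands act together. -/
theorem transferAll_fan_lower {l : ℕ} {vs : List ℕ} (hl : l ∉ vs) {new : List Step}
    (h : new.map Prod.fst = vs.map fun v => .slide l v) (φ : Op) :
    transferAll new φ =
      (1 + (vs.map fun v => elem l v).sum) * φ * (1 + (vs.map fun v => elem l v).sum) := by
  induction vs generalizing new φ with
  | nil =>
    obtain rfl : new = [] := by simpa using h
    simp [transferAll]
  | cons v vs ih =>
    obtain ⟨s, new, rfl, h1, h2⟩ := List.map_eq_cons_iff.1 h
    have hz : ∀ vs : List ℕ, ∀ v, v ≠ l → (vs.map fun v => elem l v).sum * elem l v = 0 := by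
      intro vs v hv
      induction vs with
      | nil => simp
      | cons v' vs ih =>
        rw [List.map_cons, List.sum_cons, add_mul, elem_mul_elem, ih, if_neg hv, add_zero]
    have hz' : ∀ vs : List ℕ, l ∉ vs → ∀ v, elem l v * (vs.map fun v => elem l v).sum = 0 := by
      intro vs hl v
      induction vs with
      | nil => simp
      | cons v' vs ih =>
        rw [List.map_cons, List.sum_cons, mul_add, elem_mul_elem, ih (by grind),
          if_neg (by grind), add_zero]
    have h3 := hz vs v (by grind)
    have h4 := hz' vs (by grind) v
    change transferAll new (transfer s.1 φ) = _
    rw [ih (by grind) h2, h1, transfer_slide, handleslideMap_eq, List.map_cons, List.sum_cons]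
    generalize (vs.map fun v => elem l v).sum = A at *
    calc (1 + A) * ((1 + elem l v) * φ * (1 + elem l v)) * (1 + A)
        = (1 + (elem l v + A) + A * elem l v) * φ * (1 + (elem l v + A) + elem l v * A) := by
          noncomm_ring
      _ = _ := by rw [h3, h4, add_zero]

theorem list_sum_apply_e (L : List Op) (a : ℕ) : L.sum (e a) = (L.map fun φ => φ (e a)).sum := by
  induction L with
  | nil => simp
  | cons φ L ih => simp [ih]

/-- The marks inserted by an explosion act as conjugation by `1 + ∂G`, where `G` is the operator
`e l ↦ e m`. -/
theorem transferAll_explosion {W : OrderedComplex} {l m : ℕ} {us vs : List ℕ} {new : List Step}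
    (hlm : l < m) (hus : us.Nodup) (hu : ∀ u, u ∈ us ↔ W.d (e u) l = 1)
    (hvs : vs.Nodup) (hv : ∀ v, v ∈ vs ↔ W.d (e m) v = 1)
    (hnew : new.map Prod.fst = us.map (fun u => .slide u m) ++ vs.map (fun v => .slide l v))
    (φ : Op) :
    transferAll new φ = (1 + bd W.d (elem l m)) * φ * (1 + bd W.d (elem l m)) := by
  obtain ⟨n₁, n₂, rfl, h1, h2⟩ := List.map_eq_append_iff.1 hnew
  have hm : m ∉ us := by
    intro h
    have := (W.triangular m l (by rw [(hu m).1 h]; exact one_ne_zero)).1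
    omega
  have hl : l ∉ vs := by
    intro h
    have := (W.triangular m l (by rw [(hv l).1 h]; exact one_ne_zero)).1
    omega
  have hA : (us.map fun u => elem u m).sum = elem l m * W.d := by
    apply Op.ext_basis
    intro a
    rw [list_sum_apply_e, List.map_map, Module.End.mul_apply, elem_apply]
    have h3 : ((fun φ : Op => φ (e a)) ∘ fun u => elem u m) =
        fun u => if u = a then e m else 0 := by
      funext u
      simp [eq_comm]
    rw [h3]
    have h4 : (us.map fun u => if u = a then e m else 0).sum = if a ∈ us then e m else 0 := by
      clear hu hnew h1 hm hl h3
      induction us with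
      | nil => simp
      | cons u us ih =>
        rw [List.map_cons, List.sum_cons, ih hus.of_cons]
        have := List.nodup_cons.1 hus
        by_cases hua : u = a
        · subst hua
          simp [this.1]
        · simp [hua, Ne.symm hua]
    rw [h4]
    by_cases h : a ∈ us
    · rw [if_pos h, (hu a).1 h, one_smul]
    · have h5 : W.d (e a) l = 0 := by
        by_contra h6
        exact h ((hu a).2 (Fin.eq_one_of_ne_zero _ h6))
      rw [if_neg h, h5, zero_smul]
  have hB : (vs.map fun v => elem l v).sum = W.d * elem l m := by
    apply Op.ext_basis
    intro a
    rw [list_sum_apply_e, List.map_map, Module.End.mul_apply, elem_e]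
    by_cases hal : a = l
    · rw [if_pos hal]
      have h3 : ((fun φ : Op => φ (e a)) ∘ fun v => elem l v) = fun v => e v := by
        funext v
        simp [hal]
      rw [h3]
      ext j
      have h4 : (vs.map fun v => e v).sum j = if j ∈ vs then 1 else 0 := by
        clear hv hnew h2 hl
        induction vs with
        | nil => simp
        | cons u us ih =>
          rw [List.map_cons, List.sum_cons, Finsupp.add_apply, ih hvs.of_cons, e_apply]
          have := List.nodup_cons.1 hvs
          by_cases hua : u = j
          · subst hua
            simp [this.1]
          · simp [hua, Ne.symm hua]
      rw [h4]
      by_cases h : j ∈ vs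
      · rw [if_pos h, (hv j).1 h]
      · rw [if_neg h]
        by_contra h6
        exact h ((hv j).2 (Fin.eq_one_of_ne_zero _ (Ne.symm h6)))
    · rw [if_neg hal, map_zero]
      have h3 : ((fun φ : Op => φ (e a)) ∘ fun v => elem l v) = fun _ => 0 := by
        funext v
        simp [hal]
      rw [h3]
      simp
  rw [transferAll_append, transferAll_fan_upper hm h1, transferAll_fan_lower hl h2, hA, hB]
  have hdd : (W.d * W.d : Op) = 0 := W.d_mul_d
  have hGG : elem l m * elem l m = 0 := by rw [elem_mul_elem, if_neg (by omega)]
  have h5 : (1 + W.d * elem l m) * (1 + elem l m * W.d) = 1 + bd W.d (elem l m) := by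
    have : (1 + W.d * elem l m) * (1 + elem l m * W.d) =
      1 + bd W.d (elem l m) + W.d * (elem l m * elem l m) * W.d := by
      rw [bd_apply]; noncomm_ring
    rw [this, hGG, mul_zero, zero_mul, add_zero]
  have h6 : (1 + elem l m * W.d) * (1 + W.d * elem l m) = 1 + bd W.d (elem l m) := by
    have : (1 + elem l m * W.d) * (1 + W.d * elem l m) =
      1 + bd W.d (elem l m) + elem l m * (W.d * W.d) * elem l m := by
      rw [bd_apply]; noncomm_ring
    rw [this, hdd, mul_zero, zero_mul, add_zero]
  rw [← h5]
  nth_rewrite 2 [h5]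
  rw [← h6]
  simp only [mul_assoc]

/-- Conjugation by `1 + ∂G` is chain homotopic to the identity. -/
theorem conj_one_add_bd {W : OrderedComplex} {l m : ℕ} (hlm : l < m) {φ : Op} (hφ : StrictTri φ) :
    (1 + bd W.d (elem l m)) * φ * (1 + bd W.d (elem l m)) =
      φ + bd W.d (bd (elem l m) φ) + bd (elem l m) (bd W.d φ) := by
  have hd := W.strictTri
  have q1 := elem_mul_mul_elem hφ hlm
  have q2 := elem_mul_mul_elem (hφ.mul hd) hlm
  have q3 := elem_mul_mul_elem (hd.mul hφ) hlm
  have q4 := elem_mul_mul_elem ((hd.mul hφ).mul hd) hlm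
  have a1 := Op.add_self (W.d * φ * elem l m)
  have a2 := Op.add_self (elem l m * φ * W.d)
  simp only [bd_apply]
  generalize elem l m = G at *
  generalize (W.d : Op) = d at *
  calc (1 + (d * G + G * d)) * φ * (1 + (d * G + G * d))
      = φ + (d * G * φ + G * d * φ + φ * d * G + φ * G * d) +
        (d * (G * (φ * d) * G) + d * (G * φ * G) * d + G * (d * φ * d) * G +
          (G * (d * φ) * G) * d) := by
        noncomm_ring
    _ = φ + (d * G * φ + G * d * φ + φ * d * G + φ * G * d) +
        ((d * φ * G + d * φ * G) + (G * φ * d + G * φ * d)) := by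
        rw [q1, q2, q3, q4, a1, a2]; simp
    _ = _ := by noncomm_ring

theorem cuspsOnly_of_not_noRightCusp {A B : List Step} (hc : CuspsLast (A ++ B))
    (h : ¬ NoRightCusp A) : CuspsOnly B := by
  simp only [NoRightCusp, not_forall, not_not] at h
  obtain ⟨⟨T, Y⟩, hs, k, hk⟩ := h
  obtain ⟨A₁, A₂, rfl⟩ := List.append_of_mem hs
  dsimp only at hk
  subst hk
  have := hc A₁ (A₂ ++ B) k Y (by simp)
  intro t ht
  exact this t (by simp [ht])

/-- The marks of an explosion change the matrix of chord path counts by the correction with the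
functionals `[G, ·]`, where `G` is the operator `e l ↦ e m`. -/
theorem pathCoeff_explosion {U : OrderedComplex} {A B : List Step} {l m : ℕ} {us vs : List ℕ}
    {new : List Step} (hC : StepsFit U (A ++ B)) (hc : CuspsLast (A ++ B)) (hlm : l < m)
    (hus : us.Nodup) (hu : ∀ u, u ∈ us ↔ (lastComplex U A).d (e u) l = 1)
    (hvs : vs.Nodup) (hv : ∀ v, v ∈ vs ↔ (lastComplex U A).d (e m) v = 1)
    (hnew : new.map Prod.fst = us.map (fun u => .slide u m) ++ vs.map (fun v => .slide l v))
    (b a : ℕ) :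
    let K := correction (numSing A) B fun b => bd (elem l m) (pushedBirth A b)
    pathCoeff (A ++ (new ++ B)) b a = pathCoeff (A ++ B) b a +
      ∑ c ∈ Finset.range (numSing (A ++ B)), pathCoeff (A ++ B) b c * K c a +
      ∑ c ∈ Finset.range (numSing (A ++ B)), K b c * pathCoeff (A ++ (new ++ B)) c a := by
  intro K
  have hpb := pushedBirth_strictTri hC.append_left
  have hG := StrictTri.elem hlm
  have hW := (lastComplex U A).strictTri
  have hnum : numSing new = 0 := by
    have h : ∀ s ∈ new, ∃ k l, s.1 = .slide k l := by
      intro s hs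
      have h1 := List.mem_map_of_mem (f := Prod.fst) hs
      rw [hnew] at h1
      simp only [List.mem_append, List.mem_map] at h1
      rcases h1 with ⟨u, -, h1⟩ | ⟨v, -, h1⟩
      exacts [⟨_, _, h1.symm⟩, ⟨_, _, h1.symm⟩]
    clear hnew
    induction new with
    | nil => rfl
    | cons s new ih =>
      obtain ⟨k, l, h1⟩ := h s (by simp)
      obtain ⟨T, Y⟩ := s
      dsimp only at h1
      subst h1
      exact ih fun t ht => h t (by simp [ht])
  rw [numSing_append, ← List.append_assoc]
  refine pathCoeff_correction (V := lastComplex U A) _ rfl ?_ hC.append_right hc.append_right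
    (fun b => hG.bd (hpb b)) ?_ ?_ b a
  · rw [numSing_append, hnum, add_zero]
  · intro b a ha
    exact pathCoeff_append_lt_lt _ _ _ _ ha
  · intro b hb a
    rw [pushedBirth_append_lt _ _ _ hb, transferAll_explosion hlm hus hu hvs hv hnew,
      conj_one_add_bd hlm (hpb b), map_add, map_add]
    rw [add_right_comm]
    congr 2
    -- among the right cusps `bd_pushedBirth` fails, but there both sides vanish
    by_cases hr : NoRightCusp A
    · rw [bd_pushedBirth hC.append_left hr, map_sum, map_sum]
      simp only [map_smul, smul_eq_mul]
    · have hB := cuspsOnly_of_not_noRightCusp hc hr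
      have hd := hC.append_right.allDescend
      have h0 : ∀ φ, StrictTri φ → ∀ a, readOff B a (bd (elem l m) φ) = 0 := fun φ hφ a =>
        hB.readOff_eq_zero hd (hG.bd hφ) (fun i _ => hG.bd_adjacent hφ i) a
      rw [h0 _ (hW.bd (hpb b)), Finset.sum_eq_zero]
      intro c _
      rw [h0 _ (hpb c), mul_zero]

/-! ### Counting sequences of chords -/

noncomputable instance : DecidableEq Chord := Classical.decEq _

theorem ncard_eq_zero_of_forall {p : List Chord → Prop} (h : ∀ P, ¬ p P) :
    (({P | p P}.ncard : ℕ) : ZMod 2) = 0 := by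
  rw [Set.eq_empty_of_forall_notMem (s := {P | p P}) h]
  simp

/-- The number mod `2` of sequences of chords that start at `c` and satisfy `Φ`. -/
noncomputable def chordCount (S : List Step) (Φ : List Chord → Prop) (c : Chord) : ZMod 2 :=
  ({P : List Chord | ((∀ x ∈ P, x.IsIn S) ∧ P.IsChain (Follows S) ∧ P.head? = some c) ∧
    Φ P}.ncard : ZMod 2)

theorem finite_chordLists (S : List Step) :
    {P : List Chord | (∀ x ∈ P, x.IsIn S) ∧ P.IsChain (Follows S)}.Finite := by
  have := (finite_isIn S).to_subtype
  refine ((List.finite_length_le {c : Chord | c.IsIn S} (S.length + 1)).image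
    (List.map Subtype.val)).subset ?_
  rintro P ⟨h1, h3⟩
  refine ⟨P.attach.map fun c => ⟨c.1, h1 c.1 c.2⟩, ?_, by simp⟩
  change List.length _ ≤ _
  rw [List.length_map, List.length_attach]
  cases P with
  | nil => simp
  | cons c P =>
    have h4 := length_le_of_isChain S _ h3 c (by simp)
    have h5 := (h1 c (by simp)).1
    omega

theorem finite_chordLists_from (S : List Step) (Φ : List Chord → Prop) (c : Chord) :
    {P : List Chord | ((∀ x ∈ P, x.IsIn S) ∧ P.IsChain (Follows S) ∧ P.head? = some c) ∧
      Φ P}.Finite :=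
  (finite_chordLists S).subset fun _ h => ⟨h.1.1, h.1.2.1⟩

theorem chordCount_of_not_isIn {S : List Step} {Φ : List Chord → Prop} {c : Chord}
    (h : ¬ c.IsIn S) : chordCount S Φ c = 0 := by
  refine ncard_eq_zero_of_forall fun P hP => ?_
  obtain ⟨⟨h1, -, h2⟩, -⟩ := hP
  exact h (h1 c (List.mem_of_mem_head? h2))

/-- A chord path continues from its first chord to one of the possible next chords. -/
theorem chordCount_eq_sum {S : List Step} {Φ Ψ : List Chord → Prop} {c : Chord} (hc : c.IsIn S)
    (h0 : ¬ Φ [c])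
    (h : ∀ P c', P.head? = some c' → Follows S c c' → P.IsChain (Follows S) → (Φ (c :: P) ↔ Ψ P))
    (N : Finset Chord) (hN : ∀ c', c' ∈ N ↔ Follows S c c') :
    chordCount S Φ c = ∑ c' ∈ N, chordCount S Ψ c' := by
  have h1 : {P : List Chord | ((∀ x ∈ P, x.IsIn S) ∧ P.IsChain (Follows S) ∧ P.head? = some c) ∧
      Φ P} = (c :: ·) '' ⋃ c' ∈ N, {P : List Chord | ((∀ x ∈ P, x.IsIn S) ∧
        P.IsChain (Follows S) ∧ P.head? = some c') ∧ Ψ P} := by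
    ext P
    simp only [Set.mem_ofPred_eq, Set.mem_image, Set.mem_iUnion, exists_prop]
    constructor
    · rintro ⟨⟨a1, a2, a3⟩, a4⟩
      obtain ⟨P, rfl⟩ : ∃ P', P = c :: P' := by
        cases P with
        | nil => simp at a3
        | cons x P => exact ⟨P, by simpa using a3⟩
      cases P with
      | nil => exact absurd a4 h0
      | cons c' P =>
        rw [List.isChain_cons_cons] at a2
        refine ⟨c' :: P, ⟨c', (hN c').2 a2.1, ⟨fun x hx => a1 x (List.mem_cons_of_mem _ hx), a2.2,
          rfl⟩, ?_⟩, rfl⟩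
        exact (h (c' :: P) c' rfl a2.1 a2.2).1 a4
    · rintro ⟨P, ⟨c', hc', ⟨a1, a2, a3⟩, a4⟩, rfl⟩
      have hf := (hN c').1 hc'
      refine ⟨⟨?_, ?_, rfl⟩, (h P c' a3 hf a2).2 a4⟩
      · intro x hx
        rcases List.mem_cons.1 hx with rfl | hx
        exacts [hc, a1 x hx]
      · cases P with
        | nil => simp at a3
        | cons x P =>
          obtain rfl : x = c' := by simpa using a3
          exact List.isChain_cons_cons.2 ⟨hf, a2⟩
  rw [chordCount, h1, Set.ncard_image_of_injective _ (List.cons_injective)]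
  clear h1 hN h
  induction N using Finset.induction_on with
  | empty => simp
  | insert x N hx ih =>
    rw [Finset.sum_insert hx, ← ih, Finset.set_biUnion_insert, Set.ncard_union_eq ?_ ?_ ?_,
      Nat.cast_add]
    · rfl
    · rw [Set.disjoint_left]
      intro P hP hP'
      simp only [Set.mem_iUnion, Set.mem_ofPred_eq] at hP hP'
      obtain ⟨y, hy, hP'⟩ := hP'
      have := hP.1.2.2.symm.trans hP'.1.2.2
      simp only [Option.some.injEq] at this
      exact hx (this ▸ hy)
    · exact finite_chordLists_from _ _ _
    · exact N.finite_toSet.biUnion fun _ _ => finite_chordLists_from _ _ _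

/-- The operator `φ` records the numbers of sequences that start at the various chords over
`x_m` and satisfy `Φ`. -/
def Represents (S : List Step) (m : ℕ) (Φ : List Chord → Prop) (φ : Op) : Prop :=
  ∀ i j, chordCount S Φ ⟨m, i, j⟩ = φ (e i) j

theorem Represents.eq_zero {S : List Step} {m : ℕ} {Φ : List Chord → Prop} {φ : Op}
    (h : Represents S m Φ φ) {i j : ℕ} (hij : ¬ (i < j ∧ j < (complexAt S m).deg.length)) :
    φ (e i) j = 0 := by
  rw [← h i j]
  exact chordCount_of_not_isIn fun h' => hij h'.2

theorem Represents.strictTri {S : List Step} {m : ℕ} {Φ : List Chord → Prop} {φ : Op}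
    (h : Represents S m Φ φ) : StrictTri φ := by
  intro i j hij
  by_contra h'
  exact hij (h.eq_zero fun h'' => h' h''.1)

/-- The tangle fits between `n` strands at the left and `n'` strands at the right. -/
def Tangle.FitsSize (n n' : ℕ) : Tangle → Prop
  | .sing (.leftCusp _ _) => True
  | .sing (.crossing k) => k + 1 < n ∧ n' = n
  | .sing (.rightCusp k) => k + 1 < n ∧ n' + 2 = n
  | .slide k l => k < l ∧ l < n ∧ n' = n

theorem transfer_eq_zero_of_ge {T : Tangle} {n n' : ℕ} (hT : T.FitsSize n n') {φ : Op}
    (hφ : ∀ i j, n ≤ j → φ (e i) j = 0) {i j : ℕ} (hj : n' ≤ j) : transfer T φ (e i) j = 0 := by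
  match T, hT with
  | .sing (.leftCusp _ _), _ => rfl
  | .sing (.crossing k), hT =>
    obtain ⟨h1, h2⟩ := hT
    rw [transfer_crossing_entry, if_neg (by omega), crossingPerm_of_ne (i := j) (by omega),
      hφ _ _ (by omega), add_zero]
  | .sing (.rightCusp k), hT =>
    obtain ⟨h1, h2⟩ := hT
    rw [transfer_rightCusp_entry]
    apply hφ
    simp only [cuspShift]
    split_ifs <;> omega
  | .slide k l, hT =>
    obtain ⟨h1, h2, h3⟩ := hT
    rw [transfer_slide_entry, if_neg (by omega : j ≠ l), hφ _ _ (by omega), hφ _ _ (by omega)]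
    simp

theorem Tangle.FitsSize.descends {T : Tangle} {n n' : ℕ} (hT : T.FitsSize n n') : T.Descends := by
  match T, hT with
  | .sing _, _ => trivial
  | .slide k l, hT => exact hT.1

theorem follows_iff {S : List Step} {m i j : ℕ} {T : Tangle} (hT : tangleAt S m = some T)
    (c' : Chord) : Follows S ⟨m + 1, i, j⟩ c' ↔
      c'.pos = m ∧ ChordStep T (i, j) (c'.top, c'.bot) := by
  simp only [Follows, Nat.add_right_cancel_iff]
  constructor
  · rintro ⟨h1, T', h2, h3⟩
    rw [← h1, hT] at h2
    obtain rfl := Option.some.inj h2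
    exact ⟨h1.symm, h3⟩
  · rintro ⟨h1, h2⟩
    exact ⟨h1.symm, T, by rw [h1, hT], h2⟩

theorem chordStep_crossing_iff (k : ℕ) (x y : ℕ × ℕ) : ChordStep (.sing (.crossing k)) x y ↔
    x ≠ (k, k + 1) ∧ y = (crossingPerm k x.1, crossingPerm k x.2) := by
  constructor
  · intro h
    cases h with
    | crossing _ i j h => exact ⟨h, rfl⟩
  · rintro ⟨h, rfl⟩
    exact ChordStep.crossing _ _ _ h

theorem chordStep_rightCusp_iff (k : ℕ) (x y : ℕ × ℕ) : ChordStep (.sing (.rightCusp k)) x y ↔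
    y = (cuspShift k x.1, cuspShift k x.2) := by
  constructor
  · intro h
    cases h with
    | rightCusp _ i j => rfl
  · rintro rfl
    exact ChordStep.rightCusp _ _ _

theorem chordStep_slide_iff (k l i j i' j' : ℕ) : ChordStep (.slide k l) (i, j) (i', j') ↔
    (i' = i ∧ j' = j) ∨ (i = k ∧ l < j ∧ i' = l ∧ j' = j) ∨
      (j = l ∧ i < k ∧ i' = i ∧ j' = k) := by
  constructor
  · intro h2
    cases h2
    · exact Or.inl ⟨rfl, rfl⟩
    · exact Or.inr (Or.inl ⟨rfl, ‹_›, rfl, rfl⟩)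
    · exact Or.inr (Or.inr ⟨rfl, ‹_›, rfl, rfl⟩)
  · rintro (⟨rfl, rfl⟩ | ⟨rfl, h2, rfl, rfl⟩ | ⟨rfl, h2, rfl, rfl⟩)
    · exact ChordStep.stay _ _ _ _
    · exact ChordStep.jumpTop _ _ _ h2
    · exact ChordStep.jumpBot _ _ _ h2

/-- The transfer operators count the ways to prolong sequences of chords. -/
theorem Represents.transfer {S : List Step} {m : ℕ} {Φ : List Chord → Prop} {φ : Op}
    (h : Represents S m Φ φ) {T : Tangle} (hT : tangleAt S m = some T)
    (hs : T.FitsSize (complexAt S m).deg.length (complexAt S (m + 1)).deg.length)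
    (h0 : ∀ c, c.pos = m + 1 → ¬ Φ [c])
    (h1 : ∀ c P, c.pos = m + 1 → P ≠ [] → (Φ (c :: P) ↔ Φ P)) :
    Represents S (m + 1) Φ (transfer T φ) := by
  intro i j
  have hφ := h.strictTri
  have hm : m + 1 ≤ S.length := by
    by_contra hm
    rw [tangleAt, List.getElem?_eq_none (by omega)] at hT
    simp at hT
  by_cases hin : (⟨m + 1, i, j⟩ : Chord).IsIn S
  swap
  · rw [chordCount_of_not_isIn hin]
    by_cases hij : i < j
    · symm
      refine transfer_eq_zero_of_ge hs (fun i j hj => h.eq_zero (by omega)) ?_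
      by_contra hj
      exact hin ⟨hm, hij, not_le.1 hj⟩
    · exact ((hφ.transfer hs.descends).eq_zero (not_lt.1 hij)).symm
  have hij : i < j := hin.2.1
  have key := fun N hN => chordCount_eq_sum (Ψ := Φ) hin (h0 _ rfl)
    (fun P c' hP _ _ => h1 _ P rfl (by rintro rfl; simp at hP)) N hN
  match T, hT, hs with
  | .sing (.leftCusp k p), hT, _ =>
    rw [key ∅]
    · simp [transfer_leftCusp]
    · intro c'
      rw [follows_iff hT]
      simp only [Finset.notMem_empty, false_iff, not_and]
      rintro - ⟨⟩
  | .sing (.crossing k), hT, hs =>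
    rw [transfer_crossing_entry, if_neg (by omega), add_zero]
    by_cases hk : (i, j) = (k, k + 1)
    · rw [key ∅]
      · obtain ⟨rfl, rfl⟩ := Prod.mk.inj hk
        simp only [Finset.sum_empty, crossingPerm, Equiv.swap_apply_left, Equiv.swap_apply_right]
        exact (hφ.eq_zero (by omega)).symm
      · intro c'
        rw [follows_iff hT]
        simp only [Finset.notMem_empty, false_iff, not_and]
        rintro - h2
        exact ((chordStep_crossing_iff _ _ _).1 h2).1 hk
    · rw [key {⟨m, crossingPerm k i, crossingPerm k j⟩}, Finset.sum_singleton, h]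
      intro c'
      obtain ⟨m', i', j'⟩ := c'
      rw [follows_iff hT, chordStep_crossing_iff]
      simp only [Finset.mem_singleton, Chord.mk.injEq, Prod.mk.injEq]
      tauto
  | .sing (.rightCusp k), hT, hs =>
    rw [transfer_rightCusp_entry, key {⟨m, cuspShift k i, cuspShift k j⟩}, Finset.sum_singleton, h]
    intro c'
    obtain ⟨m', i', j'⟩ := c'
    rw [follows_iff hT, chordStep_rightCusp_iff]
    simp only [Finset.mem_singleton, Chord.mk.injEq, Prod.mk.injEq]
  | .slide k l, hT, hs =>
    have hkl : k < l := hs.1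
    rw [transfer_slide_entry]
    have hz : ∀ {a b : ℕ}, b ≤ a → φ (e a) b = 0 := fun h => hφ.eq_zero h
    by_cases hA : i = k ∧ l < j
    · rw [key {⟨m, i, j⟩, ⟨m, l, j⟩}, Finset.sum_pair (by simp; omega), h, h, if_pos hA.1,
        if_neg (by omega), add_zero]
      rintro ⟨m', i', j'⟩
      rw [follows_iff hT, chordStep_slide_iff]
      simp only [Finset.mem_insert, Finset.mem_singleton, Chord.mk.injEq]
      omega
    · by_cases hB : j = l ∧ i < k
      · rw [key {⟨m, i, j⟩, ⟨m, i, k⟩}, Finset.sum_pair (by simp; omega), h, h, if_neg (by omega),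
          if_pos hB.1, add_zero, if_neg (by omega), add_zero]
        rintro ⟨m', i', j'⟩
        rw [follows_iff hT, chordStep_slide_iff]
        simp only [Finset.mem_insert, Finset.mem_singleton, Chord.mk.injEq]
        omega
      · rw [key {⟨m, i, j⟩}, Finset.sum_singleton, h]
        · split_ifs <;> simp (disch := omega) only [hz, add_zero]
        · rintro ⟨m', i', j'⟩
          rw [follows_iff hT, chordStep_slide_iff]
          simp only [Finset.mem_singleton, Chord.mk.injEq]
          omega

/-- Prolonging sequences of chords by a jump along a mark is the commutator with `e k ↦ e l`. -/
theorem Represents.jump {S : List Step} {m k l : ℕ} {Φ Ψ : List Chord → Prop} {φ : Op}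
    (h : Represents S m Ψ φ) (hT : tangleAt S m = some (.slide k l))
    (hs : (Tangle.slide k l).FitsSize (complexAt S m).deg.length (complexAt S (m + 1)).deg.length)
    (h0 : ∀ c, c.pos = m + 1 → ¬ Φ [c])
    (h1 : ∀ i j P c', P.head? = some c' → c'.pos = m → P.IsChain (Follows S) →
      (Φ (⟨m + 1, i, j⟩ :: P) ↔ Ψ P ∧ c' ≠ ⟨m, i, j⟩)) :
    Represents S (m + 1) Φ (bd (elem k l) φ) := by
  intro i j
  have hφ := h.strictTri
  have hm : m + 1 ≤ S.length := by
    by_contra hm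
    rw [tangleAt, List.getElem?_eq_none (by omega)] at hT
    simp at hT
  have hkl : k < l := hs.1
  have hent : bd (elem k l) φ (e i) j =
      (if i = k then φ (e l) j else 0) + if j = l then φ (e i) k else 0 := by
    rw [← bd_elem_entry, bd_apply, bd_apply, add_comm]
  by_cases hin : (⟨m + 1, i, j⟩ : Chord).IsIn S
  swap
  · rw [chordCount_of_not_isIn hin]
    by_cases hij : i < j
    · have hj : (complexAt S m).deg.length ≤ j := by
        by_contra hj
        exact hin ⟨hm, hij, hs.2.2 ▸ not_le.1 hj⟩
      rw [hent, if_neg (by have := hs.2.1; omega : j ≠ l), h.eq_zero (by omega)]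
      simp
    · exact (((StrictTri.elem hkl).bd hφ).eq_zero (not_lt.1 hij)).symm
  have hij : i < j := hin.2.1
  have key := fun N hN => chordCount_eq_sum
    (Ψ := fun P => Ψ P ∧ P.head? ≠ some (⟨m, i, j⟩ : Chord)) hin (h0 _ rfl)
    (fun P c' hP hf hch => by
      rw [h1 i j P c' hP ((follows_iff hT _).1 hf).1 hch, hP]
      simp) N hN
  have hc1 : chordCount S (fun P => Ψ P ∧ P.head? ≠ some (⟨m, i, j⟩ : Chord)) ⟨m, i, j⟩ = 0 := by
    refine ncard_eq_zero_of_forall fun P hP => ?_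
    obtain ⟨⟨-, -, a⟩, -, b⟩ := hP
    exact b a
  have hc2 : ∀ c : Chord, c ≠ ⟨m, i, j⟩ →
      chordCount S (fun P => Ψ P ∧ P.head? ≠ some (⟨m, i, j⟩ : Chord)) c = chordCount S Ψ c := by
    intro c hc
    rw [chordCount, chordCount]
    congr 2
    ext P
    simp only [Set.mem_ofPred_eq]
    constructor
    · rintro ⟨a, b, -⟩
      exact ⟨a, b⟩
    · rintro ⟨a, b⟩
      refine ⟨a, b, ?_⟩
      rw [a.2.2]
      simpa using hc
  have hz : ∀ {a b : ℕ}, b ≤ a → φ (e a) b = 0 := fun h => hφ.eq_zero h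
  rw [hent]
  by_cases hA : i = k ∧ l < j
  · rw [key {⟨m, i, j⟩, ⟨m, l, j⟩}, Finset.sum_pair (by simp; omega), hc1,
      hc2 _ (by simp; omega), h,
      if_pos hA.1, if_neg (by omega), add_zero, zero_add]
    rintro ⟨m', i', j'⟩
    rw [follows_iff hT, chordStep_slide_iff]
    simp only [Finset.mem_insert, Finset.mem_singleton, Chord.mk.injEq]
    omega
  · by_cases hB : j = l ∧ i < k
    · rw [key {⟨m, i, j⟩, ⟨m, i, k⟩}, Finset.sum_pair (by simp; omega), hc1,
      hc2 _ (by simp; omega), h,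
        if_neg (by omega), if_pos hB.1]
      rintro ⟨m', i', j'⟩
      rw [follows_iff hT, chordStep_slide_iff]
      simp only [Finset.mem_insert, Finset.mem_singleton, Chord.mk.injEq]
      omega
    · rw [key {⟨m, i, j⟩}, Finset.sum_singleton, hc1]
      · split_ifs <;> simp (disch := omega) only [hz, add_zero]
      · rintro ⟨m', i', j'⟩
        rw [follows_iff hT, chordStep_slide_iff]
        simp only [Finset.mem_singleton, Chord.mk.injEq]
        omega

/-- The numbers of strands fit together, from `n` strands at the left on. -/
def SizesFit : ℕ → List Step → Prop
  | _, [] => True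
  | n, s :: S => s.1.FitsSize n s.2.deg.length ∧ SizesFit s.2.deg.length S

theorem length_act_crossing {μ : List ℤ} {k : ℕ} (h : k + 1 < μ.length) :
    ((Singularity.crossing k).act μ).length = μ.length := by
  simp [Singularity.act]; omega

theorem length_act_rightCusp {μ : List ℤ} {k : ℕ} (h : k + 1 < μ.length) :
    ((Singularity.rightCusp k).act μ).length + 2 = μ.length := by
  simp [Singularity.act]; omega

theorem Fits.fitsSize {X Y : OrderedComplex} {T : Tangle} (h : Fits X T Y) :
    T.FitsSize X.deg.length Y.deg.length := by
  match T, h with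
  | .sing (.leftCusp k p), _ => trivial
  | .sing (.crossing k), h => exact ⟨h.1, by rw [h.2.1, length_act_crossing h.1]⟩
  | .sing (.rightCusp k), h => exact ⟨h.1.1, by rw [h.2.1, length_act_rightCusp h.1.1]⟩
  | .slide k l, h => exact ⟨h.1, h.2.1, by rw [h.2.2.2.1]⟩

theorem StepsFit.sizesFit {X : OrderedComplex} {S : List Step} (h : StepsFit X S) :
    SizesFit X.deg.length S := by
  induction S generalizing X with
  | nil => trivial
  | cons s S ih => exact ⟨h.1.fitsSize, ih h.2⟩

theorem tangleAt_append (A B : List Step) (s : Step) :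
    tangleAt (A ++ s :: B) A.length = some s.1 := by
  simp [tangleAt]

theorem lastComplex_append (X : OrderedComplex) (A B : List Step) :
    lastComplex X (A ++ B) = lastComplex (lastComplex X A) B := by
  induction A generalizing X with
  | nil => rfl
  | cons s A ih => exact ih _

/-- Conditions on sequences of chords that do not involve the chords to the right of `x_m`. -/
def StableAbove (m : ℕ) (Φ : List Chord → Prop) : Prop :=
  (∀ c, m < c.pos → ¬ Φ [c]) ∧ ∀ c P, m < c.pos → P ≠ [] → (Φ (c :: P) ↔ Φ P)

theorem StableAbove.mono {m m' : ℕ} {Φ : List Chord → Prop} (h : StableAbove m Φ) (hm : m ≤ m') :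
    StableAbove m' Φ :=
  ⟨fun c hc => h.1 c (by omega), fun c P hc => h.2 c P (by omega)⟩

theorem Represents.step {A B : List Step} {s : Step} {Φ : List Chord → Prop} {φ : Op}
    (h : Represents (A ++ s :: B) A.length Φ φ)
    (hs : s.1.FitsSize (lastComplex OrderedComplex.zero A).deg.length s.2.deg.length)
    (hst : StableAbove A.length Φ) :
    Represents (A ++ s :: B) (A.length + 1) Φ (LegendrianMCS.transfer s.1 φ) := by
  refine h.transfer (tangleAt_append A B s) ?_ (fun c hc => hst.1 c (by omega))
    (fun c P hc => hst.2 c P (by omega))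
  have h1 := complexAt_append (A ++ [s]) B
  rw [List.append_assoc, List.singleton_append, List.length_append, List.length_singleton,
    lastComplex_append] at h1
  rw [h1, complexAt_append]
  exact hs

theorem Represents.transferAll {A M B : List Step} {Φ : List Chord → Prop} {φ : Op}
    (h : Represents (A ++ (M ++ B)) A.length Φ φ)
    (hs : SizesFit (lastComplex OrderedComplex.zero A).deg.length M)
    (hst : StableAbove A.length Φ) :
    Represents (A ++ (M ++ B)) (A ++ M).length Φ (LegendrianMCS.transferAll M φ) := by
  induction M generalizing A φ with
  | nil => simpa [LegendrianMCS.transferAll] using h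
  | cons s M ih =>
    have h1 := h.step hs.1 hst
    have h2 : A ++ (s :: M ++ B) = (A ++ [s]) ++ (M ++ B) := by simp
    have h3 : A ++ s :: M = (A ++ [s]) ++ M := by simp
    rw [h2, h3]
    refine ih ?_ ?_ (hst.mono (by simp))
    · rw [← h2]
      simpa using h1
    · rw [lastComplex_append]
      exact hs.2

theorem numSing_take_mono (S : List Step) {m m' : ℕ} (h : m ≤ m') :
    numSing (S.take m) ≤ numSing (S.take m') := by
  obtain ⟨d, rfl⟩ := Nat.exists_eq_add_of_le h
  rw [List.take_add, numSing_append]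
  omega

theorem isAt_unique {S : List Step} {t m m' : ℕ} {s s' : Singularity} (h : IsAt S t m s)
    (h' : IsAt S t m' s') : m = m' ∧ s = s' := by
  have key : ∀ {m m' s}, IsAt S t m s → numSing (S.take m') = t → ¬ m < m' := by
    intro m m' s h h' hlt
    have h1 := numSing_take_mono S (Nat.succ_le_of_lt hlt)
    have h2 : numSing (S.take (m + 1)) = numSing (S.take m) + 1 := by
      have h3 := h.1
      rw [tangleAt, Option.map_eq_some_iff] at h3
      obtain ⟨⟨T, Y⟩, h4, h5⟩ := h3
      dsimp only at h5
      subst h5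
      rw [List.take_add_one, numSing_append, h4]
      rfl
    have h6 : numSing (S.take m) = t := h.2
    simp only [Nat.succ_eq_add_one] at h1
    omega
  have hm : m = m' := by
    have := key h h'.2
    have := key h' h.2
    omega
  subst hm
  have := h.1.symm.trans h'.1
  simp only [Option.some.injEq, Tangle.sing.injEq] at this
  exact ⟨rfl, this⟩

theorem isAt_append (A B : List Step) (s : Singularity) (Y : OrderedComplex) :
    IsAt (A ++ (.sing s, Y) :: B) (numSing A) A.length s :=
  ⟨tangleAt_append _ _ _, by rw [List.take_left']; rfl; rfl⟩

theorem exists_split {S : List Step} {t : ℕ} (h : t < numSing S) :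
    ∃ A s Y B, S = A ++ (.sing s, Y) :: B ∧ numSing A = t := by
  induction S generalizing t with
  | nil => simp at h
  | cons s S ih =>
    obtain ⟨s | ⟨k, l⟩, Y⟩ := s
    · cases t with
      | zero => exact ⟨[], s, Y, S, rfl, rfl⟩
      | succ t =>
        obtain ⟨A, s', Y', B, h1, h2⟩ := ih (by simpa using h)
        exact ⟨(.sing s, Y) :: A, s', Y', B, by rw [h1]; rfl, by rw [numSing_sing, h2]⟩
    · obtain ⟨A, s', Y', B, h1, h2⟩ := ih (by simpa using h)
      exact ⟨(.slide k l, Y) :: A, s', Y', B, by rw [h1]; rfl, by rw [numSing_slide, h2]⟩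

/-- The number of descending sequences with property `Φ` from a singularity of `B`, in terms of the
functional that represents `Φ` at the left border of `B`. -/
theorem ncard_isDescending {A B : List Step} {Φ : List Chord → Prop} {φ : Op}
    (h : Represents (A ++ B) A.length Φ φ)
    (hs : SizesFit (lastComplex OrderedComplex.zero A).deg.length B)
    (hst : StableAbove A.length Φ) {a : ℕ} (ha : a < numSing B) :
    ({P | IsDescending (A ++ B) (numSing A + a) P ∧ Φ P}.ncard : ZMod 2) = readOff B a φ := by
  obtain ⟨M, s, Y, B, rfl, rfl⟩ := exists_split ha
  have h1 := h.transferAll (A := A) (M := M) (B := (.sing s, Y) :: B) (by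
    clear h hst ha
    generalize (lastComplex OrderedComplex.zero A).deg.length = n at hs
    induction M generalizing n with
    | nil => trivial
    | cons t M ih => exact ⟨hs.1, ih _ hs.2⟩) hst
  have h2 := isAt_append (A ++ M) B s Y
  rw [← List.append_assoc] at h1 ⊢
  rw [← numSing_append]
  generalize A ++ M = A' at *
  have h3 := readOff_append_ge M ((.sing s, Y) :: B) 0 φ
  rw [add_zero] at h3
  rw [h3, readOff_zero]
  generalize LegendrianMCS.transferAll M φ = ψ at *
  have hk : ∀ k, (s = .crossing k ∨ s = .rightCusp k) →
      ({P | IsDescending (A' ++ (.sing s, Y) :: B) (numSing A') P ∧ Φ P}.ncard : ZMod 2) =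
        ψ (e k) (k + 1) := by
    intro k hk
    rw [← h1, chordCount]
    congr 2
    ext P
    simp only [Set.mem_ofPred_eq]
    refine and_congr_left fun _ => ?_
    constructor
    · rintro ⟨a1, ⟨m, k', a2, a3⟩, a4⟩
      refine ⟨a1, a4, ?_⟩
      rw [a3]
      rcases hk with rfl | rfl <;> rcases a2 with a2 | a2 <;>
        obtain ⟨b1, b2⟩ := isAt_unique h2 a2 <;>
        simp_all
    · rintro ⟨a1, a2, a3⟩
      refine ⟨a1, ⟨_, k, ?_, a3⟩, a2⟩
      rcases hk with rfl | rfl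
      exacts [Or.inl h2, Or.inr h2]
  match s with
  | .crossing k => exact hk k (Or.inl rfl)
  | .rightCusp k => exact hk k (Or.inr rfl)
  | .leftCusp k p =>
    refine ncard_eq_zero_of_forall fun P hP => ?_
    obtain ⟨⟨-, ⟨m, k', a2, -⟩, -⟩, -⟩ := hP
    rcases a2 with a2 | a2 <;> simpa using (isAt_unique h2 a2).2

theorem pos_le_of_isChain {S : List Step} {P : List Chord} (hP : P.IsChain (Follows S)) {c : Chord}
    (hc : P.head? = some c) : ∀ x ∈ P, x.pos ≤ c.pos := by
  induction P generalizing c with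
  | nil => simp
  | cons y P ih =>
    obtain rfl : y = c := by simpa using hc
    intro x hx
    rcases List.mem_cons.1 hx with rfl | hx
    · exact le_rfl
    · cases P with
      | nil => simp at hx
      | cons z P =>
        rw [List.isChain_cons_cons] at hP
        have := ih hP.2 rfl x hx
        have := hP.1.1
        omega

/-- The first chord lies over the line immediately to the left of the singularity. -/
theorem IsDescending.pos_le {A B : List Step} {t : ℕ} {P : List Chord} (ht : t < numSing A)
    (h : IsDescending (A ++ B) t P) : ∀ x ∈ P, x.pos < A.length := by
  obtain ⟨A₁, s, Y, A₂, rfl, rfl⟩ := exists_split ht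
  obtain ⟨-, ⟨m, k, h1, h2⟩, h3⟩ := h
  have h4 := isAt_append A₁ (A₂ ++ B) s Y
  have h5 : m = A₁.length := by
    rw [List.append_assoc, List.cons_append] at h1
    rcases h1 with h1 | h1 <;> exact (isAt_unique h1 h4).1
  intro x hx
  have := pos_le_of_isChain h3 h2 x hx
  simp only at this
  simp
  omega

/-- The sequence ends at a chord over `x_m` with property `R`. -/
def EndsIn (m : ℕ) (R : ℕ → ℕ → Prop) (P : List Chord) : Prop :=
  ∃ c, P.getLast? = some c ∧ c.pos = m ∧ R c.top c.bot

theorem endsIn_stableAbove (m : ℕ) (R : ℕ → ℕ → Prop) : StableAbove m (EndsIn m R) := by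
  constructor
  · rintro c hc ⟨c', h1, h2, -⟩
    obtain rfl : c = c' := by simpa using h1
    omega
  · intro c P _ hP
    obtain ⟨x, P, rfl⟩ := List.exists_cons_of_ne_nil hP
    simp only [EndsIn, List.getLast?_cons_cons]

theorem pos_getLast_lt {S : List Step} {c c' x : Chord} {P : List Chord}
    (h : (c :: c' :: P).IsChain (Follows S)) (hx : (c :: c' :: P).getLast? = some x) :
    x.pos < c.pos := by
  rw [List.getLast?_cons_cons] at hx
  rw [List.isChain_cons_cons] at h
  have h1 := pos_le_of_isChain h.2 rfl x (List.mem_of_mem_getLast? hx)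
  have := h.1.1
  omega

theorem represents_endsIn {S : List Step} {m : ℕ} (hm : m ≤ S.length) {R : ℕ → ℕ → Prop} {φ : Op}
    (h1 : ∀ i j, i < j → j < (complexAt S m).deg.length → (R i j ↔ φ (e i) j = 1))
    (h2 : ∀ i j, ¬ (i < j ∧ j < (complexAt S m).deg.length) → φ (e i) j = 0) :
    Represents S m (EndsIn m R) φ := by
  intro i j
  by_cases hij : i < j ∧ j < (complexAt S m).deg.length
  swap
  · rw [h2 i j hij, chordCount_of_not_isIn fun h => hij h.2]
  have hset : {P : List Chord | ((∀ x ∈ P, x.IsIn S) ∧ P.IsChain (Follows S) ∧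
      P.head? = some ⟨m, i, j⟩) ∧ EndsIn m R P} = {P | P = [⟨m, i, j⟩] ∧ R i j} := by
    ext P
    simp only [Set.mem_ofPred_eq]
    constructor
    · rintro ⟨⟨-, a2, a3⟩, c, a4, a5, a6⟩
      match P with
      | [] => simp at a3
      | [x] =>
        obtain rfl : x = c := by simpa using a4
        obtain rfl : x = _ := by simpa using a3
        exact ⟨rfl, a6⟩
      | x :: y :: P =>
        obtain rfl : x = _ := by simpa using a3
        have := pos_getLast_lt a2 a4
        simp only at this
        omega
    · rintro ⟨rfl, hR⟩
      exact ⟨⟨by simpa using ⟨hm, hij⟩, by simp, rfl⟩, _, rfl, rfl, hR⟩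
  rw [chordCount, hset]
  by_cases hR : R i j
  · simp [hR, (h1 i j hij.1 hij.2).1 hR]
  · have h3 : φ (e i) j = 0 := by
      by_contra h3
      exact hR ((h1 i j hij.1 hij.2).2 (Fin.eq_one_of_ne_zero _ h3))
    simp [hR, h3]

theorem terminates_iff {A B : List Step} {k : ℕ} {Y : OrderedComplex} {P : List Chord} :
    Terminates (A ++ (.sing (.crossing k), Y) :: B) (numSing A) P ↔
      EndsIn (A.length + 1) (fun i j =>
        (j = k ∧ (lastComplex OrderedComplex.zero A).d (e i) k = 1) ∨
          (i = k + 1 ∧ (lastComplex OrderedComplex.zero A).d (e (k + 1)) j = 1)) P := by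
  have h1 := isAt_append A B (.crossing k) Y
  have h2 := complexAt_append A ((.sing (.crossing k), Y) :: B)
  constructor
  · rintro ⟨p, k', c, a1, a2, a3, a4⟩
    obtain ⟨rfl, b⟩ := isAt_unique h1 a1
    obtain rfl := Singularity.crossing.inj b
    rw [h2] at a4
    exact ⟨c, a2, a3, a4⟩
  · rintro ⟨c, a2, a3, a4⟩
    refine ⟨_, k, c, h1, a2, a3, ?_⟩
    rw [h2]
    exact a4

theorem not_terminates {A B : List Step} {s : Singularity} {Y : OrderedComplex} {P : List Chord}
    (hs : ∀ k, s ≠ .crossing k) : ¬ Terminates (A ++ (.sing s, Y) :: B) (numSing A) P := by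
  rintro ⟨p, k', c, a1, -⟩
  exact hs k' (isAt_unique (isAt_append A B s Y) a1).2

/-- The operator `birth` records the condition on the last chord of a chord path. -/
theorem represents_birth {A B : List Step} {k : ℕ} {Y : OrderedComplex}
    (hf : Fits (lastComplex OrderedComplex.zero A) (.sing (.crossing k)) Y) :
    Represents (A ++ (.sing (.crossing k), Y) :: B) (A.length + 1)
      (Terminates (A ++ (.sing (.crossing k), Y) :: B) (numSing A)) (birth (.crossing k) Y) := by
  have h0 : Terminates (A ++ (.sing (.crossing k), Y) :: B) (numSing A) = _ :=
    funext fun P => propext terminates_iff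
  rw [h0]
  have h1 := complexAt_append (A ++ [(.sing (.crossing k), Y)]) B
  rw [List.append_assoc, List.singleton_append, List.length_append, List.length_singleton,
    lastComplex_append] at h1
  have h2 : (complexAt (A ++ (.sing (.crossing k), Y) :: B) (A.length + 1)).deg.length =
    Y.deg.length := by rw [h1]; rfl
  have h3 := hf.fitsSize
  have hstr := birth_strictTri hf
  apply represents_endsIn
  · simp
  · intro i j hij hj
    have h4 : birth (.crossing k) Y (e i) j = _ := bd_elem_entry _ _ _ _ _
    rw [h4, crossing_fits_entry hf, crossing_fits_entry hf]
    have h5 : crossingPerm k k = k + 1 := Equiv.swap_apply_left _ _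
    have h6 : crossingPerm k (k + 1) = k := Equiv.swap_apply_right _ _
    rw [h5, h6]
    by_cases hi : i = k + 1
    · rw [if_pos hi, if_neg (by omega), crossingPerm_of_ne (i := j) (by omega), add_zero]
      constructor
      · rintro (⟨h7, -⟩ | ⟨-, h7⟩)
        · omega
        · exact h7
      · exact fun h7 => Or.inr ⟨hi, h7⟩
    · rw [if_neg hi, zero_add]
      by_cases hjk : j = k
      · rw [if_pos hjk, crossingPerm_of_ne (i := i) (by omega)]
        simp [hi, hjk]
      · simp [hi, hjk]
  · intro i j hij
    by_cases hij' : i < j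
    · have h4 : birth (.crossing k) Y (e i) j = _ := bd_elem_entry _ _ _ _ _
      have h5 : Y.d (e k) j = 0 := by
        by_contra h5
        have := (Y.triangular k j h5).2
        omega
      have := h3.1
      have := h3.2
      rw [h4, h5, if_neg (by omega : j ≠ k)]
      simp
    · exact hstr.eq_zero (not_lt.1 hij')

theorem terminates_stableAbove (A B : List Step) (k : ℕ) (Y : OrderedComplex) :
    StableAbove (A.length + 1) (Terminates (A ++ (.sing (.crossing k), Y) :: B) (numSing A)) := by
  have h0 : Terminates (A ++ (.sing (.crossing k), Y) :: B) (numSing A) = _ :=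
    funext fun P => propext terminates_iff
  rw [h0]
  exact endsIn_stableAbove _ _

/-- The coefficients `pathCoeff` count the chord paths. -/
theorem ncard_chordPaths {S : List Step} (hS : StepsFit OrderedComplex.zero S) {a b : ℕ}
    (ha : a < numSing S) (hb : b < numSing S) :
    ((chordPaths S a b).ncard : ZMod 2) = pathCoeff S b a := by
  obtain ⟨A, s, Y, B, rfl, rfl⟩ := exists_split hb
  have hf := hS.append_right
  have hlast : lastComplex OrderedComplex.zero (A ++ [(.sing s, Y)]) = Y := by
    rw [lastComplex_append]; rfl
  have hassoc : A ++ (.sing s, Y) :: B = (A ++ [(.sing s, Y)]) ++ B := by simp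
  have hlen : (A ++ [((.sing s : Tangle), Y)]).length = A.length + 1 := by simp
  have hnum : numSing (A ++ [(.sing s, Y)]) = numSing A + 1 := by rw [numSing_append]; rfl
  by_cases hs : ∀ k, s ≠ .crossing k
  · have h1 : birth s Y = 0 := by
      match s, hs with
      | .leftCusp _ _, _ => rfl
      | .rightCusp _, _ => rfl
      | .crossing k, hs => exact absurd rfl (hs k)
    have h2 : ((chordPaths (A ++ (.sing s, Y) :: B) a (numSing A)).ncard : ZMod 2) = 0 :=
      ncard_eq_zero_of_forall fun P h => not_terminates hs h.2
    rw [h2]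
    rcases Nat.lt_or_ge (numSing A) a with h | h
    · obtain ⟨a, rfl⟩ := Nat.exists_eq_add_of_lt h
      have h3 := pathCoeff_append_ge_ge A ((.sing s, Y) :: B) 0 (a + 1)
      rw [add_zero, ← add_assoc] at h3
      rw [h3]
      simp [pathCoeff, h1]
    · rw [pathCoeff_eq_zero_of_le _ _ _ h]
  · push Not at hs
    obtain ⟨k, rfl⟩ := hs
    have hrep := represents_birth (B := B) hf.1
    have hst := terminates_stableAbove A B k Y
    rcases Nat.lt_or_ge (numSing A) a with h | h
    · obtain ⟨a, rfl⟩ := Nat.exists_eq_add_of_lt h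
      have h3 := pathCoeff_append_ge_ge A ((.sing (.crossing k), Y) :: B) 0 (a + 1)
      rw [add_zero, ← add_assoc] at h3
      rw [h3]
      simp only [pathCoeff]
      rw [hassoc] at hrep hst ha ⊢
      rw [← hlen] at hrep hst
      have h4 := ncard_isDescending hrep (by rw [hlast]; exact hf.2.sizesFit) hst (a := a) (by
        rw [numSing_append, hnum] at ha; omega)
      rw [← h4, hnum]
      rw [show numSing A + a + 1 = numSing A + 1 + a by omega]
      rfl
    · rw [pathCoeff_eq_zero_of_le _ _ _ h]
      refine ncard_eq_zero_of_forall fun P hP => ?_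
      obtain ⟨hP, hP'⟩ := hP
      obtain ⟨c, h1, h2, -⟩ := terminates_iff.1 hP'
      rw [hassoc] at hP
      have := hP.pos_le (by omega) c (List.mem_of_mem_getLast? h1)
      omega

/-- Sequences of chords that end with a given chord are counted by `readOff` of an elementary
operator. -/
theorem ncard_isDescending_getLast {A B : List Step}
    (hB : StepsFit (lastComplex OrderedComplex.zero A) B) {i j : ℕ} (hij : i < j)
    (hj : j < (lastComplex OrderedComplex.zero A).deg.length) {a : ℕ}
    (ha : a < numSing (A ++ B)) :
    ({P | IsDescending (A ++ B) a P ∧ P.getLast? = some ⟨A.length, i, j⟩}.ncard : ZMod 2) =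
      if numSing A ≤ a then readOff B (a - numSing A) (elem i j) else 0 := by
  have h0 : (fun P : List Chord => P.getLast? = some ⟨A.length, i, j⟩) =
      EndsIn A.length (fun i' j' => i' = i ∧ j' = j) := by
    funext P
    apply propext
    constructor
    · exact fun h => ⟨_, h, rfl, rfl, rfl⟩
    · rintro ⟨⟨m, i', j'⟩, h, rfl, rfl, rfl⟩
      exact h
  split_ifs with h
  · obtain ⟨a, rfl⟩ := Nat.exists_eq_add_of_le h
    rw [Nat.add_sub_cancel_left]
    have hrep : Represents (A ++ B) A.length (EndsIn A.length (fun i' j' => i' = i ∧ j' = j))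
        (elem i j) := by
      have hent : ∀ i' j', elem i j (e i') j' = if i' = i ∧ j' = j then 1 else 0 := by
        intro i' j'
        rw [elem_e]
        by_cases h : i' = i <;> by_cases h' : j' = j <;> simp [h, h', e_apply]
        exact fun h'' => absurd h''.symm h'
      apply represents_endsIn
      · simp
      · intro i' j' _ _
        rw [hent]
        simp
      · intro i' j' h'
        rw [complexAt_append] at h'
        rw [hent, if_neg]
        rintro ⟨rfl, rfl⟩
        exact h' ⟨hij, hj⟩
    rw [← h0] at hrep
    exact ncard_isDescending hrep hB.sizesFit (h0 ▸ endsIn_stableAbove _ _)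
      (by rw [numSing_append] at ha; omega)
  · refine ncard_eq_zero_of_forall fun P hP => ?_
    have := hP.1.pos_le (by omega) _ (List.mem_of_mem_getLast? hP.2)
    simp at this

/-- The sequence of chords changes its ends between `x_{p+1}` and `x_p`. -/
def JumpsAt (p : ℕ) (P : List Chord) : Prop :=
  ∃ i j i' j', (⟨p + 1, i, j⟩ : Chord) ∈ P ∧ (⟨p, i', j'⟩ : Chord) ∈ P ∧ (i, j) ≠ (i', j')

/-- Chord paths to the crossing `b` that jump along the mark between `l` and `m` correspond to the
commutator of the functional of `b` with the operator `e l ↦ e m`. -/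
theorem ncard_jumping {A B : List Step} {l m : ℕ} {W : OrderedComplex}
    (hA : StepsFit OrderedComplex.zero A) (hW : lastComplex OrderedComplex.zero A = W)
    (hB : StepsFit W B) (hlm : l < m) (hm : m < W.deg.length) {a b : ℕ}
    (ha : a < numSing (A ++ B)) (hb : b < numSing (A ++ B)) :
    ({P | P ∈ chordPaths (A ++ (.slide l m, W) :: B) a b ∧ JumpsAt A.length P}.ncard : ZMod 2) =
      correction (numSing A) B (fun b => bd (elem l m) (pushedBirth A b)) b a := by
  have hassoc : A ++ (.slide l m, W) :: B = (A ++ [(.slide l m, W)]) ++ B := by simp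
  have hnum : numSing (A ++ [(.slide l m, W)]) = numSing A := by rw [numSing_append]; rfl
  have hlen : (A ++ [((.slide l m : Tangle), W)]).length = A.length + 1 := by simp
  have hlast : lastComplex OrderedComplex.zero (A ++ [(.slide l m, W)]) = W := by
    rw [lastComplex_append]; rfl
  rcases Nat.lt_or_ge b (numSing A) with hbA | hbA
  swap
  · rw [correction_left _ _ _ hbA]
    refine ncard_eq_zero_of_forall fun P hP => ?_
    obtain ⟨⟨⟨-, -, h2⟩, p, k, c, h3, h4, h5, -⟩, -, -, i', j', -, h6, -⟩ := hP
    obtain ⟨b, rfl⟩ := Nat.exists_eq_add_of_le hbA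
    obtain ⟨B₁, s, Y, B₂, rfl, rfl⟩ := exists_split (S := B) (t := b) (by
      rw [numSing_append] at hb; omega)
    have h7 := isAt_append (A ++ (.slide l m, W) :: B₁) B₂ s Y
    rw [numSing_append, numSing_slide, List.append_assoc, List.cons_append] at h7
    have h8 := (isAt_unique h7 h3).1
    simp only [List.length_append, List.length_cons] at h8
    -- every chord of the path lies to the right of its last chord
    have h9 : ∀ P : List Chord,
        P.IsChain (Follows (A ++ (.slide l m, W) :: (B₁ ++ (.sing s, Y) :: B₂))) →
        P.getLast? = some c → ∀ x ∈ P, c.pos ≤ x.pos := by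
      intro P
      induction P with
      | nil => simp
      | cons x P ih =>
        intro a1 a2 y hy
        cases P with
        | nil =>
          obtain rfl : x = c := by simpa using a2
          obtain rfl : y = x := by simpa using hy
          exact le_rfl
        | cons z P =>
          rcases List.mem_cons.1 hy with rfl | hy
          · exact (pos_getLast_lt a1 a2).le
          · rw [List.getLast?_cons_cons] at a2
            exact ih (List.isChain_cons_cons.1 a1).2 a2 y hy
    have := h9 P h2 h4 _ h6
    simp only at this
    omega
  rcases Nat.lt_or_ge a (numSing A) with haA | haA
  · rw [correction_lt _ _ _ _ haA]
    refine ncard_eq_zero_of_forall fun P hP => ?_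
    obtain ⟨⟨h1, -⟩, i, j, -, -, h6, -⟩ := hP
    have := h1.pos_le haA _ h6
    simp at this
  obtain ⟨a, rfl⟩ := Nat.exists_eq_add_of_le haA
  rw [correction_ge _ _ _ hbA]
  obtain ⟨A₁, s, Y, A₂, rfl, rfl⟩ := exists_split hbA
  have hpush : pushedBirth (A₁ ++ (.sing s, Y) :: A₂) (numSing A₁) =
      transferAll A₂ (birth s Y) := by
    have := pushedBirth_append_ge A₁ ((.sing s, Y) :: A₂) 0
    rw [add_zero] at this
    rw [this]; rfl
  have hS : A₁ ++ (.sing s, Y) :: A₂ ++ (.slide l m, W) :: B =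
    A₁ ++ (.sing s, Y) :: (A₂ ++ (.slide l m, W) :: B) := by simp
  by_cases hs : ∀ k, s ≠ .crossing k
  · have h1 : birth s Y = 0 := by
      match s, hs with
      | .leftCusp _ _, _ => rfl
      | .rightCusp _, _ => rfl
      | .crossing k, hs => exact absurd rfl (hs k)
    rw [hpush, h1, map_zero, map_zero, map_zero]
    refine ncard_eq_zero_of_forall fun P hP => ?_
    have := hP.1.2
    rw [hS] at this
    exact not_terminates hs this
  · push Not at hs
    obtain ⟨k, rfl⟩ := hs
    have hf := hA.append_right
    have hrep := represents_birth (B := A₂ ++ (.slide l m, W) :: B) hf.1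
    have hst := terminates_stableAbove A₁ (A₂ ++ (.slide l m, W) :: B) k Y
    rw [← hS] at hrep hst
    set S := A₁ ++ (.sing (.crossing k), Y) :: A₂ ++ (.slide l m, W) :: B with hSdef
    set A := A₁ ++ (.sing (.crossing k), Y) :: A₂ with hAdef
    have hS2 : S = (A₁ ++ [(.sing (.crossing k), Y)]) ++ (A₂ ++ (.slide l m, W) :: B) := by
      simp [hSdef, hAdef]
    have hlen1 : (A₁ ++ [((.sing (.crossing k) : Tangle), Y)]).length = A₁.length + 1 := by simp
    have hrep2 : Represents S A.length (Terminates S (numSing A₁))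
        (pushedBirth A (numSing A₁)) := by
      rw [hpush]
      have h1 := hrep
      rw [← hlen1] at h1
      generalize hQ : Terminates S (numSing A₁) = Ψ at h1 hst ⊢
      rw [hS2] at h1 ⊢
      have h2 := h1.transferAll (by rw [lastComplex_append]; exact hf.2.sizesFit) (by rwa [hlen1])
      convert h2 using 1
      simp [hAdef]
    have hstA := hst.mono (m' := A.length) (by simp [hAdef])
    have hsz : (Tangle.slide l m).FitsSize W.deg.length W.deg.length := ⟨hlm, hm, rfl⟩
    have hcA : complexAt S A.length = W := by rw [hSdef, complexAt_append, hW]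
    have hcA1 : complexAt S (A.length + 1) = W := by
      rw [← hlen, hassoc, complexAt_append, hlast]
    have hrep3 : Represents S (A.length + 1)
        (fun P => Terminates S (numSing A₁) P ∧ JumpsAt A.length P)
        (bd (elem l m) (pushedBirth A (numSing A₁))) := by
      refine hrep2.jump (tangleAt_append A B _) (by rw [hcA, hcA1]; exact hsz) ?_ ?_
      · rintro c hc ⟨h1, -⟩
        exact hstA.1 c (by omega) h1
      · intro i j P c' hP hc' hch
        obtain ⟨P, rfl⟩ : ∃ P', P = c' :: P' := by
          cases P with
          | nil => simp at hP
          | cons x P => exact ⟨P, by simpa using hP⟩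
        rw [hstA.2 _ _ (by simp) (by simp)]
        refine and_congr_right fun _ => ?_
        obtain ⟨q, i₀, j₀⟩ := c'
        dsimp only at hc'
        subst hc'
        have hle := pos_le_of_isChain hch rfl
        constructor
        · rintro ⟨i₁, j₁, i₂, j₂, h1, h2, h3⟩ h4
          have h5 : (⟨A.length + 1, i₁, j₁⟩ : Chord) = ⟨A.length + 1, i, j⟩ := by
            rcases List.mem_cons.1 h1 with h1 | h1
            · exact h1
            · have := hle _ h1
              simp at this
          have h6 : (⟨A.length, i₂, j₂⟩ : Chord) = ⟨A.length, i₀, j₀⟩ := by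
            rcases List.mem_cons.1 h2 with h2 | h2
            · simp at h2
            · rcases List.mem_cons.1 h2 with h2 | h2
              · exact h2
              · cases P with
                | nil => simp at h2
                | cons z P =>
                  rw [List.isChain_cons_cons] at hch
                  have h7 := pos_le_of_isChain hch.2 rfl _ h2
                  have h8 := hch.1.1
                  simp only at h7 h8
                  omega
          simp only [Chord.mk.injEq, true_and] at h4 h5 h6
          apply h3
          rw [h5.1, h5.2, h6.1, h6.2, h4.1, h4.2]
        · intro h4
          refine ⟨i, j, i₀, j₀, by simp, by simp, ?_⟩
          rintro ⟨⟩
          exact h4 rfl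
    have hst3 : StableAbove (A.length + 1)
        (fun P => Terminates S (numSing A₁) P ∧ JumpsAt A.length P) := by
      constructor
      · rintro c hc ⟨h1, -⟩
        exact hstA.1 c (by omega) h1
      · intro c P hc hP
        change _ ∧ _ ↔ _ ∧ _
        rw [hstA.2 c P (by omega) hP]
        refine and_congr_right fun _ => ?_
        constructor
        · rintro ⟨i₁, j₁, i₂, j₂, h1, h2, h3⟩
          refine ⟨i₁, j₁, i₂, j₂, ?_, ?_, h3⟩
          · rcases List.mem_cons.1 h1 with rfl | h1
            · simp at hc
            · exact h1
          · rcases List.mem_cons.1 h2 with rfl | h2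
            · simp only at hc
              omega
            · exact h2
        · rintro ⟨i₁, j₁, i₂, j₂, h1, h2, h3⟩
          exact ⟨i₁, j₁, i₂, j₂, List.mem_cons_of_mem _ h1, List.mem_cons_of_mem _ h2, h3⟩
    rw [← hlen] at hrep3 hst3
    rw [hassoc] at hrep3
    have ha' : a < numSing B := by
      have := numSing_append A B
      omega
    rw [hassoc] at hst3
    have h9 := ncard_isDescending hrep3 (by rw [hlast]; exact hB.sizesFit) hst3 ha'
    rw [← h9, hnum, ← hassoc]
    congr 2
    ext P
    simp only [Set.mem_ofPred_eq, chordPaths, and_assoc]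

/-! ### Degrees -/

/-- The degree of a singularity as a generator, from the potentials at its left. -/
def genDegree (μ : List ℤ) : Singularity → ℤ
  | .leftCusp _ _ => 0
  | .crossing k => μ.getD k 0 - μ.getD (k + 1) 0
  | .rightCusp _ => 1

/-- The degree of the singularity number `a` of a sequence of tangles with the complex `X` at its
left. -/
def degreeAt : OrderedComplex → List Step → ℕ → ℤ
  | _, [], _ => 0
  | _, (.slide _ _, Y) :: S, a => degreeAt Y S a
  | X, (.sing s, _) :: _, 0 => genDegree X.deg s
  | _, (.sing _, Y) :: S, a + 1 => degreeAt Y S a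

/-- The operator lowers the degree by `δ`. -/
def Homogeneous (μ : List ℤ) (δ : ℤ) (φ : Op) : Prop :=
  ∀ i j, φ (e i) j ≠ 0 → μ.getD i 0 - μ.getD j 0 = δ

theorem getD_act_crossing {μ : List ℤ} {k : ℕ} (h : k + 1 < μ.length) (j : ℕ) :
    ((Singularity.crossing k).act μ).getD j 0 = μ.getD (crossingPerm k j) 0 := by
  have h1 : μ = μ.take k ++ μ[k] :: μ[k + 1] :: μ.drop (k + 2) := by
    simp
  have h2 : (μ.take k).length = k := by simp; omega
  generalize μ.take k = A at h1 h2
  generalize μ[k] = x at h1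
  generalize μ[k + 1] = y at h1
  generalize μ.drop (k + 2) = B at h1
  subst h1
  subst h2
  have h3 : (Singularity.crossing A.length).act (A ++ x :: y :: B) = A ++ y :: x :: B := by
    simp [Singularity.act, List.drop_append]
  rw [h3]
  simp only [List.getD_eq_getElem?_getD, crossingPerm, Equiv.swap_apply_def]
  congr 1
  rcases Nat.lt_or_ge j A.length with hj | hj
  · rw [if_neg (by omega), if_neg (by omega), List.getElem?_append_left hj,
      List.getElem?_append_left hj]
  · obtain ⟨j, rfl⟩ := Nat.exists_eq_add_of_le hj
    match j with
    | 0 => simp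
    | 1 => simp
    | j + 2 =>
      rw [if_neg (by omega), if_neg (by omega), List.getElem?_append_right hj,
        List.getElem?_append_right hj]
      simp

theorem getD_act_rightCusp {μ : List ℤ} {k : ℕ} (h : k + 1 < μ.length) (j : ℕ) :
    ((Singularity.rightCusp k).act μ).getD j 0 = μ.getD (cuspShift k j) 0 := by
  simp only [Singularity.act, List.getD_eq_getElem?_getD, cuspShift]
  congr 1
  split_ifs with hj
  · rw [List.getElem?_append_left (by simp; omega), List.getElem?_take_of_lt hj]
  · rw [List.getElem?_append_right (by simp; omega), List.getElem?_drop, List.length_take]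
    congr 1
    omega

theorem OrderedComplex.homogeneous (X : OrderedComplex) : Homogeneous X.deg 1 X.d := by
  intro i j h
  have := X.degree i j h
  omega

theorem Homogeneous.bd {μ : List ℤ} {δ ε : ℤ} {φ ψ : Op} (hφ : Homogeneous μ δ φ)
    (hψ : Homogeneous μ ε ψ) : Homogeneous μ (δ + ε) (bd φ ψ) := by
  have hmul : ∀ {δ ε : ℤ} {φ ψ : Op}, Homogeneous μ δ φ → Homogeneous μ ε ψ → ∀ i j,
      (φ * ψ) (e i) j ≠ 0 → μ.getD i 0 - μ.getD j 0 = δ + ε := by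
    intro δ ε φ ψ hφ hψ i j h
    rw [Module.End.mul_apply, apply_eq_sum] at h
    obtain ⟨r, -, h2⟩ := Finset.exists_ne_zero_of_sum_ne_zero h
    have h3 := hψ i r (left_ne_zero_of_mul h2)
    have h4 := hφ r j (right_ne_zero_of_mul h2)
    omega
  intro i j h
  rw [bd_apply, LinearMap.add_apply, Finsupp.add_apply] at h
  by_cases h1 : (φ * ψ) (e i) j = 0
  · rw [h1, zero_add] at h
    rw [hmul hψ hφ i j h, add_comm]
  · exact hmul hφ hψ i j h1

theorem homogeneous_elem {μ : List ℤ} {δ : ℤ} {i j : ℕ} (h : μ.getD i 0 - μ.getD j 0 = δ) :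
    Homogeneous μ δ (elem i j) := by
  intro a b hab
  rw [elem_e] at hab
  split_ifs at hab with h1
  · rw [e_apply] at hab
    split_ifs at hab with h2
    · rw [h1, ← h2, h]
    · simp at hab
  · simp at hab

theorem Homogeneous.transfer {X Y : OrderedComplex} {T : Tangle} (hf : Fits X T Y) {δ : ℤ} {φ : Op}
    (hφ : Homogeneous X.deg δ φ) : Homogeneous Y.deg δ (transfer T φ) := by
  intro i j h
  match T, hf with
  | .sing (.leftCusp _ _), _ => simp [transfer_leftCusp] at h
  | .sing (.rightCusp k), hf =>
    rw [transfer_rightCusp_entry] at h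
    rw [hf.2.1, getD_act_rightCusp hf.1.1, getD_act_rightCusp hf.1.1]
    exact hφ _ _ h
  | .sing (.crossing k), hf =>
    have hp : k + 1 < X.deg.length := hf.1
    rw [transfer_crossing_entry] at h
    rw [hf.2.1, getD_act_crossing hp, getD_act_crossing hp]
    by_cases hij : i = k + 1 ∧ j = k
    · apply hφ
      intro h0
      apply h
      rw [if_pos hij, h0, zero_add]
      obtain ⟨rfl, rfl⟩ := hij
      simpa only [crossingPerm, Equiv.swap_apply_left, Equiv.swap_apply_right] using h0
    · rw [if_neg hij, add_zero] at h
      exact hφ _ _ h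
  | .slide k l, hf =>
    have hkl : X.deg.getD k 0 = X.deg.getD l 0 := hf.2.2.1
    rw [hf.2.2.2.1]
    rw [transfer_slide_entry] at h
    by_contra hne
    apply h
    have h1 : φ (e i) j = 0 := by
      by_contra h1
      exact hne (hφ _ _ h1)
    have h2 : i = k → φ (e l) j = 0 := by
      rintro rfl
      by_contra h1
      have := hφ _ _ h1
      exact hne (by omega)
    have h3 : j = l → φ (e i) k = 0 := by
      rintro rfl
      by_contra h1
      have := hφ _ _ h1
      exact hne (by omega)
    have h4 : j = l → i = k → φ (e l) k = 0 := by
      rintro rfl rfl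
      by_contra h1
      have := hφ _ _ h1
      exact hne (by omega)
    rw [h1]
    split_ifs with a b b
    · rw [h2 a, h3 b, h4 b a]; simp
    · rw [h2 a]; simp
    · rw [h3 b]; simp
    · simp

theorem degreeAt_eq_of_readOff_ne_zero {X : OrderedComplex} {S : List Step} (hS : StepsFit X S)
    {δ : ℤ} {φ : Op} (hφ : Homogeneous X.deg δ φ) {a : ℕ} (h : readOff S a φ ≠ 0) :
    degreeAt X S a = δ := by
  induction S generalizing X a φ with
  | nil => exact absurd rfl h
  | cons s S ih =>
    obtain ⟨s | ⟨k, l⟩, Y⟩ := s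
    · cases a with
      | zero =>
        rw [readOff_zero] at h
        match s, hS with
        | .leftCusp _ _, _ => exact absurd rfl h
        | .crossing k, _ => exact hφ _ _ h
        | .rightCusp k, hS =>
          have h1 := hφ _ _ h
          have h2 := hS.1.1.2
          simp only [degreeAt, genDegree]
          omega
      | succ a => exact ih hS.2 (hφ.transfer hS.1) h
    · exact ih hS.2 (hφ.transfer hS.1) h

theorem homogeneous_birth {X Y : OrderedComplex} {s : Singularity} (h : Fits X (.sing s) Y) :
    Homogeneous Y.deg (genDegree X.deg s + 1) (birth s Y) := by
  match s, h with
  | .leftCusp _ _, _ => intro i j h; exact absurd rfl h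
  | .rightCusp _, _ => intro i j h; exact absurd rfl h
  | .crossing k, h =>
    rw [add_comm]
    refine Y.homogeneous.bd (homogeneous_elem ?_)
    have hp : k + 1 < X.deg.length := h.1
    rw [h.2.1, getD_act_crossing hp, getD_act_crossing hp]
    simp only [crossingPerm, Equiv.swap_apply_left, Equiv.swap_apply_right, genDegree]

theorem Homogeneous.transferAll {X : OrderedComplex} {S : List Step} (hS : StepsFit X S) {δ : ℤ}
    {φ : Op} (hφ : Homogeneous X.deg δ φ) :
    Homogeneous (lastComplex X S).deg δ (transferAll S φ) := by
  induction S generalizing X φ with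
  | nil => exact hφ
  | cons s S ih => exact ih hS.2 (hφ.transfer hS.1)

theorem homogeneous_pushedBirth {X : OrderedComplex} {S : List Step} (hS : StepsFit X S) (b : ℕ) :
    Homogeneous (lastComplex X S).deg (degreeAt X S b + 1) (pushedBirth S b) := by
  induction S generalizing X b with
  | nil => intro i j h; exact absurd rfl h
  | cons s S ih =>
    obtain ⟨s | ⟨k, l⟩, Y⟩ := s
    · cases b with
      | zero => exact (homogeneous_birth hS.1).transferAll hS.2
      | succ b => exact ih hS.2 b
    · exact ih hS.2 b

/-- Chord paths lower the degree by one. -/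
theorem degreeAt_of_pathCoeff_ne_zero {X : OrderedComplex} {S : List Step} (hS : StepsFit X S)
    {b a : ℕ} (h : pathCoeff S b a ≠ 0) : degreeAt X S a = degreeAt X S b + 1 := by
  induction S generalizing X b a with
  | nil => exact absurd rfl h
  | cons s S ih =>
    obtain ⟨s | ⟨k, l⟩, Y⟩ := s
    · match b, a with
      | 0, 0 => exact absurd rfl h
      | b + 1, 0 => exact absurd rfl h
      | b + 1, a + 1 => exact ih hS.2 h
      | 0, a + 1 => exact degreeAt_eq_of_readOff_ne_zero hS.2 (homogeneous_birth hS.1) h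
    · exact ih hS.2 h

theorem degreeAt_append_lt (X : OrderedComplex) (A B : List Step) {a : ℕ} (ha : a < numSing A) :
    degreeAt X (A ++ B) a = degreeAt X A a := by
  induction A generalizing X a with
  | nil => simp at ha
  | cons s A ih =>
    obtain ⟨s | ⟨k, l⟩, Y⟩ := s
    · cases a with
      | zero => rfl
      | succ a => exact ih _ (by simpa using ha)
    · exact ih _ ha

theorem degreeAt_append_ge (X : OrderedComplex) (A B : List Step) (a : ℕ) :
    degreeAt X (A ++ B) (numSing A + a) = degreeAt (lastComplex X A) B a := by
  induction A generalizing X with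
  | nil => simp [lastComplex]
  | cons s A ih =>
    obtain ⟨s | ⟨k, l⟩, Y⟩ := s
    · rw [List.cons_append, numSing_sing, show numSing A + 1 + a = (numSing A + a) + 1 by omega]
      exact ih _
    · exact ih _

theorem deg_lastComplex {X : OrderedComplex} {A : List Step} (h : StepsFit X A) :
    (lastComplex X A).deg = (A.filterMap fun s => s.1.sing?).foldl Singularity.act X.deg := by
  induction A generalizing X with
  | nil => rfl
  | cons s A ih =>
    have h1 := ih h.2
    obtain ⟨s | ⟨k, l⟩, Y⟩ := s
    · have h2 : Y.deg = s.act X.deg := by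
        match s, h.1 with
        | .leftCusp _ _, h => exact h.2.1
        | .crossing _, h => exact h.2.1
        | .rightCusp _, h => exact h.2.1
      simp only [lastComplex, h1, h2]
      rfl
    · have h2 : Y.deg = X.deg := h.1.2.2.2.1
      simp only [lastComplex, h1, h2]
      rfl

theorem filterMap_sing (s : Singularity) (Y : OrderedComplex) (B : List Step) :
    List.filterMap (fun s : Step => s.1.sing?) ((.sing s, Y) :: B) =
      s :: B.filterMap fun s => s.1.sing? := rfl

theorem MCS.numSing_steps {F : Front} (C : MCS F) : numSing C.steps = F.word.length := by
  rw [numSing, C.front_eq]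

/-- A generator of the front in the sequence of tangles. -/
theorem MCS.exists_split {F : Front} (C : MCS F) (t : Fin F.word.length) :
    ∃ A Y B, C.steps = A ++ (.sing (F.word.get t), Y) :: B ∧ numSing A = t ∧
      A.filterMap (fun s => s.1.sing?) = F.word.take t := by
  obtain ⟨A, s, Y, B, h1, h2⟩ := LegendrianMCS.exists_split (S := C.steps) (t := t)
    (by rw [C.numSing_steps]; exact t.2)
  have h3 := C.front_eq
  rw [h1, List.filterMap_append, filterMap_sing] at h3
  have h4 : (A.filterMap fun s => s.1.sing?).length = t := h2
  have key : ∀ (P Q w : List Singularity) (n : ℕ), P ++ s :: Q = w → P.length = n →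
      w[n]? = some s ∧ P = w.take n := by
    rintro P Q _ _ rfl rfl
    simp
  obtain ⟨h5, h6⟩ := key _ _ _ _ h3 h4
  have h7 : F.word.get t = s := (List.getElem?_eq_some_iff.1 h5).2
  exact ⟨A, Y, B, by rw [h7, h1], h2, h6⟩

theorem MCS.degreeAt_steps {F : Front} (C : MCS F) (q : F.Q) :
    degreeAt OrderedComplex.zero C.steps q.1 = F.degree q := by
  obtain ⟨A, Y, B, h1, h2, h3⟩ := C.exists_split q.1
  have hf := C.fits
  rw [h1] at hf
  have h4 : degreeAt OrderedComplex.zero C.steps q.1 =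
      genDegree (F.strandsBefore q.1) (F.word.get q.1) := by
    have h5 := degreeAt_append_ge OrderedComplex.zero A ((.sing (F.word.get q.1), Y) :: B) 0
    rw [add_zero, h2, ← h1] at h5
    rw [h5]
    simp only [degreeAt]
    rw [deg_lastComplex hf.append_left, h3]
    rfl
  rw [h4, Front.degree]
  cases F.word.get q.1 <;> rfl

/-- Only generators contribute. -/
theorem MCS.pathCoeff_eq_zero {F : Front} (C : MCS F) {t : Fin F.word.length}
    (ht : ¬ (F.word.get t).IsGenerator) (c : ℕ) :
    pathCoeff C.steps c t = 0 ∧ pathCoeff C.steps t c = 0 := by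
  obtain ⟨A, Y, B, h1, h2, -⟩ := C.exists_split t
  obtain ⟨k, p, hs⟩ : ∃ k p, F.word.get t = .leftCusp k p := by
    match h : F.word.get t with
    | .leftCusp k p => exact ⟨k, p, rfl⟩
    | .crossing k => rw [h] at ht; exact absurd trivial ht
    | .rightCusp k => rw [h] at ht; exact absurd trivial ht
  rw [h1, hs, ← h2]
  constructor
  · rcases Nat.lt_or_ge c (numSing A) with hc | hc
    · have := pathCoeff_append_lt_ge A ((.sing (.leftCusp k p), Y) :: B) c 0 hc
      rw [add_zero] at this
      rw [this]; rfl
    · exact pathCoeff_eq_zero_of_le _ _ _ hc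
  · rcases Nat.lt_or_ge (numSing A) c with hc | hc
    · obtain ⟨c, rfl⟩ := Nat.exists_eq_add_of_lt hc
      have := pathCoeff_append_ge_ge A ((.sing (.leftCusp k p), Y) :: B) 0 (c + 1)
      rw [add_zero, ← add_assoc] at this
      rw [this]
      simp [pathCoeff, birth]
    · exact pathCoeff_eq_zero_of_le _ _ _ hc

/-! ### The linearized complexes -/

theorem ofCounts_apply {F : Front} (n : F.Q → F.Q → ZMod 2) (a b : F.Q) :
    ofCounts n (Finsupp.single a 1) b = n a b := by
  rw [ofCounts, Finsupp.linearCombination_single, one_smul, Finsupp.finsetSum_apply,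
    Finset.sum_eq_single b]
  · simp
  · intro c _ hc
    simp [hc]
  · simp

theorem LinSpace.hom_ext {F : Front} {f g : LinSpace F →ₗ[ZMod 2] LinSpace F}
    (h : ∀ a b, f (Finsupp.single a 1) b = g (Finsupp.single a 1) b) : f = g :=
  Finsupp.lhom_ext' fun a => LinearMap.ext_ring (Finsupp.ext (h a))

theorem ofCounts_comp {F : Front} (m n : F.Q → F.Q → ZMod 2) :
    ofCounts n ∘ₗ ofCounts m = ofCounts fun a c => ∑ b, m a b * n b c := by
  apply LinSpace.hom_ext
  intro a c
  rw [ofCounts_apply, LinearMap.comp_apply]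
  have : ofCounts m (Finsupp.single a 1) = ∑ b, m a b • Finsupp.single b 1 := by
    rw [ofCounts, Finsupp.linearCombination_single, one_smul]
  rw [this, map_sum, Finsupp.finsetSum_apply]
  refine Finset.sum_congr rfl fun b _ => ?_
  rw [map_smul, Finsupp.smul_apply, ofCounts_apply, smul_eq_mul]

/-- The degree condition in the definition of `d₁` holds whenever there is a chord path. -/
theorem d₁_eq {F : Front} (C : MCS F) :
    d₁ C = ofCounts fun a b => pathCoeff C.steps b.1 a.1 := by
  rw [d₁]
  congr 1
  funext a b
  have h := ncard_chordPaths C.fits (a := a.1) (b := b.1) (by rw [C.numSing_steps]; exact a.1.2)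
    (by rw [C.numSing_steps]; exact b.1.2)
  rw [h]
  split_ifs with hd
  · rfl
  · by_contra h0
    have := degreeAt_of_pathCoeff_ne_zero C.fits (Ne.symm h0)
    rw [C.degreeAt_steps, C.degreeAt_steps] at this
    exact hd (by omega)

theorem sum_range_eq_sum_generators {F : Front} (f : ℕ → ZMod 2)
    (hf : ∀ t : Fin F.word.length, ¬ (F.word.get t).IsGenerator → f t = 0) :
    ∑ c ∈ Finset.range F.word.length, f c = ∑ q : F.Q, f q.1 := by
  rw [Finset.sum_range, ← Fintype.sum_subtype_add_sum_subtype
    (fun t : Fin F.word.length => (F.word.get t).IsGenerator) fun t => f t]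
  rw [add_eq_left]
  exact Finset.sum_eq_zero fun t _ => hf t.1 t.2

theorem LinSpace.add_self {F : Front} (f : Module.End (ZMod 2) (LinSpace F)) : f + f = 0 := by
  rw [← two_smul (ZMod 2) f]
  have : (2 : ZMod 2) = 0 := rfl
  rw [this, zero_smul]

/-- If the matrices of chord path counts are conjugate by the identity plus a matrix `K` of square
zero, then the corresponding involution is an isomorphism of the linearized complexes. -/
theorem isLinearizedIso_of_correction {F : Front} {C D : MCS F} (K : ℕ → ℕ → ZMod 2)
    (n : F.Q → F.Q → ZMod 2) (hn : ∀ a b : F.Q, n a b = K b.1 a.1)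
    (hrel : ∀ b a, pathCoeff D.steps b a = pathCoeff C.steps b a +
      ∑ c ∈ Finset.range (numSing C.steps), pathCoeff C.steps b c * K c a +
      ∑ c ∈ Finset.range (numSing C.steps), K b c * pathCoeff D.steps c a)
    (hKK : ∀ b a c, K b c * K c a = 0)
    (hdeg : ∀ a b : F.Q, K b.1 a.1 ≠ 0 → F.degree b = F.degree a) :
    ∃ Φ, Φ = LinearMap.id + ofCounts n ∧ Φ ∘ₗ Φ = LinearMap.id ∧ IsLinearizedIso C D Φ := by
  obtain rfl : n = fun a b : F.Q => K b.1 a.1 := funext fun a => funext fun b => hn a b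
  set k : Module.End (ZMod 2) (LinSpace F) := ofCounts fun a b : F.Q => K b.1 a.1 with hk
  set dC : Module.End (ZMod 2) (LinSpace F) := d₁ C with hdC
  set dD : Module.End (ZMod 2) (LinSpace F) := d₁ D with hdD
  have hkk : k * k = 0 := by
    have h1 : k * k = _ := ofCounts_comp _ _
    rw [h1]
    apply LinSpace.hom_ext
    intro a b
    rw [ofCounts_apply]
    exact Finset.sum_eq_zero fun c _ => by rw [mul_comm, hKK]
  have h2 : dD = dC + dC * k + k * dD := by
    have e1 : dC * k = ofCounts fun a b : F.Q =>
        ∑ c ∈ Finset.range (numSing C.steps), pathCoeff C.steps b.1 c * K c a.1 := by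
      rw [hdC, d₁_eq, hk, Module.End.mul_eq_comp, ofCounts_comp, C.numSing_steps]
      congr 1
      funext a b
      rw [sum_range_eq_sum_generators (fun c => pathCoeff C.steps b.1 c * K c a.1)]
      · exact Finset.sum_congr rfl fun c _ => mul_comm _ _
      · intro t ht
        rw [(C.pathCoeff_eq_zero ht _).1, zero_mul]
    have e2 : k * dD = ofCounts fun a b : F.Q =>
        ∑ c ∈ Finset.range (numSing C.steps), K b.1 c * pathCoeff D.steps c a.1 := by
      rw [hdD, d₁_eq, hk, Module.End.mul_eq_comp, ofCounts_comp, C.numSing_steps]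
      congr 1
      funext a b
      rw [sum_range_eq_sum_generators (fun c => K b.1 c * pathCoeff D.steps c a.1)]
      · exact Finset.sum_congr rfl fun c _ => mul_comm _ _
      · intro t ht
        rw [(D.pathCoeff_eq_zero ht _).2, mul_zero]
    rw [e1, e2]
    apply LinSpace.hom_ext
    intro a b
    rw [hdC, hdD, d₁_eq, d₁_eq]
    simp only [LinearMap.add_apply, Finsupp.add_apply, ofCounts_apply]
    exact hrel _ _
  have hinv : (1 + k) * (1 + k) = 1 := by
    have : (1 + k) * (1 + k) = 1 + (k + k) + k * k := by noncomm_ring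
    rw [this, hkk, LinSpace.add_self, add_zero, add_zero]
  have hchain : (1 + k) * dC = dD * (1 + k) := by
    have h3 : (1 + k) * dD = dC * (1 + k) := by
      have : (1 + k) * dD = dD + k * dD := by noncomm_ring
      rw [this]
      nth_rewrite 1 [h2]
      rw [add_assoc, LinSpace.add_self]
      noncomm_ring
    calc (1 + k) * dC = (1 + k) * (dC * (1 + k)) * (1 + k) := by
          rw [mul_assoc, mul_assoc, hinv, mul_one]
      _ = (1 + k) * (1 + k) * dD * (1 + k) := by rw [← h3]; simp only [mul_assoc]
      _ = _ := by rw [hinv, one_mul]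
  refine ⟨1 + k, rfl, hinv, ?_, ?_, hchain⟩
  · exact Function.Involutive.bijective fun x => LinearMap.congr_fun hinv x
  · intro a b h
    by_cases hab : a = b
    · rw [hab]
    · apply hdeg
      intro h0
      apply h
      rw [LinearMap.add_apply, Finsupp.add_apply, hk, ofCounts_apply, h0, add_zero]
      exact Finsupp.single_eq_of_ne (Ne.symm hab)

theorem Front.NearlyPlat.cuspsLast {F : Front} (hF : F.NearlyPlat) (C : MCS F) :
    CuspsLast C.steps := by
  obtain ⟨L, X, R, hw, hL, hX, hR⟩ := hF
  intro A B k Y hAB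
  have h1 := C.front_eq
  rw [hAB, List.filterMap_append, filterMap_sing, hw] at h1
  have hLX : Singularity.rightCusp k ∉ L ++ X := by
    intro h
    rcases List.mem_append.1 h with h | h
    · obtain ⟨_, _, -, h⟩ := hL _ h
      cases h
    · obtain ⟨_, h⟩ := hX _ h
      cases h
  have h2 : ∀ q ∈ Singularity.rightCusp k :: B.filterMap (fun s => s.1.sing?), q ∈ R := by
    intro q hq
    rcases List.append_eq_append_iff.1 h1 with ⟨A', h3, h4⟩ | ⟨A', h3, h4⟩
    · cases A' with
      | nil =>
        rw [List.nil_append] at h4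
        rwa [← h4]
      | cons x A' =>
        rw [List.cons_append, List.cons_eq_cons] at h4
        exact absurd (by rw [h3, h4.1]; simp) hLX
    · rw [h4]
      exact List.mem_append_right _ hq
  rintro ⟨T, Z⟩ hs q rfl
  have hq : q ∈ Singularity.rightCusp k :: B.filterMap (fun s => s.1.sing?) := by
    rcases List.mem_cons.1 hs with h | h
    · cases h
      simp
    · exact List.mem_cons_of_mem _ (List.mem_filterMap.2 ⟨_, h, rfl⟩)
  exact hR q (h2 q hq)

theorem IsLinearizedIso.refl {F : Front} (C : MCS F) : IsLinearizedIso C C LinearMap.id := by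
  refine ⟨Function.bijective_id, ?_, by rw [LinearMap.id_comp, LinearMap.comp_id]⟩
  intro a b hab
  by_contra hne
  apply hab
  rw [LinearMap.id_apply]
  exact Finsupp.single_eq_of_ne fun h => hne (by rw [h])

theorem Move.isLinearizedIso_id {F : Front} (hF : F.NearlyPlat) {C D : MCS F} {κ : MoveType} {p : ℕ}
    (hκ : κ.IsPlain) (h : Move κ p C D) : IsLinearizedIso C D LinearMap.id := by
  have hd : d₁ C = d₁ D := by
    rw [d₁_eq, d₁_eq]
    congr 1
    funext a b
    exact h.pathCoeff_eq hκ (hF.cuspsLast C) _ _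
  have hC := IsLinearizedIso.refl C
  exact ⟨hC.1, hC.2.1, by rw [← hd]; exact hC.2.2⟩

/-- A mark with an end on the crossing strands passes a crossing to the right; `Z = e i₀ ↦ e j₀` is
the error term in the commutation of the mark with the operator of the crossing. -/
theorem crossingEnd_iso {F : Front} (hF : F.NearlyPlat) {C D : MCS F} {i j i' j' m i₀ j₀ : ℕ}
    {X X' Y : OrderedComplex} {A B : List Step}
    (hC : C.steps = A ++ [(.slide i j, X), (.sing (.crossing m), Y)] ++ B)
    (hD : D.steps = A ++ [(.sing (.crossing m), X'), (.slide i' j', Y)] ++ B)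
    (hi : crossingPerm m i = i') (hj : crossingPerm m j = j') (h₀ : i₀ < j₀)
    (hn : j₀ < Y.deg.length)
    (hd : Y.deg.getD i₀ 0 - Y.deg.getD j₀ 0 = X.deg.getD m 0 - X.deg.getD (m + 1) 0)
    (hE : transfer (.slide i' j') (elem (m + 1) m) = elem (m + 1) m + elem i₀ j₀) :
    ∃ Φ, Φ = LinearMap.id + ofCounts (crossingCount C A.length m i₀ j₀) ∧ Φ ∘ₗ Φ = LinearMap.id ∧
      IsLinearizedIso C D Φ := by
  have hCf := C.fits
  have hDf := D.fits
  have hc := hF.cuspsLast C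
  have hassoc : C.steps = A ++ ((.slide i j, X) :: (.sing (.crossing m), Y) :: B) := by
    simp [hC]
  have hassoc' : C.steps = (A ++ [(.slide i j, X)]) ++ ((.sing (.crossing m), Y) :: B) := by
    simp [hC]
  have hlast : lastComplex OrderedComplex.zero
      (A ++ [(.slide i j, X), (.sing (.crossing m), Y)]) = Y := by
    rw [lastComplex_append]; rfl
  have hlast' : lastComplex OrderedComplex.zero (A ++ [(.slide i j, X)]) = X := by
    rw [lastComplex_append]; rfl
  have hnum : numSing (A ++ [(.slide i j, X), (.sing (.crossing m), Y)]) = numSing A + 1 := by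
    rw [numSing_append]; rfl
  have hnum' : numSing (A ++ [(.slide i j, X)]) = numSing A := by
    rw [numSing_append]; rfl
  have hlen' : (A ++ [((.slide i j : Tangle), X)]).length = A.length + 1 := by simp
  have hlen : (A ++ [((.slide i j : Tangle), X), (.sing (.crossing m), Y)]).length =
      A.length + 2 := by
    simp
  have hBf : StepsFit Y B := by
    have := hC ▸ hCf
    have := this.append_right
    rwa [hlast] at this
  have hcB : CuspsLast B := (hC ▸ hc).append_right
  refine isLinearizedIso_of_correction
    (correction (numSing A + 1) B fun b => if b = numSing A then elem i₀ j₀ else 0) _ ?_ ?_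
    (correction_mul_correction _ _ _) ?_
  · intro a q
    have hat : IsAt C.steps q.1 (A.length + 1) (.crossing m) ↔ (q.1 : ℕ) = numSing A := by
      have h1 := isAt_append (A ++ [(.slide i j, X)]) B (.crossing m) Y
      rw [← hassoc', hlen', hnum'] at h1
      constructor
      · intro h
        exact h.2.symm.trans h1.2
      · intro h
        rw [h]
        exact h1
    rw [crossingCount, hat]
    split_ifs with hq
    · have h2 := ncard_isDescending_getLast (A := A ++ [(.slide i j, X), (.sing (.crossing m), Y)])
        (B := B) (a := a.1) (by rw [hlast]; exact hBf) h₀ (by rwa [hlast])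
        (by rw [← hC, C.numSing_steps]; exact a.1.2)
      rw [← hC, hlen, hnum] at h2
      rw [h2]
      simp only [correction, if_pos hq]
      congr 1
      simp [hq]
    · simp only [correction, if_neg hq, map_zero, ite_self]
  · intro b a
    have h3 := pathCoeff_crossingEnd hi hj (hassoc ▸ hCf) (by simpa [hD] using hDf) hcB
      (StrictTri.elem h₀) hE b a
    have h4 : D.steps = A ++ ((.sing (.crossing m), X') :: (.slide i' j', Y) :: B) := by simp [hD]
    rw [hassoc, h4]
    exact h3
  · intro a b h
    rw [← C.degreeAt_steps, ← C.degreeAt_steps]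
    simp only [correction] at h
    split_ifs at h with h1 h2
    · obtain ⟨c, hc⟩ := Nat.exists_eq_add_of_le h1.2
      rw [hc, Nat.add_sub_cancel_left] at h
      have h5 := degreeAt_eq_of_readOff_ne_zero hBf (homogeneous_elem hd) h
      have h6 := degreeAt_append_ge OrderedComplex.zero
        (A ++ [(.slide i j, X), (.sing (.crossing m), Y)]) B c
      rw [hnum, hlast, ← hC, h5] at h6
      have h7 := degreeAt_append_ge OrderedComplex.zero (A ++ [(.slide i j, X)])
        ((.sing (.crossing m), Y) :: B) 0
      rw [hnum', hlast', ← hassoc', add_zero] at h7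
      rw [hc, h6, h2, h7]
      rfl
    · simp at h
    · simp at h

theorem Move.crossingEnd_iso {F : Front} (hF : F.NearlyPlat) {C D : MCS F} {l m p : ℕ}
    (h : Move (.crossingEnd l m) p C D) :
    ∃ Φ, Φ = LinearMap.id + ofCounts (crossingCount C p m l m) ∧ Φ ∘ₗ Φ = LinearMap.id ∧
      IsLinearizedIso C D Φ := by
  obtain ⟨pre, old, new, post, rfl, hC, hD, hm⟩ := h
  cases hm with
  | crossingEnd _ X X' Y _ _ hlm =>
    have hCf := C.fits
    rw [hC, List.append_assoc] at hCf
    have hsl := hCf.append_right.1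
    have hcr := hCf.append_right.2.1
    have hp : m + 1 < X.deg.length := hcr.1
    have h1 : crossingPerm m l = l := crossingPerm_of_ne (by omega)
    have h2 : crossingPerm m m = m + 1 := Equiv.swap_apply_left _ _
    refine LegendrianMCS.crossingEnd_iso hF hC hD h1 h2 hlm ?_ ?_ ?_
    · rw [hcr.2.1, length_act_crossing hp]
      omega
    · rw [hcr.2.1, getD_act_crossing hp, getD_act_crossing hp, h1, h2]
      have h3 := hsl.2.2.1
      have h4 : X.deg = _ := hsl.2.2.2.1
      rw [h4, h3]
    · rw [transfer_slide, handleslideMap_eq, mul_assoc, mul_add, mul_one, elem_mul_elem, if_pos rfl,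
        add_mul, one_mul, mul_add, elem_mul_elem, elem_mul_elem, if_neg (by omega),
        if_neg (by omega), add_zero, add_zero]

theorem Move.crossingEndHor_iso {F : Front} (hF : F.NearlyPlat) {C D : MCS F} {l m p : ℕ}
    (h : Move (.crossingEndHor l m) p C D) :
    ∃ Φ, Φ = LinearMap.id + ofCounts (crossingCount C p m (m + 1) l) ∧ Φ ∘ₗ Φ = LinearMap.id ∧
      IsLinearizedIso C D Φ := by
  obtain ⟨pre, old, new, post, rfl, hC, hD, hm⟩ := h
  cases hm with
  | crossingEndHor _ X X' Y _ _ hlm =>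
    have hCf := C.fits
    rw [hC, List.append_assoc] at hCf
    have hsl := hCf.append_right.1
    have hcr := hCf.append_right.2.1
    have hp : m + 1 < X.deg.length := hcr.1
    have h1 : crossingPerm m l = l := crossingPerm_of_ne (by omega)
    have h2 : crossingPerm m (m + 1) = m := Equiv.swap_apply_right _ _
    refine LegendrianMCS.crossingEnd_iso hF hC hD h2 h1 hlm ?_ ?_ ?_
    · rw [hcr.2.1, length_act_crossing hp]
      have h3 := hsl.2.1
      have h4 : X.deg = _ := hsl.2.2.2.1
      rwa [h4]
    · rw [hcr.2.1, getD_act_crossing hp, getD_act_crossing hp, h1, h2]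
      have h3 := hsl.2.2.1
      have h4 : X.deg = _ := hsl.2.2.2.1
      rw [h4, ← h3]
    · rw [transfer_slide, handleslideMap_eq, mul_assoc, mul_add, mul_one, elem_mul_elem,
        if_neg (by omega), add_zero, add_mul, one_mul, elem_mul_elem, if_pos rfl]

theorem Move.explosion_iso {F : Front} (hF : F.NearlyPlat) {C D : MCS F} {l m p : ℕ}
    (h : Move (.explosion l m) p C D) :
    ∃ Φ, Φ = LinearMap.id + ofCounts (markCount C p l m) ∧ Φ ∘ₗ Φ = LinearMap.id ∧
      IsLinearizedIso C D Φ := by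
  obtain ⟨pre, old, new, post, rfl, hC, hD, hm⟩ := h
  generalize hW : complexAt C.steps pre.length = W at hm
  cases hm with
  | explosion _ _ _ us vs _ hlm hml hdeg hus hu hvs hv hne hnew =>
    rw [List.append_nil] at hC
    have hCf := C.fits
    have hc := hF.cuspsLast C
    rw [hC] at hCf hc
    rw [hC, complexAt_append] at hW
    subst hW
    refine isLinearizedIso_of_correction
      (correction (numSing pre) post fun b => bd (elem l m) (pushedBirth pre b)) _ ?_ ?_
      (correction_mul_correction _ _ _) ?_
    · intro a b
      have hw : withMark C pre.length l m =
          pre ++ (.slide l m, lastComplex OrderedComplex.zero pre) :: post := by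
        rw [withMark, hC, complexAt_append]
        simp
      rw [markCount, hw]
      exact ncard_jumping hCf.append_left rfl hCf.append_right hlm hml
        (by rw [← hC, C.numSing_steps]; exact a.1.2) (by rw [← hC, C.numSing_steps]; exact b.1.2)
    · intro b a
      rw [hC, hD, List.append_assoc]
      exact pathCoeff_explosion hCf hc hlm hus hu hvs hv hnew b a
    · intro a b h
      rw [← C.degreeAt_steps, ← C.degreeAt_steps]
      simp only [correction] at h
      split_ifs at h with h1
      · obtain ⟨c, hcc⟩ := Nat.exists_eq_add_of_le h1.2
        rw [hcc, Nat.add_sub_cancel_left] at h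
        have hG : Homogeneous (lastComplex OrderedComplex.zero pre).deg (-1) (elem l m) :=
          homogeneous_elem (by rw [hdeg]; ring)
        have h2 := degreeAt_eq_of_readOff_ne_zero hCf.append_right
          (hG.bd (homogeneous_pushedBirth hCf.append_left b.1)) h
        rw [hC, hcc, degreeAt_append_ge, h2, degreeAt_append_lt _ _ _ h1.1]
        ring
      · simp at h

/-! ### Equivalent sequences -/

/-- There are mutually inverse isomorphisms between the linearized complexes. -/
def LinearizedEquiv {F : Front} (C D : MCS F) : Prop :=
  ∃ Φ Ψ, Φ ∘ₗ Ψ = LinearMap.id ∧ Ψ ∘ₗ Φ = LinearMap.id ∧ IsLinearizedIso C D Φ ∧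
    IsLinearizedIso D C Ψ

theorem linearizedEquiv_of_involution {F : Front} {C D : MCS F}
    {Φ : LinSpace F →ₗ[ZMod 2] LinSpace F} (h : Φ ∘ₗ Φ = LinearMap.id)
    (hΦ : IsLinearizedIso C D Φ) : LinearizedEquiv C D := by
  refine ⟨Φ, Φ, h, h, hΦ, hΦ.1, hΦ.2.1, ?_⟩
  calc Φ ∘ₗ d₁ D = Φ ∘ₗ (d₁ D ∘ₗ Φ) ∘ₗ Φ := by
        rw [LinearMap.comp_assoc, h, LinearMap.comp_id]
    _ = (Φ ∘ₗ Φ) ∘ₗ d₁ C ∘ₗ Φ := by rw [← hΦ.2.2]; simp only [LinearMap.comp_assoc]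
    _ = d₁ C ∘ₗ Φ := by rw [h, LinearMap.id_comp]

theorem IsLinearizedIso.trans {F : Front} {C D E : MCS F}
    {Φ Ψ : LinSpace F →ₗ[ZMod 2] LinSpace F} (h : IsLinearizedIso C D Φ)
    (h' : IsLinearizedIso D E Ψ) : IsLinearizedIso C E (Ψ ∘ₗ Φ) := by
  refine ⟨h'.1.comp h.1, ?_, ?_⟩
  · intro a c hac
    have h1 : Φ (Finsupp.single a 1) =
        ∑ b ∈ (Φ (Finsupp.single a 1)).support,
          Φ (Finsupp.single a 1) b • Finsupp.single b (1 : ZMod 2) := by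
      conv_lhs => rw [← Finsupp.sum_single (Φ (Finsupp.single a 1))]
      simp [Finsupp.sum]
    rw [LinearMap.comp_apply, h1, map_sum, Finsupp.finsetSum_apply] at hac
    obtain ⟨b, hb, hbc⟩ := Finset.exists_ne_zero_of_sum_ne_zero hac
    rw [map_smul, Finsupp.smul_apply] at hbc
    rw [h'.2.1 b c (right_ne_zero_of_smul hbc), h.2.1 a b (Finsupp.mem_support_iff.1 hb)]
  · rw [LinearMap.comp_assoc, h.2.2, ← LinearMap.comp_assoc, h'.2.2, LinearMap.comp_assoc]

theorem Equivalent.linearizedEquiv {F : Front} (hF : F.NearlyPlat) {C D : MCS F}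
    (h : Equivalent C D) : LinearizedEquiv C D := by
  induction h with
  | rel C D h =>
    obtain ⟨κ, p, h⟩ := h
    have hplain : κ.IsPlain → LinearizedEquiv C D := fun hκ =>
      linearizedEquiv_of_involution (LinearMap.id_comp _) (h.isLinearizedIso_id hF hκ)
    match κ, h, hplain with
    | .crossingEnd l m, h, _ =>
      obtain ⟨Φ, -, h1, h2⟩ := h.crossingEnd_iso hF
      exact linearizedEquiv_of_involution h1 h2
    | .crossingEndHor l m, h, _ =>
      obtain ⟨Φ, -, h1, h2⟩ := h.crossingEndHor_iso hF
      exact linearizedEquiv_of_involution h1 h2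
    | .explosion l m, h, _ =>
      obtain ⟨Φ, -, h1, h2⟩ := h.explosion_iso hF
      exact linearizedEquiv_of_involution h1 h2
    | .cancel, _, hp => exact hp trivial
    | .commute, _, hp => exact hp trivial
    | .commutator, _, hp => exact hp trivial
    | .pastCrossing, _, hp => exact hp trivial
    | .crossingEndVert, _, hp => exact hp trivial
    | .pastCusp, _, hp => exact hp trivial
    | .cuspEnd, _, hp => exact hp trivial
  | refl C =>
    exact linearizedEquiv_of_involution (LinearMap.id_comp _) (IsLinearizedIso.refl C)
  | symm C D _ ih =>
    obtain ⟨Φ, Ψ, h1, h2, h3, h4⟩ := ih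
    exact ⟨Ψ, Φ, h2, h1, h4, h3⟩
  | trans C D E _ _ ih ih' =>
    obtain ⟨Φ, Ψ, h1, h2, h3, h4⟩ := ih
    obtain ⟨Φ', Ψ', h1', h2', h3', h4'⟩ := ih'
    refine ⟨Φ' ∘ₗ Φ, Ψ ∘ₗ Ψ', ?_, ?_, h3.trans h3', h4'.trans h4⟩
    · calc (Φ' ∘ₗ Φ) ∘ₗ Ψ ∘ₗ Ψ' = Φ' ∘ₗ (Φ ∘ₗ Ψ) ∘ₗ Ψ' := by simp only [LinearMap.comp_assoc]
        _ = _ := by rw [h1, LinearMap.id_comp, h1']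
    · calc (Ψ ∘ₗ Ψ') ∘ₗ Φ' ∘ₗ Φ = Ψ ∘ₗ (Ψ' ∘ₗ Φ') ∘ₗ Φ := by simp only [LinearMap.comp_assoc]
        _ = _ := by rw [h2', LinearMap.id_comp, h2]

end LegendrianMCS

theorem theorem5p3 (F : LegendrianMCS.Front) (hF : F.NearlyPlat) :
    -- equivalent sequences have isomorphic linearized complexes
    (∀ C D : LegendrianMCS.MCS F, LegendrianMCS.Equivalent C D →
      ∃ Φ, LegendrianMCS.IsLinearizedIso C D Φ) ∧
    -- the moves for which the identity map is an isomorphism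
    (∀ (C D : LegendrianMCS.MCS F) (κ : LegendrianMCS.MoveType) (p : ℕ),
      κ.IsPlain → LegendrianMCS.Move κ p C D →
      LegendrianMCS.IsLinearizedIso C D LinearMap.id) ∧
    -- the move of a mark with one end on the crossing strands, and its horizontal reflection
    (∀ (C D : LegendrianMCS.MCS F) (l m p : ℕ),
      LegendrianMCS.Move (.crossingEnd l m) p C D →
      ∃ Φ, Φ = LinearMap.id + LegendrianMCS.ofCounts (LegendrianMCS.crossingCount C p m l m) ∧
        Φ ∘ₗ Φ = LinearMap.id ∧ LegendrianMCS.IsLinearizedIso C D Φ) ∧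
    (∀ (C D : LegendrianMCS.MCS F) (l m p : ℕ),
      LegendrianMCS.Move (.crossingEndHor l m) p C D →
      ∃ Φ, Φ = LinearMap.id + LegendrianMCS.ofCounts (LegendrianMCS.crossingCount C p m (m + 1) l) ∧
        Φ ∘ₗ Φ = LinearMap.id ∧ LegendrianMCS.IsLinearizedIso C D Φ) ∧
    -- the move that inserts many marks
    (∀ (C D : LegendrianMCS.MCS F) (l m p : ℕ),
      LegendrianMCS.Move (.explosion l m) p C D →
      ∃ Φ, Φ = LinearMap.id + LegendrianMCS.ofCounts (LegendrianMCS.markCount C p l m) ∧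
        Φ ∘ₗ Φ = LinearMap.id ∧ LegendrianMCS.IsLinearizedIso C D Φ) := by
  refine ⟨fun C D h => ?_, fun C D κ p hκ h => h.isLinearizedIso_id hF hκ,
    fun C D l m p h => h.crossingEnd_iso hF, fun C D l m p h => h.crossingEndHor_iso hF,
    fun C D l m p h => h.explosion_iso hF⟩
  obtain ⟨Φ, -, -, -, h1, -⟩ := h.linearizedEquiv hF
  exact ⟨Φ, h1⟩
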